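/- Everything is over $\mathbb{C}$. Let $\dot{\mathfrak g}$ be a finite-dimensional simple Lie algebra with Cartan subalgebra $\dot{\mathfrak h}$, a base of its root system, the corresponding decomposition $\dot{\mathfrak g}=\dot{\mathfrak g}^-\oplus\dot{\mathfrak h}\oplus\dot{\mathfrak g}^+$, and a nondegenerate symmetric invariant bilinear form $(\cdot,\cdot)$. Let $n\ge 0$, $A=\mathbb{C}[t_0^{\pm1},\dots,t_n^{\pm1}]$, and let $B$ be a finitely generated commutative associative unital algebra. Let $\Omega_A=\bigoplus_{i=0}^n A K_i$, let $dA\subseteq\Omega_A$ be spanned by the elements $\sum_i k_i t^{k}K_i$ $(k\in\mathbb{Z}^{n+1})$, $Z=\Omega_A/dA$, and $D=\bigoplus_{i=0}^n\mathbb{C}d_i$. The loop toroidal Lie algebra is $\tau(B)=\dot{\mathfrak g}\otimes A\otimes B\,\oplus\, Z\otimes B\,\oplus\, D$ with $$[x\otimes t^k\otimes b,\,y\otimes t^r\otimes b']=[x,y]\otimes t^{k+r}\otimes bb'+(x,y)\sum_{i}k_i\,t^{k+r}K_i\otimes bb',$$ $Z\otimes B$ commuting with $\dot{\mathfrak g}\otimes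 A\otimes B\oplus Z\otimes B$, $[d_i,x\otimes t^k\otimes b]=k_i\,x\otimes t^k\otimes b$, $[d_i,t^kK_j\otimes b]=k_i\,t^kK_j\otimes b$ and $[d_i,d_j]=0$. Put $H=\dot{\mathfrak h}\oplus\bigoplus_i\mathbb{C}K_i\oplus\bigoplus_i\mathbb{C}d_i$ (identifying $h$ with $h\otimes1\otimes1$ and $K_i$ with $K_i\otimes 1$), $\tau_1=\dot{\mathfrak g}\otimes A\otimes B$, $\tilde\tau_1=\tau_1\oplus D=\tau(B)/(Z\otimes B)$, and $\mathfrak h_1=\dot{\mathfrak h}\otimes A\otimes B$. A $\tau(B)$-module is integrable if it is the direct sum of its $H$-weight spaces and every $X_\alpha\otimes t^m\otimes b$ ($X_\alpha$ a root vector of $\dot{\mathfrak g}$, $m\in\mathbb{Z}^{n+1}$, $b\in B$) acts locally nilpotently. For a $\mathbb{Z}^{n+1}$-graded algebra homomorphism $\bar\psi:U(\mathfrak h_1)\to A$ with image $A_{\bar\psi}$, let $\dot{\mathfrak g}^+\otimes A\otimes B$ act on $A_{\bar\psi}$ by $0$, let $x\in\mathfrak h_1$ act by multiplication by $\bar\psi(x)$,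 and let $d_i$ act by $d_it^m=m_it^m$. Let $V(\bar\psi)$ be the irreducible quotient (the quotient by the sum of all proper submodules) of the $\tilde\tau_1$-module $U(\tilde\tau_1)\otimes_{U(\dot{\mathfrak g}^+\otimes A\otimes B\oplus\mathfrak h_1\oplus D)}A_{\bar\psi}$. For $\psi\in\mathfrak h_1^*$ let $V(\psi)$ be the irreducible quotient (in the same sense) of the $\tau_1$-module $U(\tau_1)\otimes_{U(\dot{\mathfrak g}^+\otimes A\otimes B\oplus\mathfrak h_1)}\mathbb{C}_\psi$, where $\dot{\mathfrak g}^+\otimes A\otimes B$ acts on the line $\mathbb{C}_\psi$ by $0$ and $\mathfrak h_1$ by $\psi$. Let $E(1):A\to\mathbb{C}$ be the linear map with $E(1)t^m=1$ for all $m$. **Theorem.** Let $V$ be an irreducible integrable $\tau(B)$-module whose $H$-weight spaces are all finite-dimensional and on which $K_0\otimes 1,\dots,K_n\otimes 1$ act by zero. Then there are a $\mathbb{Z}^{n+1}$-graded algebra homomorphism $\bar\psi:U(\mathfrak h_1)\to A$ and $c=(c_0,\dots,c_n)\in\mathbb{C}^{n+1}$ such that $V$ is isomorphic, as a $\tau(B)$-module,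 to $V(\bar\psi)\otimes\mathbb{C}_c$, where $\tau(B)$ acts on $V(\bar\psi)$ through $\tau(B)\to\tilde\tau_1$ (so that $Z\otimes B$ acts by zero) and $\mathbb{C}_c$ is the one-dimensional module on which $\dot{\mathfrak g}\otimes A\otimes B\oplus Z\otimes B$ acts by zero and $d_i$ by $c_i$. Moreover, for this $\bar\psi$ and $\psi=E(1)\circ\bar\psi|_{\mathfrak h_1}$, the $\tau_1$-module $V(\psi)$ is irreducible and finite-dimensional. -/

import Mathlib

open scoped TensorProduct

noncomputable section

namespace LoopToroidal

/-! ### Laurent polynomials in `t_0, …, t_n` and the centre `Ω_A / dA` -/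

/-- `A = ℂ[t_0^{±1}, …, t_n^{±1}]`. -/
abbrev Laurent (n : ℕ) : Type := AddMonoidAlgebra ℂ (Fin (n + 1) → ℤ)

/-- The monomial `t^m`, `m ∈ ℤ^{n+1}`. -/
abbrev mono {n : ℕ} (m : Fin (n + 1) → ℤ) : Laurent n := AddMonoidAlgebra.single m 1

/-- The degree derivation `∑ i, c_i t_i ∂/∂t_i` of `A`, that is `t^m ↦ (∑ i, c_i m_i) t^m`,
linearly in `c ∈ ℂ^{n+1}`. -/
def deg (n : ℕ) : (Fin (n + 1) → ℂ) →ₗ[ℂ] Laurent n →ₗ[ℂ] Laurent n :=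
  LinearMap.flip ((AddMonoidAlgebra.basis (Fin (n + 1) → ℤ) ℂ).constr ℂ fun m =>
    { toFun := fun c => (∑ i, c i * (m i : ℂ)) • mono m
      map_add' := fun c c' => by
        simp only [Pi.add_apply, add_mul, Finset.sum_add_distrib, add_smul]
      map_smul' := fun r c => by
        simp only [Pi.smul_apply, smul_eq_mul, mul_assoc, ← Finset.mul_sum, RingHom.id_apply,
          mul_smul] })

lemma deg_mono {n : ℕ} (c : Fin (n + 1) → ℂ) (m : Fin (n + 1) → ℤ) :
    deg n c (mono m) = (∑ i, c i * (m i : ℂ)) • mono m := by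
  have h := (AddMonoidAlgebra.basis (Fin (n + 1) → ℤ) ℂ).constr_basis ℂ (fun m =>
    ({ toFun := fun c => (∑ i, c i * (m i : ℂ)) • mono m
       map_add' := fun c c' => by
        simp only [Pi.add_apply, add_mul, Finset.sum_add_distrib, add_smul]
       map_smul' := fun r c => by
        simp only [Pi.smul_apply, smul_eq_mul, mul_assoc, ← Finset.mul_sum, RingHom.id_apply,
          mul_smul] } : (Fin (n + 1) → ℂ) →ₗ[ℂ] Laurent n)) m
  exact LinearMap.congr_fun h c

lemma laurent_induction {n : ℕ} {p : Laurent n → Prop} (a : Laurent n)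
    (hm : ∀ m, p (mono m)) (ha : ∀ x y, p x → p y → p (x + y))
    (hs : ∀ (r : ℂ) x, p x → p (r • x)) : p a := by
  have h0 : p 0 := by simpa using hs 0 _ (hm 0)
  have : a ∈ Submodule.span ℂ (Set.range (AddMonoidAlgebra.basis (Fin (n + 1) → ℤ) ℂ)) := by
    rw [Module.Basis.span_eq]; trivial
  induction this using Submodule.span_induction with
  | mem x hx => obtain ⟨m, rfl⟩ := hx; exact hm m
  | zero => exact h0
  | add x y _ _ h1 h2 => exact ha _ _ h1 h2
  | smul r x _ h => exact hs r x h

lemma deg_mul {n : ℕ} (c : Fin (n + 1) → ℂ) (a b : Laurent n) :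
    deg n c (a * b) = deg n c a * b + a * deg n c b := by
  induction a using laurent_induction with
  | hm m =>
    induction b using laurent_induction with
    | hm k =>
      have : (mono m * mono k : Laurent n) = mono (m + k) := by
        simp [mono, AddMonoidAlgebra.single_mul_single]
      rw [this, deg_mono, deg_mono, deg_mono, smul_mul_assoc, mul_smul_comm, this, ← add_smul,
        ← Finset.sum_add_distrib]
      simp [mul_add]
    | ha x y hx hy => simp only [mul_add, map_add, hx, hy]; abel
    | hs r x hx => simp only [mul_smul_comm, map_smul, hx, smul_add]
  | ha x y hx hy => simp only [add_mul, map_add, hx, hy]; abel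
  | hs r x hx => simp only [smul_mul_assoc, map_smul, hx, smul_add]

lemma deg_comm {n : ℕ} (c c' : Fin (n + 1) → ℂ) (a : Laurent n) :
    deg n c (deg n c' a) = deg n c' (deg n c a) := by
  induction a using laurent_induction with
  | hm m => simp only [deg_mono, map_smul]; rw [smul_comm]
  | ha x y hx hy => simp only [map_add, hx, hy]
  | hs r x hx => simp only [map_smul, hx]

/-- `Ω_A`: the vector `(a_0, …, a_n)` stands for `∑ i, a_i K_i`, so that `t^k K_i` is
`Pi.single i (mono k)`. -/
abbrev Omega (n : ℕ) : Type := Fin (n + 1) → Laurent n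

/-- `d : A → Ω_A`, `t^k ↦ ∑ i, k_i t^k K_i`. -/
def dOmega (n : ℕ) : Laurent n →ₗ[ℂ] Omega n :=
  LinearMap.pi fun i => deg n (Pi.single i 1)

/-- `Z = Ω_A / dA`. -/
abbrev ZA (n : ℕ) : Type := Omega n ⧸ LinearMap.range (dOmega n)

/-- `(a, a') ↦ (da) a' ∈ Z`; on monomials
`(t^k, t^r) ↦ ∑ i, k_i t^{k+r} K_i`. -/
def dmul (n : ℕ) : Laurent n →ₗ[ℂ] Laurent n →ₗ[ℂ] ZA n :=
  LinearMap.mk₂ ℂ (fun a a' => (LinearMap.range (dOmega n)).mkQ fun i => dOmega n a i * a')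
    (fun a b a' => by rw [← map_add]; congr 1; ext1 i; simp [add_mul])
    (fun r a a' => by rw [← map_smul]; congr 1; ext1 i; simp)
    (fun a a' b => by rw [← map_add]; congr 1; ext1 i; simp [mul_add])
    (fun r a a' => by rw [← map_smul]; congr 1; ext1 i; simp)

lemma dmul_apply {n : ℕ} (a a' : Laurent n) :
    dmul n a a' = (LinearMap.range (dOmega n)).mkQ fun i => dOmega n a i * a' := rfl

lemma dmul_skew {n : ℕ} (a a' : Laurent n) : dmul n a a' + dmul n a' a = 0 := by
  rw [dmul_apply, dmul_apply, ← map_add, Submodule.mkQ_apply, Submodule.Quotient.mk_eq_zero]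
  refine ⟨a * a', ?_⟩
  ext1 i
  simp [dOmega, deg_mul, mul_comm]

lemma dmul_mul {n : ℕ} (a b c : Laurent n) :
    dmul n (a * b) c = dmul n a (b * c) + dmul n b (a * c) := by
  rw [dmul_apply, dmul_apply, dmul_apply, ← map_add]
  congr 1; ext1 i
  simp only [dOmega, LinearMap.pi_apply, deg_mul, Pi.add_apply]
  ring

/-- The action of `∑ i, c_i d_i` on `Z`: `t^k K_j ↦ (∑ i, c_i k_i) t^k K_j`. -/
def degZ (n : ℕ) : (Fin (n + 1) → ℂ) →ₗ[ℂ] ZA n →ₗ[ℂ] ZA n :=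
  { toFun := fun c => Submodule.mapQ _ _ (LinearMap.pi fun i => deg n c ∘ₗ LinearMap.proj i) (by
      rintro _ ⟨a, rfl⟩
      refine ⟨deg n c a, ?_⟩
      ext1 i
      simp [dOmega, deg_comm c])
    map_add' := fun c c' => by
      refine LinearMap.ext fun z => ?_
      obtain ⟨a, rfl⟩ := Submodule.mkQ_surjective _ z
      change (LinearMap.range (dOmega n)).mkQ (fun i => deg n (c + c') (a i)) =
        (LinearMap.range (dOmega n)).mkQ (fun i => deg n c (a i)) +
          (LinearMap.range (dOmega n)).mkQ (fun i => deg n c' (a i))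
      rw [← map_add]
      congr 1; ext1 i; simp
    map_smul' := fun r c => by
      refine LinearMap.ext fun z => ?_
      obtain ⟨a, rfl⟩ := Submodule.mkQ_surjective _ z
      change (LinearMap.range (dOmega n)).mkQ (fun i => deg n (r • c) (a i)) =
        r • (LinearMap.range (dOmega n)).mkQ (fun i => deg n c (a i))
      rw [← map_smul]
      congr 1; ext1 i; simp }

lemma degZ_mkQ {n : ℕ} (c : Fin (n + 1) → ℂ) (a : Omega n) :
    degZ n c ((LinearMap.range (dOmega n)).mkQ a) =
      (LinearMap.range (dOmega n)).mkQ fun i => deg n c (a i) := rfl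

lemma degZ_comm {n : ℕ} (c c' : Fin (n + 1) → ℂ) (z : ZA n) :
    degZ n c (degZ n c' z) = degZ n c' (degZ n c z) := by
  obtain ⟨a, rfl⟩ := Submodule.mkQ_surjective _ z
  simp only [degZ_mkQ]
  congr 1; ext1 i
  exact deg_comm c c' _

lemma degZ_dmul {n : ℕ} (c : Fin (n + 1) → ℂ) (a b : Laurent n) :
    degZ n c (dmul n a b) = dmul n (deg n c a) b + dmul n a (deg n c b) := by
  simp only [dmul_apply, degZ_mkQ, ← map_add]
  congr 1; ext1 i
  simp only [dOmega, LinearMap.pi_apply, deg_mul, Pi.add_apply, deg_comm c]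

/-! ### The Lie algebras `τ_1`, `τ̃_1` and `τ(B)` -/

/-- A nondegenerate symmetric invariant bilinear form on the Lie algebra `g`.  On a
simple Lie algebra these are the nonzero multiples of the Killing form. -/
structure InvariantForm (g : Type*) [LieRing g] [LieAlgebra ℂ g] where
  form : LinearMap.BilinForm ℂ g
  symm : ∀ x y, form x y = form y x
  invariant : form.lieInvariant g
  nondegenerate : form.Nondegenerate

section

variable (n : ℕ) (g : Type*) [LieRing g] [LieAlgebra ℂ g]
  (B : Type*) [CommRing B] [Algebra ℂ B]

/-- The commutative algebra `A ⊗ B`. -/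
abbrev Coeff : Type _ := Laurent n ⊗[ℂ] B

/-- The Lie algebra `τ_1 = g ⊗ A ⊗ B` (written with the coefficients first), with the bracket
`[x ⊗ a ⊗ b, y ⊗ a' ⊗ b'] = [x, y] ⊗ a a' ⊗ b b'`. -/
def Tau1 : Type _ := Coeff n B ⊗[ℂ] g

instance : LieRing (Tau1 n g B) := LieAlgebra.ExtendScalars.instLieRing ℂ (Coeff n B) g

instance : LieAlgebra ℂ (Tau1 n g B) :=
  LieAlgebra.ExtendScalars.instBaseLieAlgebra ℂ (Coeff n B) g

variable {n g B} in
/-- The element `x ⊗ a ⊗ b` of `τ_1`. -/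
def Tau1.elt (a : Laurent n) (b : B) (x : g) : Tau1 n g B :=
  ((a ⊗ₜ[ℂ] b) ⊗ₜ[ℂ] x : Coeff n B ⊗[ℂ] g)

/-- `Z ⊗ B`. -/
abbrev ZB : Type _ := ZA n ⊗[ℂ] B

/-- `D` acting on `τ_1`: `d_i (x ⊗ t^k ⊗ b) = k_i x ⊗ t^k ⊗ b`. -/
def degTau1 : (Fin (n + 1) → ℂ) →ₗ[ℂ] Tau1 n g B →ₗ[ℂ] Tau1 n g B :=
  (LinearMap.rTensorHom g ∘ₗ LinearMap.rTensorHom B ∘ₗ deg n :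
    (Fin (n + 1) → ℂ) →ₗ[ℂ] (Coeff n B ⊗[ℂ] g) →ₗ[ℂ] (Coeff n B ⊗[ℂ] g))

/-- `D` acting on `Z ⊗ B`: `d_i (t^k K_j ⊗ b) = k_i t^k K_j ⊗ b`. -/
def degZB : (Fin (n + 1) → ℂ) →ₗ[ℂ] ZB n B →ₗ[ℂ] ZB n B :=
  LinearMap.rTensorHom B ∘ₗ degZ n

variable {g}

/-- The cocycle
`(x ⊗ a ⊗ b, y ⊗ a' ⊗ b') ↦ (x, y) (da) a' ⊗ b b' ∈ Z ⊗ B`. -/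
def cocycle (F : InvariantForm g) : Tau1 n g B →ₗ[ℂ] Tau1 n g B →ₗ[ℂ] ZB n B :=
  ((TensorProduct.map₂ (TensorProduct.map₂ (dmul n) (LinearMap.mul ℂ B)) F.form).compr₂
    (TensorProduct.rid ℂ (ZB n B)).toLinearMap :
    (Coeff n B ⊗[ℂ] g) →ₗ[ℂ] (Coeff n B ⊗[ℂ] g) →ₗ[ℂ] ZB n B)

variable {n B}

lemma degTau1_tmul (c : Fin (n + 1) → ℂ) (a : Laurent n) (b : B) (x : g) :
    degTau1 n g B c (Tau1.elt a b x) = Tau1.elt (deg n c a) b x := rfl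

lemma elt_lie (a a' : Laurent n) (b b' : B) (x y : g) :
    ⁅Tau1.elt a b x, Tau1.elt a' b' y⁆ = Tau1.elt (a * a') (b * b') ⁅x, y⁆ :=
  (LieAlgebra.ExtendScalars.bracket_tmul ℂ (Coeff n B) g g (a ⊗ₜ b) (a' ⊗ₜ b') x y).trans
    (by rw [Algebra.TensorProduct.tmul_mul_tmul]; rfl)

lemma elt_add (a a' : Laurent n) (b : B) (x : g) :
    Tau1.elt (a + a') b x = Tau1.elt a b x + Tau1.elt a' b x := by
  unfold Tau1.elt
  rw [TensorProduct.add_tmul, TensorProduct.add_tmul]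
  rfl

lemma elt_smul (r : ℂ) (a : Laurent n) (b : B) (x : g) :
    Tau1.elt (r • a) b x = r • Tau1.elt a b x := rfl

lemma degZB_tmul (c : Fin (n + 1) → ℂ) (z : ZA n) (b : B) :
    degZB n B c (z ⊗ₜ b) = degZ n c z ⊗ₜ b := rfl

lemma cocycle_tmul (F : InvariantForm g) (a a' : Laurent n) (b b' : B) (x y : g) :
    cocycle n B F (Tau1.elt a b x) (Tau1.elt a' b' y) =
      F.form x y • (dmul n a a' ⊗ₜ[ℂ] (b * b')) := rfl

lemma tau1_induction {p : Tau1 n g B → Prop} (u : Tau1 n g B)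
    (ht : ∀ a b x, p (Tau1.elt a b x)) (ha : ∀ u v, p u → p v → p (u + v)) : p u := by
  have h0 : p 0 := by
    have h := ht 0 0 0
    have h' : (Tau1.elt 0 0 0 : Tau1 n g B) = 0 := TensorProduct.tmul_zero _ _
    rwa [h'] at h
  refine TensorProduct.induction_on (motive := p) u h0 (fun s x => ?_) ha
  refine TensorProduct.induction_on (motive := fun s => p (s ⊗ₜ[ℂ] x)) s ?_
    (fun a b => ht a b x) (fun s t hs ht' => ?_)
  · have h' : ((0 : Coeff n B) ⊗ₜ[ℂ] x : Coeff n B ⊗[ℂ] g) = (0 : Tau1 n g B) :=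
      TensorProduct.zero_tmul _ _
    rwa [h']
  · have h' : ((s + t) ⊗ₜ[ℂ] x : Coeff n B ⊗[ℂ] g) =
        ((s ⊗ₜ[ℂ] x : Coeff n B ⊗[ℂ] g) : Tau1 n g B) + (t ⊗ₜ[ℂ] x : Coeff n B ⊗[ℂ] g) :=
      TensorProduct.add_tmul _ _ _
    rw [h']
    exact ha _ _ hs ht'

lemma degTau1_comm (c c' : Fin (n + 1) → ℂ) (u : Tau1 n g B) :
    degTau1 n g B c (degTau1 n g B c' u) = degTau1 n g B c' (degTau1 n g B c u) := by
  induction u using tau1_induction with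
  | ht a b x => simp only [degTau1_tmul, deg_comm c]
  | ha u v hu hv => simp only [map_add, hu, hv]

lemma degZB_comm (c c' : Fin (n + 1) → ℂ) (z : ZB n B) :
    degZB n B c (degZB n B c' z) = degZB n B c' (degZB n B c z) := by
  induction z using TensorProduct.induction_on with
  | zero => simp
  | tmul z b => simp only [degZB_tmul, degZ_comm c]
  | add u v hu hv => simp only [map_add, hu, hv]

lemma degTau1_lie (c : Fin (n + 1) → ℂ) (u v : Tau1 n g B) :
    degTau1 n g B c ⁅u, v⁆ = ⁅degTau1 n g B c u, v⁆ + ⁅u, degTau1 n g B c v⁆ := by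
  induction u using tau1_induction with
  | ht a b x =>
    induction v using tau1_induction with
    | ht a' b' y =>
      simp only [degTau1_tmul, elt_lie, deg_mul, elt_add]
    | ha u v hu hv => simp only [map_add, lie_add, hu, hv]; abel
  | ha u v hu hv => simp only [map_add, add_lie, hu, hv]; abel

lemma degZB_cocycle (F : InvariantForm g) (c : Fin (n + 1) → ℂ) (u v : Tau1 n g B) :
    degZB n B c (cocycle n B F u v) =
      cocycle n B F (degTau1 n g B c u) v + cocycle n B F u (degTau1 n g B c v) := by
  induction u using tau1_induction with
  | ht a b x =>
    induction v using tau1_induction with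
    | ht a' b' y =>
      simp only [degTau1_tmul, cocycle_tmul, map_smul, degZB_tmul, degZ_dmul,
        TensorProduct.add_tmul, smul_add]
    | ha u v hu hv => simp only [map_add, hu, hv]; abel
  | ha u v hu hv => simp only [map_add, LinearMap.add_apply, hu, hv]; abel

lemma cocycle_skew (F : InvariantForm g) (u v : Tau1 n g B) :
    cocycle n B F u v + cocycle n B F v u = 0 := by
  induction u using tau1_induction with
  | ht a b x =>
    induction v using tau1_induction with
    | ht a' b' y =>
      rw [cocycle_tmul, cocycle_tmul, F.symm y x, mul_comm b' b, ← smul_add,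
        ← TensorProduct.add_tmul, dmul_skew, TensorProduct.zero_tmul, smul_zero]
    | ha u v hu hv =>
      rw [map_add, map_add, LinearMap.add_apply, add_add_add_comm, hu, hv, add_zero]
  | ha u v hu hv =>
    rw [map_add, map_add, LinearMap.add_apply, add_add_add_comm, hu, hv, add_zero]

lemma cocycle_self (F : InvariantForm g) (u : Tau1 n g B) : cocycle n B F u u = 0 := by
  have h := cocycle_skew F u u
  rw [← two_smul ℂ] at h
  exact (smul_eq_zero.mp h).resolve_left two_ne_zero

lemma smul_aux {M : Type*} [AddCommGroup M] [Module ℂ M] (r : ℂ) (p q : M) :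
    r • p = r • (p + q) + (-r) • q := by
  rw [smul_add, neg_smul, add_neg_cancel_right]

lemma cocycle_jacobi (F : InvariantForm g) (u v w : Tau1 n g B) :
    cocycle n B F u ⁅v, w⁆ = cocycle n B F ⁅u, v⁆ w + cocycle n B F v ⁅u, w⁆ := by
  induction u using tau1_induction with
  | ht a b x =>
    induction v using tau1_induction with
    | ht a' b' y =>
      induction w using tau1_induction with
      | ht a'' b'' z =>
        simp only [elt_lie, cocycle_tmul, dmul_mul]
        have h1 : F.form ⁅x, y⁆ z = F.form x ⁅y, z⁆ := by
          rw [← lie_skew, map_neg, LinearMap.neg_apply, F.invariant, neg_neg]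
        have h2 : F.form y ⁅x, z⁆ = -F.form x ⁅y, z⁆ := by
          rw [← h1, F.invariant, neg_neg]
        rw [h1, h2, mul_assoc b b' b'', mul_left_comm b' b b'', TensorProduct.add_tmul]
        exact smul_aux (M := ZB n B) (F.form x ⁅y, z⁆) _ _
      | ha u v hu hv => simp only [map_add, lie_add, hu, hv]; abel
    | ha u v hu hv => simp only [map_add, lie_add, add_lie, LinearMap.add_apply, hu, hv]; abel
  | ha u v hu hv => simp only [map_add, add_lie, LinearMap.add_apply, hu, hv]; abel

variable (n g B)

/-- The underlying space of `τ̃_1 = g ⊗ A ⊗ B ⊕ D`; the tuple `c` in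
the second component stands for `∑ i, c_i d_i`. -/
def Tau1D : Type _ := Tau1 n g B × (Fin (n + 1) → ℂ)

instance : AddCommGroup (Tau1D n g B) :=
  inferInstanceAs (AddCommGroup (Tau1 n g B × (Fin (n + 1) → ℂ)))

instance : Module ℂ (Tau1D n g B) :=
  inferInstanceAs (Module ℂ (Tau1 n g B × (Fin (n + 1) → ℂ)))

variable {n g B}

/-- `[u + d, u' + d'] = [u, u'] + d(u') - d'(u)`. -/
instance : Bracket (Tau1D n g B) (Tau1D n g B) where
  bracket x y :=
    ((⁅x.1, y.1⁆ + degTau1 n g B x.2 y.1 - degTau1 n g B y.2 x.1, 0) :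
      Tau1 n g B × (Fin (n + 1) → ℂ))

instance : LieRing (Tau1D n g B) where
  add_lie x y z := by
    refine Prod.ext ?_ ?_
    · change ⁅x.1 + y.1, z.1⁆ + degTau1 n g B (x.2 + y.2) z.1 - degTau1 n g B z.2 (x.1 + y.1) =
        (⁅x.1, z.1⁆ + degTau1 n g B x.2 z.1 - degTau1 n g B z.2 x.1) +
        (⁅y.1, z.1⁆ + degTau1 n g B y.2 z.1 - degTau1 n g B z.2 y.1)
      simp only [map_add, add_lie, LinearMap.add_apply]; abel
    · exact (add_zero (0 : Fin (n + 1) → ℂ)).symm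
  lie_add x y z := by
    refine Prod.ext ?_ ?_
    · change ⁅x.1, y.1 + z.1⁆ + degTau1 n g B x.2 (y.1 + z.1) - degTau1 n g B (y.2 + z.2) x.1 =
        (⁅x.1, y.1⁆ + degTau1 n g B x.2 y.1 - degTau1 n g B y.2 x.1) +
        (⁅x.1, z.1⁆ + degTau1 n g B x.2 z.1 - degTau1 n g B z.2 x.1)
      simp only [map_add, lie_add, LinearMap.add_apply]; abel
    · exact (add_zero (0 : Fin (n + 1) → ℂ)).symm
  lie_self x := by
    refine Prod.ext ?_ rfl
    change ⁅x.1, x.1⁆ + degTau1 n g B x.2 x.1 - degTau1 n g B x.2 x.1 = 0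
    simp
  leibniz_lie x y z := by
    refine Prod.ext ?_ ?_
    · change ⁅x.1, ⁅y.1, z.1⁆ + degTau1 n g B y.2 z.1 - degTau1 n g B z.2 y.1⁆ +
          degTau1 n g B x.2 (⁅y.1, z.1⁆ + degTau1 n g B y.2 z.1 - degTau1 n g B z.2 y.1) -
          degTau1 n g B 0 x.1 =
        (⁅⁅x.1, y.1⁆ + degTau1 n g B x.2 y.1 - degTau1 n g B y.2 x.1, z.1⁆ +
          degTau1 n g B 0 z.1 -
          degTau1 n g B z.2 (⁅x.1, y.1⁆ + degTau1 n g B x.2 y.1 - degTau1 n g B y.2 x.1)) +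
        (⁅y.1, ⁅x.1, z.1⁆ + degTau1 n g B x.2 z.1 - degTau1 n g B z.2 x.1⁆ +
          degTau1 n g B y.2 (⁅x.1, z.1⁆ + degTau1 n g B x.2 z.1 - degTau1 n g B z.2 x.1) -
          degTau1 n g B 0 y.1)
      simp only [map_add, map_sub, add_lie, lie_add, sub_lie, lie_sub, degTau1_lie, map_zero,
        LinearMap.zero_apply, leibniz_lie x.1 y.1 z.1, degTau1_comm x.2 y.2,
        degTau1_comm x.2 z.2, degTau1_comm y.2 z.2, ← lie_skew (degTau1 n g B y.2 x.1) z.1,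
        ← lie_skew (degTau1 n g B z.2 x.1) y.1]
      abel
    · exact (add_zero (0 : Fin (n + 1) → ℂ)).symm

instance : LieAlgebra ℂ (Tau1D n g B) where
  lie_smul r x y := by
    refine Prod.ext ?_ ?_
    · change ⁅x.1, r • y.1⁆ + degTau1 n g B x.2 (r • y.1) - degTau1 n g B (r • y.2) x.1 =
        r • (⁅x.1, y.1⁆ + degTau1 n g B x.2 y.1 - degTau1 n g B y.2 x.1)
      simp only [map_smul, lie_smul, LinearMap.smul_apply, smul_add, smul_sub]
    · exact (smul_zero r).symm

/-- The inclusion `τ_1 ⊆ τ̃_1`. -/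
def Tau1D.ofTau1 : Tau1 n g B →ₗ[ℂ] Tau1D n g B :=
  LinearMap.inl ℂ (Tau1 n g B) (Fin (n + 1) → ℂ)

/-- The inclusion `D ⊆ τ̃_1`. -/
def Tau1D.ofD : (Fin (n + 1) → ℂ) →ₗ[ℂ] Tau1D n g B :=
  LinearMap.inr ℂ (Tau1 n g B) (Fin (n + 1) → ℂ)

variable (n B)

/-- The underlying space of the loop toroidal Lie algebra
`τ(B) = g ⊗ A ⊗ B ⊕ Z ⊗ B ⊕ D`.  The form is recorded because the bracket depends on it. -/
@[nolint unusedArguments]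
def Tau (_F : InvariantForm g) : Type _ := Tau1 n g B × ZB n B × (Fin (n + 1) → ℂ)

instance (F : InvariantForm g) : AddCommGroup (Tau n B F) :=
  inferInstanceAs (AddCommGroup (Tau1 n g B × ZB n B × (Fin (n + 1) → ℂ)))

instance (F : InvariantForm g) : Module ℂ (Tau n B F) :=
  inferInstanceAs (Module ℂ (Tau1 n g B × ZB n B × (Fin (n + 1) → ℂ)))

variable {n B}

/-- `[u + z + d, u' + z' + d'] = ([u, u'] + d(u') - d'(u)) + (ω(u, u') + d(z') - d'(z))`, with
`ω` the cocycle above. -/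
instance (F : InvariantForm g) : Bracket (Tau n B F) (Tau n B F) where
  bracket x y :=
    ((⁅x.1, y.1⁆ + degTau1 n g B x.2.2 y.1 - degTau1 n g B y.2.2 x.1,
      cocycle n B F x.1 y.1 + degZB n B x.2.2 y.2.1 - degZB n B y.2.2 x.2.1, 0) :
      Tau1 n g B × ZB n B × (Fin (n + 1) → ℂ))

/-- The projection `τ(B) → τ̃_1` killing `Z ⊗ B`, as a linear map. -/
def Tau.projLin (F : InvariantForm g) : Tau n B F →ₗ[ℂ] Tau1D n g B where
  toFun x := ((x.1, x.2.2) : Tau1 n g B × (Fin (n + 1) → ℂ))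
  map_add' _ _ := rfl
  map_smul' _ _ := rfl

lemma Tau.ext' {F : InvariantForm g} {x y : Tau n B F}
    (h : Tau.projLin F x = Tau.projLin F y) (h' : x.2.1 = y.2.1) : x = y :=
  Prod.ext (congrArg (fun z : Tau1D n g B => z.1) h)
    (Prod.ext h' (congrArg (fun z : Tau1D n g B => z.2) h))

lemma Tau.projLin_lie {F : InvariantForm g} (x y : Tau n B F) :
    Tau.projLin F ⁅x, y⁆ = ⁅Tau.projLin F x, Tau.projLin F y⁆ := rfl

instance (F : InvariantForm g) : LieRing (Tau n B F) where
  add_lie x y z := by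
    refine Tau.ext' ?_ ?_
    · simp only [map_add, Tau.projLin_lie, add_lie]
    · change cocycle n B F (x.1 + y.1) z.1 + degZB n B (x.2.2 + y.2.2) z.2.1 -
          degZB n B z.2.2 (x.2.1 + y.2.1) =
        (cocycle n B F x.1 z.1 + degZB n B x.2.2 z.2.1 - degZB n B z.2.2 x.2.1) +
        (cocycle n B F y.1 z.1 + degZB n B y.2.2 z.2.1 - degZB n B z.2.2 y.2.1)
      simp only [map_add, LinearMap.add_apply]; abel
  lie_add x y z := by
    refine Tau.ext' ?_ ?_
    · simp only [map_add, Tau.projLin_lie, lie_add]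
    · change cocycle n B F x.1 (y.1 + z.1) + degZB n B x.2.2 (y.2.1 + z.2.1) -
          degZB n B (y.2.2 + z.2.2) x.2.1 =
        (cocycle n B F x.1 y.1 + degZB n B x.2.2 y.2.1 - degZB n B y.2.2 x.2.1) +
        (cocycle n B F x.1 z.1 + degZB n B x.2.2 z.2.1 - degZB n B z.2.2 x.2.1)
      simp only [map_add, LinearMap.add_apply]; abel
  lie_self x := by
    refine Tau.ext' ?_ ?_
    · simp only [Tau.projLin_lie, lie_self, map_zero]
    · change cocycle n B F x.1 x.1 + degZB n B x.2.2 x.2.1 - degZB n B x.2.2 x.2.1 = 0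
      rw [cocycle_self]; simp
  leibniz_lie x y z := by
    refine Tau.ext' ?_ ?_
    · simp only [map_add, Tau.projLin_lie, leibniz_lie (Tau.projLin F x)]
    · change cocycle n B F x.1 (⁅y.1, z.1⁆ + degTau1 n g B y.2.2 z.1 - degTau1 n g B z.2.2 y.1) +
          degZB n B x.2.2 (cocycle n B F y.1 z.1 + degZB n B y.2.2 z.2.1 -
            degZB n B z.2.2 y.2.1) - degZB n B 0 x.2.1 =
        (cocycle n B F (⁅x.1, y.1⁆ + degTau1 n g B x.2.2 y.1 - degTau1 n g B y.2.2 x.1) z.1 +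
          degZB n B 0 z.2.1 - degZB n B z.2.2 (cocycle n B F x.1 y.1 +
            degZB n B x.2.2 y.2.1 - degZB n B y.2.2 x.2.1)) +
        (cocycle n B F y.1 (⁅x.1, z.1⁆ + degTau1 n g B x.2.2 z.1 - degTau1 n g B z.2.2 x.1) +
          degZB n B y.2.2 (cocycle n B F x.1 z.1 + degZB n B x.2.2 z.2.1 -
            degZB n B z.2.2 x.2.1) - degZB n B 0 y.2.1)
      have h1 : cocycle n B F y.1 (degTau1 n g B z.2.2 x.1) =
          - cocycle n B F (degTau1 n g B z.2.2 x.1) y.1 :=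
        eq_neg_of_add_eq_zero_left (cocycle_skew F _ _)
      have h2 : cocycle n B F (degTau1 n g B y.2.2 x.1) z.1 =
          - cocycle n B F z.1 (degTau1 n g B y.2.2 x.1) :=
        eq_neg_of_add_eq_zero_left (cocycle_skew F _ _)
      simp only [map_add, map_sub, LinearMap.add_apply, LinearMap.sub_apply, degZB_cocycle,
        map_zero, LinearMap.zero_apply, cocycle_jacobi F x.1 y.1 z.1, degZB_comm x.2.2 y.2.2,
        degZB_comm x.2.2 z.2.2, degZB_comm y.2.2 z.2.2, h1, h2]
      abel

instance (F : InvariantForm g) : LieAlgebra ℂ (Tau n B F) where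
  lie_smul r x y := by
    refine Tau.ext' ?_ ?_
    · simp only [map_smul, Tau.projLin_lie, lie_smul]
    · change cocycle n B F x.1 (r • y.1) + degZB n B x.2.2 (r • y.2.1) -
          degZB n B (r • y.2.2) x.2.1 =
        r • (cocycle n B F x.1 y.1 + degZB n B x.2.2 y.2.1 - degZB n B y.2.2 x.2.1)
      simp only [map_smul, LinearMap.smul_apply, smul_add, smul_sub]

/-- The projection `τ(B) → τ̃_1 = τ(B) / (Z ⊗ B)`. -/
def Tau.proj (F : InvariantForm g) : Tau n B F →ₗ⁅ℂ⁆ Tau1D n g B :=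
  { Tau.projLin F with map_lie' := fun {x y} => Tau.projLin_lie x y }

/-- The coordinates of the `D`-component: `c_0, …, c_n` for an element `u + z + ∑ i, c_i d_i`. -/
def Tau.dCoord {F : InvariantForm g} (x : Tau n B F) : Fin (n + 1) → ℂ := x.2.2

/-- The inclusion `τ_1 = g ⊗ A ⊗ B ⊆ τ(B)` of vector spaces. -/
def Tau.ofTau1 (F : InvariantForm g) : Tau1 n g B →ₗ[ℂ] Tau n B F :=
  LinearMap.inl ℂ (Tau1 n g B) (ZB n B × (Fin (n + 1) → ℂ))

/-- The inclusion `Z ⊗ B ⊆ τ(B)`. -/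
def Tau.ofZB (F : InvariantForm g) : ZB n B →ₗ[ℂ] Tau n B F :=
  LinearMap.inr ℂ (Tau1 n g B) (ZB n B × (Fin (n + 1) → ℂ)) ∘ₗ
    LinearMap.inl ℂ (ZB n B) (Fin (n + 1) → ℂ)

/-- The inclusion `D ⊆ τ(B)`. -/
def Tau.ofD (F : InvariantForm g) : (Fin (n + 1) → ℂ) →ₗ[ℂ] Tau n B F :=
  LinearMap.inr ℂ (Tau1 n g B) (ZB n B × (Fin (n + 1) → ℂ)) ∘ₗ
    LinearMap.inr ℂ (ZB n B) (Fin (n + 1) → ℂ)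

/-- `∑ i, c_i K_i ∈ Z`. -/
def centralK (n : ℕ) : (Fin (n + 1) → ℂ) →ₗ[ℂ] ZA n :=
  (LinearMap.range (dOmega n)).mkQ ∘ₗ
    LinearMap.pi fun i => (LinearMap.proj i).smulRight (1 : Laurent n)

/-! ### Integrable modules -/

/-- The abelian Lie algebra `h ⊕ ⨁ ℂ K_i ⊕ ⨁ ℂ d_i`, as a vector space;
`(x, k, c)` stands for `x + ∑ i, k_i K_i + ∑ i, c_i d_i`. -/
abbrev FullCartan (n : ℕ) (H : LieSubalgebra ℂ g) : Type _ :=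
  H × (Fin (n + 1) → ℂ) × (Fin (n + 1) → ℂ)

/-- The map from `h ⊕ ⨁ ℂ K_i ⊕ ⨁ ℂ d_i` to `τ(B)`:
`x ↦ x ⊗ 1 ⊗ 1`, `K_i ↦ K_i ⊗ 1`, `d_i ↦ d_i`. -/
def FullCartan.toTau (F : InvariantForm g) (H : LieSubalgebra ℂ g) (x : FullCartan n H) :
    Tau n B F :=
  Tau.ofTau1 F (Tau1.elt 1 1 (x.1 : g)) +
    Tau.ofZB F (centralK n x.2.1 ⊗ₜ[ℂ] (1 : B)) + Tau.ofD F x.2.2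

section Modules

variable (F : InvariantForm g) (H : LieSubalgebra ℂ g) (n B)
  (V : Type*) [AddCommGroup V] [Module ℂ V] [LieRingModule (Tau n B F) V]
  [LieModule ℂ (Tau n B F) V]

/-- The weight space `V_lam`, for `lam` a linear form on `h ⊕ ⨁ ℂ K_i ⊕ ⨁ ℂ d_i`. -/
def weightSpace (lam : Module.Dual ℂ (FullCartan n H)) : Submodule ℂ V where
  carrier := {v | ∀ x : FullCartan n H, ⁅(x.toTau F H : Tau n B F), v⁆ = lam x • v}
  add_mem' := fun {v w} hv hw x => by
    rw [lie_add, hv x, hw x, smul_add]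
  zero_mem' := fun x => by simp
  smul_mem' := fun r v hv x => by
    rw [lie_smul, hv x, smul_comm]

open Classical in
/-- Integrable modules: `V` is the direct sum of its weight spaces, and the elements
`X_α ⊗ t^m ⊗ b`, with `X_α` a root vector of `g`, act locally nilpotently. -/
structure IsIntegrable [LieRing.IsNilpotent H] : Prop where
  weight : DirectSum.IsInternal (weightSpace n B F H V : Module.Dual ℂ (FullCartan n H) → _)
  nilpotent : ∀ α : LieModule.Weight ℂ H g, α.IsNonZero →
    ∀ X ∈ LieAlgebra.rootSpace H α, ∀ (m : Fin (n + 1) → ℤ) (b : B) (v : V), ∃ k : ℕ,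
      ((LieModule.toEnd ℂ (Tau n B F) V (Tau.ofTau1 F (Tau1.elt (mono m) b X))) ^ k) v = 0

end Modules

end

/-! ### Induced modules and irreducible quotients -/

section Induced

attribute [local instance] LieRing.ofAssociativeRing

/-- The canonical map `L → U(L)`, as a linear map. -/
def iotaLin (L : Type*) [LieRing L] [LieAlgebra ℂ L] : L →ₗ[ℂ] UniversalEnvelopingAlgebra ℂ L :=
  (UniversalEnvelopingAlgebra.ι ℂ : L →ₗ⁅ℂ⁆ UniversalEnvelopingAlgebra ℂ L)

variable (L : Type*) [LieRing L] [LieAlgebra ℂ L]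
  {P W : Type*} [AddCommGroup P] [Module ℂ P] [AddCommGroup W] [Module ℂ W]
  (j : P →ₗ[ℂ] L) (act : P →ₗ[ℂ] Module.End ℂ W)

/-- The `U(L)`-submodule of `U(L) ⊗ W` generated by the elements `u p ⊗ w - u ⊗ p w`. -/
def inducedRel :
    Submodule (UniversalEnvelopingAlgebra ℂ L) (UniversalEnvelopingAlgebra ℂ L ⊗[ℂ] W) :=
  Submodule.span _ {x | ∃ (u : UniversalEnvelopingAlgebra ℂ L) (p : P) (w : W),
    x = (u * UniversalEnvelopingAlgebra.ι ℂ (j p)) ⊗ₜ[ℂ] w - u ⊗ₜ[ℂ] act p w}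

/-- The induced module `U(L) ⊗_{U(P)} W`.  Here `j` embeds the space of a Lie subalgebra `P`
in `L`, and `act` is the action of `P` on `W`; the tensor product over `U(P)` is the quotient of
`U(L) ⊗ W` by the relations `u p ⊗ w = u ⊗ p w` for `p ∈ P`, because `P` generates `U(P)`. -/
def Induced : Type _ := (UniversalEnvelopingAlgebra ℂ L ⊗[ℂ] W) ⧸ inducedRel L j act

instance : AddCommGroup (Induced L j act) :=
  inferInstanceAs (AddCommGroup (_ ⧸ inducedRel L j act))

instance : Module (UniversalEnvelopingAlgebra ℂ L) (Induced L j act) :=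
  inferInstanceAs (Module _ (_ ⧸ inducedRel L j act))

instance : Module ℂ (Induced L j act) :=
  inferInstanceAs (Module ℂ (_ ⧸ inducedRel L j act))

instance : IsScalarTower ℂ (UniversalEnvelopingAlgebra ℂ L) (Induced L j act) :=
  inferInstanceAs (IsScalarTower ℂ (UniversalEnvelopingAlgebra ℂ L) (_ ⧸ inducedRel L j act))

/-- `L` acts through `L → U(L)`. -/
instance : LieRingModule L (Induced L j act) where
  bracket x m := UniversalEnvelopingAlgebra.ι ℂ x • m
  add_lie x y m := by
    change UniversalEnvelopingAlgebra.ι ℂ (x + y) • m = _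
    rw [map_add, add_smul]
  lie_add x m m' := smul_add _ m m'
  leibniz_lie x y m := by
    change UniversalEnvelopingAlgebra.ι ℂ x • UniversalEnvelopingAlgebra.ι ℂ y • m =
      UniversalEnvelopingAlgebra.ι ℂ ⁅x, y⁆ • m +
        UniversalEnvelopingAlgebra.ι ℂ y • UniversalEnvelopingAlgebra.ι ℂ x • m
    rw [LieHom.map_lie, LieRing.of_associative_ring_bracket, sub_smul, mul_smul, mul_smul]
    abel

instance : LieModule ℂ L (Induced L j act) where
  smul_lie r x m := by
    change UniversalEnvelopingAlgebra.ι ℂ (r • x) • m =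
      r • (UniversalEnvelopingAlgebra.ι ℂ x • m)
    rw [map_smul, smul_assoc]
  lie_smul r x m := by
    change UniversalEnvelopingAlgebra.ι ℂ x • (r • m) =
      r • (UniversalEnvelopingAlgebra.ι ℂ x • m)
    rw [← algebraMap_smul (UniversalEnvelopingAlgebra ℂ L) r m,
      ← algebraMap_smul (UniversalEnvelopingAlgebra ℂ L) r (UniversalEnvelopingAlgebra.ι ℂ x • m),
      ← mul_smul, ← mul_smul, Algebra.commutes]

/-- The quotient of a module by the sum of all its proper submodules: the unique irreducible
quotient whenever there is a largest proper submodule and `M ≠ 0`. -/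
abbrev IrredQuotient (M : Type*) [AddCommGroup M] [Module ℂ M] [LieRingModule L M]
    [LieModule ℂ L M] : Type _ :=
  M ⧸ (sSup {N : LieSubmodule ℂ L M | N ≠ ⊤})

end Induced

/-! ### Graded morphisms `U(h ⊗ A ⊗ B) → A` and the highest weight modules -/

section HighestWeight

attribute [local instance] LieRing.ofAssociativeRing

variable (n : ℕ) {g : Type*} [LieRing g] [LieAlgebra ℂ g] (H : LieSubalgebra ℂ g)
  (B : Type*) [CommRing B] [Algebra ℂ B]

/-- `h_1 = h ⊗ A ⊗ B`. -/
abbrev Cartan1 : Type _ := Tau1 n H B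

variable {n H B} in
/-- The generator `h ⊗ t^r ⊗ b` of `U(h_1)`. -/
def gen (r : Fin (n + 1) → ℤ) (b : B) (h : H) : UniversalEnvelopingAlgebra ℂ (Cartan1 n H B) :=
  UniversalEnvelopingAlgebra.ι ℂ (Tau1.elt (mono r) b h)

/-- The degree `m` component of `U(h_1)`: the span of the products
`(h_1 ⊗ t^{r_1} ⊗ b_1) ⋯ (h_k ⊗ t^{r_k} ⊗ b_k)` with `r_1 + ⋯ + r_k = m`. -/
def gradedPiece (m : Fin (n + 1) → ℤ) :
    Submodule ℂ (UniversalEnvelopingAlgebra ℂ (Cartan1 n H B)) :=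
  Submodule.span ℂ {u | ∃ l : List ((Fin (n + 1) → ℤ) × B × H),
    (l.map fun q => q.1).sum = m ∧ u = (l.map fun q => gen q.1 q.2.1 q.2.2).prod}

/-- A `ℤ^{n+1}`-graded algebra homomorphism `U(h_1) → A`. -/
structure GradedHom where
  toAlgHom : UniversalEnvelopingAlgebra ℂ (Cartan1 n H B) →ₐ[ℂ] Laurent n
  graded : ∀ m, ∀ u ∈ gradedPiece n H B m, toAlgHom u ∈ Submodule.span ℂ {mono m}

variable {n H B}

namespace GradedHom

/-- `A_ψ`, the image of the graded morphism. -/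
abbrev image (ψ : GradedHom n H B) : Subalgebra ℂ (Laurent n) := ψ.toAlgHom.range

lemma uea_induction {L : Type*} [LieRing L] [LieAlgebra ℂ L]
    (T : Subalgebra ℂ (UniversalEnvelopingAlgebra ℂ L))
    (hT : ∀ x : L, UniversalEnvelopingAlgebra.ι ℂ x ∈ T) (u : UniversalEnvelopingAlgebra ℂ L) :
    u ∈ T := by
  let f : L →ₗ⁅ℂ⁆ T :=
    { toFun := fun x => ⟨UniversalEnvelopingAlgebra.ι ℂ x, hT x⟩
      map_add' := fun x y => Subtype.ext (map_add _ x y)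
      map_smul' := fun r x => Subtype.ext (map_smul _ r x)
      map_lie' := fun {x y} => Subtype.ext (LieHom.map_lie _ x y) }
  have h : T.val.comp (UniversalEnvelopingAlgebra.lift ℂ f) = AlgHom.id ℂ _ := by
    apply UniversalEnvelopingAlgebra.hom_ext
    ext x
    change ((UniversalEnvelopingAlgebra.lift ℂ f (UniversalEnvelopingAlgebra.ι ℂ x) : T) :
      UniversalEnvelopingAlgebra ℂ L) = UniversalEnvelopingAlgebra.ι ℂ x
    rw [UniversalEnvelopingAlgebra.lift_ι_apply]
    rfl
  have h' := AlgHom.congr_fun h u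
  rw [AlgHom.id_apply] at h'
  rw [← h']
  exact (UniversalEnvelopingAlgebra.lift ℂ f u).2

lemma deg_mem_image (ψ : GradedHom n H B) (c : Fin (n + 1) → ℂ) {a : Laurent n}
    (ha : a ∈ ψ.image) : deg n c a ∈ ψ.image := by
  obtain ⟨u, rfl⟩ := ha
  let T : Subalgebra ℂ (UniversalEnvelopingAlgebra ℂ (Cartan1 n H B)) :=
    { carrier := {u | deg n c (ψ.toAlgHom u) ∈ ψ.image}
      mul_mem' := fun {u v} hu hv => by
        change deg n c (ψ.toAlgHom (u * v)) ∈ ψ.image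
        rw [map_mul, deg_mul]
        exact add_mem (mul_mem hu ⟨v, rfl⟩) (mul_mem ⟨u, rfl⟩ hv)
      add_mem' := fun {u v} hu hv => by
        change deg n c (ψ.toAlgHom (u + v)) ∈ ψ.image
        rw [map_add, map_add]
        exact add_mem hu hv
      algebraMap_mem' := fun r => by
        change deg n c (ψ.toAlgHom (algebraMap ℂ _ r)) ∈ ψ.image
        have h1 : (1 : Laurent n) = mono 0 := rfl
        rw [AlgHom.commutes, Algebra.algebraMap_eq_smul_one, map_smul, h1, deg_mono]
        simp }
  refine uea_induction T (fun x => ?_) u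
  change deg n c (ψ.toAlgHom (UniversalEnvelopingAlgebra.ι ℂ x)) ∈ ψ.image
  induction x using tau1_induction with
  | ht a b h =>
    induction a using laurent_induction with
    | hm m =>
      have hm : ψ.toAlgHom (gen m b h) ∈ Submodule.span ℂ {mono m} :=
        ψ.graded m _ (Submodule.subset_span ⟨[(m, b, h)], by simp, by simp⟩)
      obtain ⟨r, hr⟩ := Submodule.mem_span_singleton.mp hm
      change deg n c (ψ.toAlgHom (gen m b h)) ∈ ψ.image
      have : deg n c (ψ.toAlgHom (gen m b h)) =
          (∑ i, c i * (m i : ℂ)) • ψ.toAlgHom (gen m b h) := by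
        rw [← hr, map_smul, deg_mono, smul_comm]
      rw [this]
      exact ψ.image.smul_mem ⟨_, rfl⟩ _
    | ha x y hx hy =>
      simp only [elt_add, map_add]
      exact add_mem hx hy
    | hs r x hx =>
      simp only [elt_smul, map_smul]
      exact ψ.image.smul_mem hx _
  | ha u v hu hv =>
    simp only [map_add]
    exact add_mem hu hv

/-- `D` acting on `A_ψ`: `d_i t^m = m_i t^m`. -/
def actD (ψ : GradedHom n H B) : (Fin (n + 1) → ℂ) →ₗ[ℂ] Module.End ℂ ψ.image :=
  LinearMap.mk₂ ℂ (fun c a => ⟨deg n c a, ψ.deg_mem_image c a.2⟩)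
    (fun c c' a => Subtype.ext (by simp)) (fun r c a => Subtype.ext (by simp))
    (fun c a a' => Subtype.ext (by simp)) (fun r c a => Subtype.ext (by simp))

/-- `h_1` acting on `A_ψ`: `x` acts by multiplication by its image under the morphism. -/
def actCartan (ψ : GradedHom n H B) : Cartan1 n H B →ₗ[ℂ] Module.End ℂ ψ.image :=
  LinearMap.mul ℂ ψ.image ∘ₗ ψ.toAlgHom.rangeRestrict.toLinearMap ∘ₗ
    iotaLin (Cartan1 n H B)

/-- The linear map `E(1) : A → ℂ`, `t^r ↦ 1`. -/
def evalOne (n : ℕ) : Laurent n →ₗ[ℂ] ℂ :=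
  (AddMonoidAlgebra.basis (Fin (n + 1) → ℤ) ℂ).constr ℂ fun _ => (1 : ℂ)

/-- `E(1)` composed with the graded morphism, as a linear form on `h_1`. -/
def evalAtOne (ψ : GradedHom n H B) : Module.Dual ℂ (Cartan1 n H B) :=
  evalOne n ∘ₗ ψ.toAlgHom.toLinearMap ∘ₗ
    iotaLin (Cartan1 n H B)

end GradedHom

variable [FiniteDimensional ℂ g] [LieAlgebra.IsSimple ℂ g] [H.IsCartanSubalgebra]

/-- `g⁺`, the sum of the root spaces of the roots that are positive for the base `Δ`. -/
def gPlus (Δ : (LieAlgebra.IsKilling.rootSystem H).Base) : Submodule ℂ g :=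
  ⨆ α : {α // Δ.IsPos α},
    (LieAlgebra.rootSpace H ((LieAlgebra.IsKilling.rootSystem H).root α)).toSubmodule

/-- The inclusion of `g⁺ ⊗ A ⊗ B` in `τ_1`. -/
def inclPlus (Δ : (LieAlgebra.IsKilling.rootSystem H).Base) :
    Coeff n B ⊗[ℂ] gPlus Δ →ₗ[ℂ] Tau1 n g B :=
  (LinearMap.lTensor (Coeff n B) (gPlus Δ).subtype :
    Coeff n B ⊗[ℂ] gPlus Δ →ₗ[ℂ] Coeff n B ⊗[ℂ] g)

/-- The inclusion of `h_1 = h ⊗ A ⊗ B` in `τ_1`. -/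
def inclCartan : Cartan1 n H B →ₗ[ℂ] Tau1 n g B :=
  (LinearMap.lTensor (Coeff n B) H.toSubmodule.subtype :
    Coeff n B ⊗[ℂ] H →ₗ[ℂ] Coeff n B ⊗[ℂ] g)

/-- The module `M(ψ̄)` of `τ̃_1` induced from the module `A_ψ̄` of
`g⁺ ⊗ A ⊗ B ⊕ h_1 ⊕ D`, on which `g⁺ ⊗ A ⊗ B` acts by zero. -/
abbrev MGraded (Δ : (LieAlgebra.IsKilling.rootSystem H).Base) (ψ : GradedHom n H B) : Type _ :=
  Induced (Tau1D n g B)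
    (P := (Coeff n B ⊗[ℂ] gPlus Δ) × Cartan1 n H B × (Fin (n + 1) → ℂ)) (W := ψ.image)
    ((Tau1D.ofTau1 ∘ₗ inclPlus Δ).coprod ((Tau1D.ofTau1 ∘ₗ inclCartan).coprod Tau1D.ofD))
    ((0 : Coeff n B ⊗[ℂ] gPlus Δ →ₗ[ℂ] Module.End ℂ ψ.image).coprod
      (ψ.actCartan.coprod ψ.actD))

/-- `V(ψ̄)`, the irreducible quotient of `M(ψ̄)`. -/
abbrev VGraded (Δ : (LieAlgebra.IsKilling.rootSystem H).Base) (ψ : GradedHom n H B) : Type _ :=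
  IrredQuotient (Tau1D n g B) (MGraded Δ ψ)

/-- The module `M(ψ)` of `τ_1` induced from the one-dimensional module of
`g⁺ ⊗ A ⊗ B ⊕ h_1` on which `g⁺ ⊗ A ⊗ B` acts by zero and `h_1` by `ψ`. -/
abbrev MNongraded (Δ : (LieAlgebra.IsKilling.rootSystem H).Base)
    (ψ : Module.Dual ℂ (Cartan1 n H B)) : Type _ :=
  Induced (Tau1 n g B) (P := (Coeff n B ⊗[ℂ] gPlus Δ) × Cartan1 n H B) (W := ℂ)
    ((inclPlus Δ).coprod inclCartan)
    ((0 : Coeff n B ⊗[ℂ] gPlus Δ →ₗ[ℂ] Module.End ℂ ℂ).coprod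
      (ψ.smulRight (1 : Module.End ℂ ℂ)))

/-- `V(ψ)`, the irreducible quotient of `M(ψ)`. -/
abbrev VNongraded (Δ : (LieAlgebra.IsKilling.rootSystem H).Base)
    (ψ : Module.Dual ℂ (Cartan1 n H B)) : Type _ :=
  IrredQuotient (Tau1 n g B) (MNongraded Δ ψ)

end HighestWeight

end LoopToroidal

end

/-!
All actions are turned into linear maps `a` from `τ_1 = g ⊗ A ⊗ B` (and `D` from `ℂ^{n+1}`) to
`End V` that satisfy the commutation relations, so that subspaces, quotients and twists can be
used without choosing module structures.

**A highest weight vector.** At level zero `e ⊗ t^m`, `f ⊗ t^{-m}`, `h ⊗ 1` act as an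
`sl₂`-triple, so a weight on which a coroot takes a value at least two can be lowered into any
other component of the `D`-grading (`mem_of_lower_mem`). With `m = 0` this shows that one
component of the `D`-grading lies in the `g`-module generated by its finitely many small weights;
hence it is finite-dimensional (`exists_finiteDimensional_component`). With arbitrary `m` the
whole module has only finitely many weights for `h` (`finite_weights`). A weight of maximal height
gives a space `T` of vectors killed by `g⁺ ⊗ A ⊗ B`, and the operators `f ⊗ c` are nilpotent
on it. To leading order `(e ⊗ 1)^k (f ⊗ c)^k` acts on `T` as `k! (h ⊗ c)^k`; commuting `k` times
with `h ⊗ u` leaves a power of the central element `(h, h) (du) c` (`commutator_nilpotent`). So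
`Z ⊗ B` acts nilpotently, hence by zero, on the irreducible module (`exists_highestWeightVector`).

**The graded morphism.** Let `v₀` be a highest weight vector and shift `D` so that it has degree
zero. Every nonzero homogeneous vector of the highest weight part `U(h_1) v₀` generates it, since
the submodule generated by an `h_1`-stable space of highest weight vectors contains no further
vectors of the highest weight part
(`IsHighestWeightSystem.exists_cartanAct_eq`). So `U(h_1) v₀` is a commutative graded algebra
whose nonzero homogeneous elements are invertible and whose degree zero part is finite-dimensional,
hence equal to `ℂ`. Its degrees form a free abelian group, so it embeds in the Laurent polynomials
(`exists_graded_embedding`); this is the morphism `ψ̄`, and `U(h_1) v₀` is a copy of `A_ψ̄`. Both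
`V` and `V(ψ̄)` are then the quotient of the induced module by its largest proper submodule
(`IsHighestWeightSystem.exists_equiv_vGraded`).

**Finite-dimensionality.** Divide `V`, as a `τ_1`-module, by the submodule generated by the kernel
of `E(1)` on `A_ψ̄`. The image of `v₀` is nonzero and generates an integrable module of highest
weight `E(1) ∘ ψ̄`. In such a module local nilpotency of `f` yields a polynomial relation between
the `f ⊗ c^j` on the highest weight vector (`exists_relation_of_nilpotent`, a form of Garland's
argument), so the coefficients that act by zero form an ideal of finite codimension in the
finitely generated algebra `A ⊗ B`. The module is therefore acted on by a finite-dimensional Lie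
algebra with locally finite generators, and is finite-dimensional
(`finiteDimensional_of_highestWeight`); it has `V(E(1) ∘ ψ̄)` as a quotient.
-/

open scoped TensorProduct

set_option linter.unusedSectionVars false

namespace LoopToroidal

/-! ### Operators on a complex vector space -/

section Operators

variable {V : Type*} [AddCommGroup V] [Module ℂ V]

/-- Commutation of `f` with powers of `e` on a weight vector. -/
lemma sl2_lower_raise {e f h : Module.End ℂ V} (hef : e * f - f * e = h)
    (hhe : h * e - e * h = (2 : ℂ) • e) {v : V} {p : ℂ} (hv : h v = p • v) (a : ℕ) :
    h ((e ^ a) v) = (p + 2 * a) • (e ^ a) v ∧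
    f ((e ^ (a + 1)) v) = (e ^ (a + 1)) (f v) - (((a : ℂ) + 1) * (p + a)) • (e ^ a) v := by
  have h1 : ∀ w, e (f w) - f (e w) = h w := fun w => LinearMap.congr_fun hef w
  have h2 : ∀ w, h (e w) - e (h w) = (2 : ℂ) • e w := fun w => LinearMap.congr_fun hhe w
  induction a with
  | zero =>
    refine ⟨by simpa using hv, ?_⟩
    have := h1 v
    simp only [zero_add, pow_one, pow_zero, Module.End.one_apply, Nat.cast_zero, add_zero, one_mul]
    rw [← hv, ← this]; abel
  | succ a ih =>
    obtain ⟨ih1, ih2⟩ := ih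
    have h3 : h ((e ^ (a + 1)) v) = (p + 2 * ((a + 1 : ℕ) : ℂ)) • (e ^ (a + 1)) v := by
      have := h2 ((e ^ a) v)
      rw [ih1, map_smul] at this
      rw [pow_succ', Module.End.mul_apply, sub_eq_iff_eq_add.mp this]
      push_cast
      module
    refine ⟨h3, ?_⟩
    have := h1 ((e ^ (a + 1)) v)
    rw [h3, ih2, map_sub, map_smul] at this
    rw [pow_succ' e (a + 1), Module.End.mul_apply, Module.End.mul_apply]
    rw [pow_succ' e a] at this ⊢
    simp only [Module.End.mul_apply] at this ⊢
    rw [sub_eq_iff_eq_add] at this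
    rw [← sub_eq_iff_eq_add'.mpr this]
    push_cast
    module

/-- The lowering operator of an `sl₂` acts injectively on vectors of positive weight, modulo a
subspace stable under the locally nilpotent raising operator. -/
lemma sl2_mem {e f h : Module.End ℂ V} (hef : e * f - f * e = h)
    (hhe : h * e - e * h = (2 : ℂ) • e) (E : Submodule ℂ V) (hE : ∀ w ∈ E, e w ∈ E)
    (hE' : ∀ w ∈ E, f w ∈ E) {v : V} {p : ℕ} (hp : 0 < p) (hv : h v = (p : ℂ) • v)
    (hnil : ∃ k, (e ^ k) v = 0) (hfv : f v ∈ E) : v ∈ E := by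
  by_contra hvE
  have hex : ∃ k, (e ^ k) v ∈ E := by
    obtain ⟨k, hk⟩ := hnil
    exact ⟨k, hk ▸ E.zero_mem⟩
  classical
  obtain hk : (e ^ Nat.find hex) v ∈ E := Nat.find_spec hex
  have hmin : ∀ m, m < Nat.find hex → (e ^ m) v ∉ E := fun m hm => Nat.find_min hex hm
  cases hn : Nat.find hex with
  | zero => rw [hn] at hk; exact hvE (by simpa using hk)
  | succ a =>
    rw [hn] at hk
    have ha := hmin a (by omega)
    have hs := (sl2_lower_raise hef hhe hv a).2
    have hpow : ∀ (m : ℕ) (w : V), w ∈ E → (e ^ m) w ∈ E := by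
      intro m
      induction m with
      | zero => intro w hw; simpa using hw
      | succ m ih => intro w hw; rw [pow_succ', Module.End.mul_apply]; exact hE _ (ih w hw)
    have hmem : (((a : ℂ) + 1) * ((p : ℂ) + a)) • (e ^ a) v ∈ E := by
      have : (((a : ℂ) + 1) * ((p : ℂ) + a)) • (e ^ a) v =
          (e ^ (a + 1)) (f v) - f ((e ^ (a + 1)) v) := by rw [hs]; abel
      rw [this]
      exact E.sub_mem (hpow _ _ hfv) (hE' _ hk)
    refine ha ((E.smul_mem_iff ?_).mp hmem)
    have h1 : ((a : ℂ) + 1) * ((p : ℂ) + a) = (((a + 1) * (p + a) : ℕ) : ℂ) := by push_cast; ring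
    rw [h1, Nat.cast_ne_zero]
    positivity

/-- Weights of an `sl₂` with locally nilpotent raising and lowering operators are integers. -/
lemma sl2_int {e f h : Module.End ℂ V} (hef : e * f - f * e = h)
    (hhe : h * e - e * h = (2 : ℂ) • e) (hhf : h * f - f * h = -((2 : ℂ) • f))
    (he : ∀ v, ∃ k, (e ^ k) v = 0) (hf : ∀ v, ∃ k, (f ^ k) v = 0)
    {v : V} (hv0 : v ≠ 0) {p : ℂ} (hv : h v = p • v) : ∃ z : ℤ, p = z := by
  classical
  have hex := he v
  cases hn : Nat.find hex with
  | zero => have := Nat.find_spec hex; rw [hn] at this; exact absurd (by simpa using this) hv0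
  | succ a =>
    have h1 := Nat.find_spec hex
    rw [hn] at h1
    have hw0 : (e ^ a) v ≠ 0 := Nat.find_min hex (m := a) (by omega)
    set w := (e ^ a) v with hw
    have hew : e w = 0 := by rw [hw, ← Module.End.mul_apply, ← pow_succ', h1]
    have hhw : h w = (p + 2 * a) • w := (sl2_lower_raise hef hhe hv a).1
    -- apply the raising identity to the opposite triple `(f, e, -h)`
    have hef' : f * e - e * f = -h := by rw [← hef]; abel
    have hhe' : (-h) * f - f * (-h) = (2 : ℂ) • f := by
      rw [neg_mul, mul_neg, sub_neg_eq_add, neg_add_eq_sub, ← neg_sub, hhf, neg_neg]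
    have hhw' : (-h) w = (-(p + 2 * a)) • w := by
      rw [LinearMap.neg_apply, hhw, neg_smul]
    have hex' := hf w
    cases hm : Nat.find hex' with
    | zero => have := Nat.find_spec hex'; rw [hm] at this; exact absurd (by simpa using this) hw0
    | succ b =>
      have h2 := Nat.find_spec hex'
      rw [hm] at h2
      have hb : (f ^ b) w ≠ 0 := Nat.find_min hex' (m := b) (by omega)
      have h3 := (sl2_lower_raise hef' hhe' hhw' b).2
      rw [h2, hew, map_zero, map_zero, zero_sub, eq_comm, neg_eq_zero, smul_eq_zero] at h3
      have h4 := (mul_eq_zero.mp (h3.resolve_right hb)).resolve_left (Nat.cast_add_one_ne_zero b)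
      refine ⟨(b : ℤ) - 2 * a, ?_⟩
      push_cast
      linear_combination -h4

/-- The product `x_{i_1} (x_{i_2} (⋯ w))`. -/
def wordAct {ι : Type*} (x : ι → Module.End ℂ V) (l : List ι) : Module.End ℂ V :=
  (l.map x).prod

@[simp] lemma wordAct_nil {ι : Type*} (x : ι → Module.End ℂ V) (w : V) :
    wordAct x [] w = w := rfl

@[simp] lemma wordAct_cons {ι : Type*} (x : ι → Module.End ℂ V) (i : ι) (l : List ι) (w : V) :
    wordAct x (i :: l) w = x i (wordAct x l w) := by
  simp [wordAct]

lemma wordAct_append {ι : Type*} (x : ι → Module.End ℂ V) (l l' : List ι) (w : V) :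
    wordAct x (l ++ l') w = wordAct x l (wordAct x l' w) := by
  simp [wordAct]

lemma exists_finiteDimensional_stable_of_locallyFinite (x : Module.End ℂ V)
    (hx : ∀ v, ∃ S : Submodule ℂ V, FiniteDimensional ℂ S ∧ v ∈ S ∧ ∀ w ∈ S, x w ∈ S)
    (F : Submodule ℂ V) [FiniteDimensional ℂ F] :
    ∃ S : Submodule ℂ V, FiniteDimensional ℂ S ∧ F ≤ S ∧ ∀ w ∈ S, x w ∈ S := by
  obtain ⟨s, hs⟩ := (Submodule.fg_iff_finiteDimensional F).mpr inferInstance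
  choose S hS1 hS2 hS3 using hx
  refine ⟨⨆ v ∈ s, S v, ?_, ?_, ?_⟩
  · have := hS1
    exact Submodule.finiteDimensional_finset_sup s S |> fun h => by rwa [Finset.sup_eq_iSup] at h
  · rw [← hs, Submodule.span_le]
    intro v hv
    exact (le_iSup₂_of_le v hv le_rfl : S v ≤ _) (hS2 v)
  · have : (⨆ v ∈ s, S v) ≤ Submodule.comap x (⨆ v ∈ s, S v) :=
      iSup₂_le fun v hv w hw => (le_iSup₂_of_le v hv le_rfl : S v ≤ _) (hS3 v w hw)
    exact this

/-- The spanning half of the Poincaré–Birkhoff–Witt theorem, in the form of a finiteness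
statement: finitely many locally finite operators whose span is closed under commutators
generate a finite-dimensional space from a finite-dimensional one. -/
lemma exists_finiteDimensional_stable {ι : Type*} [Finite ι] (x : ι → Module.End ℂ V)
    (hc : ∀ i j, x i * x j - x j * x i ∈ Submodule.span ℂ (Set.range x))
    (hx : ∀ i v, ∃ S : Submodule ℂ V, FiniteDimensional ℂ S ∧ v ∈ S ∧ ∀ w ∈ S, x i w ∈ S)
    (F : Submodule ℂ V) [FiniteDimensional ℂ F] :
    ∃ S : Submodule ℂ V, FiniteDimensional ℂ S ∧ F ≤ S ∧ ∀ i, ∀ w ∈ S, x i w ∈ S := by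
  classical
  have := Fintype.ofFinite ι
  -- words shorter than `n`
  let Sh : ℕ → Submodule ℂ V := fun n =>
    Submodule.span ℂ {u | ∃ l : List ι, l.length < n ∧ ∃ w ∈ F, u = wordAct x l w}
  have hmono : ∀ {n m}, n ≤ m → Sh n ≤ Sh m := fun hnm =>
    Submodule.span_mono fun u ⟨l, hl, w, hw, hu⟩ => ⟨l, by omega, w, hw, hu⟩
  have hstep : ∀ n i, ∀ u ∈ Sh n, x i u ∈ Sh (n + 1) := by
    intro n i u hu
    induction hu using Submodule.span_induction with
    | mem u hu =>
      obtain ⟨l, hl, w, hw, rfl⟩ := hu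
      exact Submodule.subset_span ⟨i :: l, by simpa using hl, w, hw, by simp⟩
    | zero => simp
    | add u v _ _ h1 h2 => rw [map_add]; exact add_mem h1 h2
    | smul r u _ h => rw [map_smul]; exact Submodule.smul_mem _ _ h
  have hperm : ∀ l l' : List ι, l.Perm l' → ∀ w ∈ F,
      wordAct x l w - wordAct x l' w ∈ Sh l.length := by
    intro l l' h
    induction h with
    | nil => intro w _; simp
    | cons a _ ih =>
      intro w hw
      rw [wordAct_cons, wordAct_cons, ← map_sub]
      exact hstep _ _ _ (ih w hw)
    | swap a b l =>
      intro w hw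
      simp only [wordAct_cons]
      have h1 := hc b a
      have h2 : ∀ T ∈ Submodule.span ℂ (Set.range x), T (wordAct x l w) ∈ Sh (l.length + 2) := by
        intro T hT
        induction hT using Submodule.span_induction with
        | mem T hT =>
          obtain ⟨i, rfl⟩ := hT
          exact Submodule.subset_span ⟨i :: l, by simp, w, hw, by simp⟩
        | zero => simp
        | add u v _ _ h1 h2 => exact add_mem h1 h2
        | smul r u _ h => exact Submodule.smul_mem _ _ h
      exact h2 _ h1
    | trans h1 h2 ih1 ih2 =>
      intro w hw
      have := add_mem (ih1 w hw) (h1.length_eq ▸ ih2 w hw)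
      simpa using this
  -- up to shorter words the factors can be ordered, and ordered words lie in a finite-dimensional
  -- space because each operator is locally finite
  have hord : ∀ L : List ι, ∃ E : Submodule ℂ V, FiniteDimensional ℂ E ∧
      ∀ l : List ι, (∀ i ∈ l, i ∈ L) → ∃ l', l.Perm l' ∧ ∀ w ∈ F, wordAct x l' w ∈ E := by
    intro L
    induction L with
    | nil =>
      refine ⟨F, inferInstance, fun l hl => ⟨[], ?_, fun w hw => hw⟩⟩
      have : l = [] := List.eq_nil_iff_forall_not_mem.mpr fun i hi => by simpa using hl i hi
      rw [this]
    | cons i L ih =>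
      obtain ⟨E, hE, hE'⟩ := ih
      obtain ⟨S, hS, hES, hSx⟩ :=
        exists_finiteDimensional_stable_of_locallyFinite (x i) (hx i) E
      refine ⟨S, hS, fun l hl => ?_⟩
      obtain ⟨l', hl', hw'⟩ := hE' (l.filter fun j => !decide (j = i)) (fun j hj => by
        simp only [List.mem_filter, Bool.not_eq_true', decide_eq_false_iff_not] at hj
        exact (List.mem_cons.mp (hl j hj.1)).resolve_left hj.2)
      refine ⟨l.filter (fun j => decide (j = i)) ++ l', ?_, fun w hw => ?_⟩
      · exact (List.filter_append_perm (fun j => decide (j = i)) l).symm.trans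
          (hl'.append_left _)
      · rw [wordAct_append]
        have h0 : wordAct x l' w ∈ S := hES (hw' w hw)
        have : ∀ m : List ι, (∀ j ∈ m, j = i) → wordAct x m (wordAct x l' w) ∈ S := by
          intro m
          induction m with
          | nil => intro _; simpa using h0
          | cons j m ihm =>
            intro hm
            rw [wordAct_cons, hm j (by simp)]
            exact hSx _ (ihm fun k hk => hm k (by simp [hk]))
        exact this _ fun j hj => by simpa using (List.mem_filter.mp hj).2
  obtain ⟨E, hE, hE'⟩ := hord Finset.univ.toList
  have hall : ∀ n, Sh n ≤ E := by
    intro n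
    induction n with
    | zero => exact Submodule.span_le.mpr fun u ⟨l, hl, _⟩ => absurd hl (by omega)
    | succ n ih =>
      refine Submodule.span_le.mpr fun u ⟨l, hl, w, hw, hu⟩ => ?_
      obtain ⟨l', hll', hl'⟩ := hE' l (fun i _ => by simp)
      have h1 := ih (hmono (Nat.lt_succ_iff.mp hl) (hperm l l' hll' w hw))
      have := E.add_mem h1 (hl' w hw)
      rw [hu]
      simpa using this
  refine ⟨⨆ n, Sh n, ?_, ?_, ?_⟩
  · exact Submodule.finiteDimensional_of_le (iSup_le hall)
  · intro w hw
    exact (le_iSup Sh 1) (Submodule.subset_span ⟨[], by simp, w, hw, by simp⟩)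
  · intro i
    have : (⨆ n, Sh n) ≤ Submodule.comap (x i) (⨆ n, Sh n) :=
      iSup_le fun n u hu => (le_iSup Sh (n + 1)) (hstep n i u hu)
    exact this

lemma locallyFinite_of_nilpotent {x : Module.End ℂ V} {v : V} (hv : ∃ k, (x ^ k) v = 0) :
    ∃ S : Submodule ℂ V, FiniteDimensional ℂ S ∧ v ∈ S ∧ ∀ w ∈ S, x w ∈ S := by
  obtain ⟨k, hk⟩ := hv
  have hk' : ∀ m, k ≤ m → (x ^ m) v = 0 := fun m hm => by
    obtain ⟨j, rfl⟩ := Nat.exists_eq_add_of_le hm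
    rw [add_comm, pow_add, Module.End.mul_apply, hk, map_zero]
  refine ⟨Submodule.span ℂ (Set.range fun i : Fin (k + 1) => (x ^ (i : ℕ)) v),
    FiniteDimensional.span_of_finite ℂ (Set.finite_range _),
    Submodule.subset_span ⟨0, by simp⟩, fun w hw => ?_⟩
  induction hw using Submodule.span_induction with
  | mem w hw =>
    obtain ⟨i, rfl⟩ := hw
    by_cases hi : (i : ℕ) + 1 < k + 1
    · exact Submodule.subset_span ⟨⟨i + 1, hi⟩, by simp [pow_succ']⟩
    · have : x ((x ^ (i : ℕ)) v) = 0 := by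
        rw [← Module.End.mul_apply, ← pow_succ']
        exact hk' _ (by omega)
      simp [this]
  | zero => simp
  | add u v _ _ h1 h2 => rw [map_add]; exact add_mem h1 h2
  | smul r u _ h => rw [map_smul]; exact Submodule.smul_mem _ _ h

/-- Vectors whose components for the operator `h` have eigenvalues outside `c, c + 1, c + 2, …`.
In a highest weight module, these are the vectors strictly below the highest weight. -/
def lowPart (h : Module.End ℂ V) (c : ℂ) : Submodule ℂ V where
  carrier := {l | ∃ p : Polynomial ℂ, Polynomial.aeval h p l = 0 ∧
    ∀ j : ℕ, p.eval (c + j) ≠ 0}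
  zero_mem' := ⟨1, by simp, by simp⟩
  add_mem' := by
    rintro a b ⟨p, hp, hp'⟩ ⟨q, hq, hq'⟩
    refine ⟨p * q, ?_, fun j => ?_⟩
    · have h1 : Polynomial.aeval h (p * q) a = 0 := by
        rw [mul_comm, map_mul, Module.End.mul_apply, hp, map_zero]
      have h2 : Polynomial.aeval h (p * q) b = 0 := by
        rw [map_mul, Module.End.mul_apply, hq, map_zero]
      rw [map_add, h1, h2, add_zero]
    · rw [Polynomial.eval_mul]
      exact mul_ne_zero (hp' j) (hq' j)
  smul_mem' := by
    rintro r a ⟨p, hp, hp'⟩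
    exact ⟨p, by rw [map_smul, hp, smul_zero], hp'⟩

lemma aeval_apply_of_eigen {h : Module.End ℂ V} {c : ℂ} {w : V} (hw : h w = c • w)
    (p : Polynomial ℂ) : Polynomial.aeval h p w = p.eval c • w := by
  induction p using Polynomial.induction_on' with
  | add p q hp hq => simp [hp, hq, add_smul]
  | monomial k a =>
    have : ∀ k : ℕ, (h ^ k) w = c ^ k • w := by
      intro k
      induction k with
      | zero => simp
      | succ k ih => rw [pow_succ', Module.End.mul_apply, ih, map_smul, hw, smul_smul, pow_succ]
    simp [Polynomial.aeval_monomial, this, smul_smul, mul_comm]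

/-- A subspace stable under `h` contains the eigencomponent of each of its vectors. -/
lemma mem_of_add_lowPart_mem {h : Module.End ℂ V} {c : ℂ} {N : Submodule ℂ V}
    (hN : ∀ w ∈ N, h w ∈ N) {w l : V} (hw : h w = c • w) (hl : l ∈ lowPart h c)
    (hwl : w + l ∈ N) : w ∈ N := by
  obtain ⟨p, hp, hp'⟩ := hl
  have hst : ∀ (q : Polynomial ℂ), ∀ u ∈ N, Polynomial.aeval h q u ∈ N := by
    intro q u hu
    induction q using Polynomial.induction_on' with
    | add p q hp hq => rw [map_add]; exact N.add_mem hp hq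
    | monomial k a =>
      have : ∀ k : ℕ, (h ^ k) u ∈ N := by
        intro k
        induction k with
        | zero => simpa using hu
        | succ k ih => rw [pow_succ', Module.End.mul_apply]; exact hN _ ih
      rw [Polynomial.aeval_monomial, Module.End.mul_apply, Module.algebraMap_end_apply]
      exact N.smul_mem _ (this k)
  have h1 := hst p _ hwl
  rw [map_add, hp, add_zero, aeval_apply_of_eigen hw] at h1
  exact (N.smul_mem_iff (by simpa using hp' 0)).mp h1

lemma eq_zero_of_mem_lowPart {h : Module.End ℂ V} {c : ℂ} {w : V} (hw : h w = c • w)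
    (hl : w ∈ lowPart h c) : w = 0 := by
  have := mem_of_add_lowPart_mem (N := ⊥) (w := w) (l := -w) (c := c) (h := h)
    (fun u hu => by rw [(Submodule.mem_bot ℂ).mp hu]; simp) hw (neg_mem hl) (by simp)
  simpa using this

lemma lower_mem_lowPart {h y : Module.End ℂ V} {c : ℂ} {k : ℕ} (hk : 0 < k)
    (hy : h * y - y * h = -((k : ℂ) • y)) {w : V} (hw : h w = c • w) : y w ∈ lowPart h c := by
  refine ⟨Polynomial.X - Polynomial.C (c - k), ?_, fun j => ?_⟩
  · have := LinearMap.congr_fun hy w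
    simp only [LinearMap.sub_apply, Module.End.mul_apply, LinearMap.neg_apply,
      LinearMap.smul_apply, hw, map_smul] at this
    simp only [map_sub, Polynomial.aeval_X, Polynomial.aeval_C, LinearMap.sub_apply,
      Module.algebraMap_end_apply]
    rw [sub_eq_iff_eq_add] at this
    rw [this]; abel
  · simp only [Polynomial.eval_sub, Polynomial.eval_X, Polynomial.eval_C]
    have : c + (j : ℂ) - (c - k) = ((j + k : ℕ) : ℂ) := by push_cast; ring
    rw [this, Nat.cast_ne_zero]
    omega

/-- An operator of negative degree for `h` preserves the low part. -/
lemma lowPart_lower {h y : Module.End ℂ V} {c : ℂ} {k : ℕ}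
    (hy : h * y - y * h = -((k : ℂ) • y)) {l : V} (hl : l ∈ lowPart h c) :
    y l ∈ lowPart h c := by
  obtain ⟨p, hp, hp'⟩ := hl
  -- `q(h) y = y q(h - k)`, so the polynomial is shifted by `k`
  refine ⟨p.comp (Polynomial.X + Polynomial.C (k : ℂ)), ?_, fun j => ?_⟩
  · have hy' : (h + algebraMap ℂ (Module.End ℂ V) k) * y = y * h := by
      rw [add_mul, sub_eq_iff_eq_add.mp hy, Algebra.algebraMap_eq_smul_one, smul_mul_assoc,
        one_mul]
      abel
    have : ∀ q : Polynomial ℂ,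
        Polynomial.aeval (h + algebraMap ℂ (Module.End ℂ V) k) q * y = y * Polynomial.aeval h q := by
      intro q
      induction q using Polynomial.induction_on' with
      | add p q hp hq => rw [map_add, map_add, add_mul, mul_add, hp, hq]
      | monomial m a =>
        simp only [Polynomial.aeval_monomial]
        rw [mul_assoc, (SemiconjBy.pow_right (show SemiconjBy y h _ from hy'.symm) m).eq.symm,
          ← mul_assoc, ← mul_assoc, Algebra.commutes]
    rw [Polynomial.aeval_comp]
    have h2 := LinearMap.congr_fun (this p) l
    simp only [Module.End.mul_apply, hp, map_zero] at h2
    simpa using h2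
  · have h2 := hp' (j + k)
    rw [Polynomial.eval_comp]
    simpa [add_assoc] using h2

/-- The smallest subspace that contains `W` and is stable under the operators in `N`. -/
def opClosure (N : Set (Module.End ℂ V)) (W : Submodule ℂ V) : Submodule ℂ V :=
  sInf {S | W ≤ S ∧ ∀ y ∈ N, ∀ s ∈ S, y s ∈ S}

lemma le_opClosure (N : Set (Module.End ℂ V)) (W : Submodule ℂ V) : W ≤ opClosure N W :=
  le_sInf fun _ hS => hS.1

lemma opClosure_stable {N : Set (Module.End ℂ V)} {W : Submodule ℂ V} {y : Module.End ℂ V}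
    (hy : y ∈ N) {s : V} (hs : s ∈ opClosure N W) : y s ∈ opClosure N W := by
  rw [opClosure, Submodule.mem_sInf] at hs ⊢
  exact fun S hS => hS.2 y hy s (hs S hS)

lemma opClosure_le {N : Set (Module.End ℂ V)} {W S : Submodule ℂ V} (h : W ≤ S)
    (hS : ∀ y ∈ N, ∀ s ∈ S, y s ∈ S) : opClosure N W ≤ S :=
  sInf_le ⟨h, hS⟩

/-- If `b` stabilizes `W` and commutators of `N` with `b` lie in `N + b`, the `N`-closure of `W`
is stable under `b`. -/
lemma opClosure_stable_of_commutator {N b : Submodule ℂ (Module.End ℂ V)} {W : Submodule ℂ V}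
    (hW : ∀ x ∈ b, ∀ w ∈ W, x w ∈ W) (hc : ∀ x ∈ b, ∀ y ∈ N, x * y - y * x ∈ N ⊔ b)
    {x : Module.End ℂ V} (hx : x ∈ b) {s : V} (hs : s ∈ opClosure (N : Set _) W) :
    x s ∈ opClosure (N : Set _) W := by
  let S : Submodule ℂ V :=
    { carrier := {s | s ∈ opClosure (N : Set _) W ∧ ∀ x ∈ b, x s ∈ opClosure (N : Set _) W}
      zero_mem' := ⟨zero_mem _, fun x _ => by simp⟩
      add_mem' := fun {u v} hu hv => ⟨add_mem hu.1 hv.1, fun x hx => by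
        rw [map_add]; exact add_mem (hu.2 x hx) (hv.2 x hx)⟩
      smul_mem' := fun r u hu => ⟨Submodule.smul_mem _ _ hu.1, fun x hx => by
        rw [map_smul]; exact Submodule.smul_mem _ _ (hu.2 x hx)⟩ }
  have hS : opClosure (N : Set _) W ≤ S := by
    refine opClosure_le (fun w hw => ⟨le_opClosure _ _ hw, fun x hx =>
      le_opClosure _ _ (hW x hx w hw)⟩) fun y hy s hs => ⟨opClosure_stable hy hs.1, fun x hx => ?_⟩
    obtain ⟨y', hy', x', hx', he⟩ := Submodule.mem_sup.mp (hc x hx y hy)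
    have : x (y s) = y (x s) + (y' s + x' s) := by
      have := LinearMap.congr_fun he s
      simp only [LinearMap.add_apply, LinearMap.sub_apply, Module.End.mul_apply] at this
      rw [this]; abel
    rw [this]
    exact add_mem (opClosure_stable hy (hs.2 x hx))
      (add_mem (opClosure_stable hy' hs.1) (hs.2 x' hx'))
  exact (hS hs).2 x hx

/-- The space generated from an eigenspace `W` by operators of negative degree for `h` is `W` plus
vectors strictly below it. -/
lemma opClosure_le_sup_lowPart {N : Submodule ℂ (Module.End ℂ V)} {W : Submodule ℂ V}
    {h : Module.End ℂ V} {c : ℂ} (hW : ∀ w ∈ W, h w = c • w)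
    (hN : N ≤ Submodule.span ℂ {y | ∃ k : ℕ, 0 < k ∧ h * y - y * h = -((k : ℂ) • y)}) :
    opClosure (N : Set _) W ≤ W ⊔ lowPart h c := by
  refine opClosure_le le_sup_left fun y hy s hs => ?_
  refine (le_sup_right : lowPart h c ≤ _) ?_
  obtain ⟨w, hw, l, hl, rfl⟩ := Submodule.mem_sup.mp hs
  have hy' := hN hy
  clear hy
  induction hy' using Submodule.span_induction with
  | mem y hy =>
    obtain ⟨k, hk, hy⟩ := hy
    rw [map_add]
    exact add_mem (lower_mem_lowPart hk hy (hW w hw)) (lowPart_lower hy hl)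
  | zero => simp
  | add y y' _ _ h1 h2 => rw [LinearMap.add_apply]; exact add_mem h1 h2
  | smul r y _ h1 => rw [LinearMap.smul_apply]; exact Submodule.smul_mem _ _ h1

end Operators

/-! ### Words in the loop algebra of `sl₂` -/

section Heisenberg

variable {V : Type*} [AddCommGroup V] [Module ℂ V] {C : Type*}

/-- Operators that agree on `T` with a combination of products of `k` operators `Y f` and fewer
than `j` operators `η f`. -/
def wordSpan (T : Submodule ℂ V) (Y η : C → Module.End ℂ V) (k j : ℕ) :
    Submodule ℂ (Module.End ℂ V) :=
  Submodule.span ℂ {O | ∃ l l' : List C, l.length = k ∧ l'.length < j ∧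
    O = wordAct Y l * wordAct η l'} ⊔
  { carrier := {O | ∀ v ∈ T, O v = 0}
    zero_mem' := fun v _ => rfl
    add_mem' := fun {a b} ha hb v hv => by rw [LinearMap.add_apply, ha v hv, hb v hv, add_zero]
    smul_mem' := fun r a ha v hv => by rw [LinearMap.smul_apply, ha v hv, smul_zero] }

variable {T : Submodule ℂ V} {Y η : C → Module.End ℂ V}

lemma mem_wordSpan_of_vanish {k j : ℕ} {O : Module.End ℂ V} (h : ∀ v ∈ T, O v = 0) :
    O ∈ wordSpan T Y η k j :=
  (le_sup_right : _ ≤ wordSpan T Y η k j) h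

lemma mem_wordSpan_word {k j : ℕ} (l l' : List C) (hl : l.length = k) (hl' : l'.length < j) :
    wordAct Y l * wordAct η l' ∈ wordSpan T Y η k j :=
  (le_sup_left : _ ≤ wordSpan T Y η k j) (Submodule.subset_span ⟨l, l', hl, hl', rfl⟩)

lemma wordSpan_induction {k j : ℕ} {p : Module.End ℂ V → Prop}
    (hv : ∀ O : Module.End ℂ V, (∀ v ∈ T, O v = 0) → p O)
    (hw : ∀ l l' : List C, l.length = k → l'.length < j → p (wordAct Y l * wordAct η l'))
    (ha : ∀ a b, p a → p b → p (a + b)) (hs : ∀ (r : ℂ) a, p a → p (r • a))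
    {O : Module.End ℂ V} (hO : O ∈ wordSpan T Y η k j) : p O := by
  obtain ⟨a, ha', b, hb, rfl⟩ := Submodule.mem_sup.mp hO
  clear hO
  refine ha _ _ ?_ (hv b hb)
  induction ha' using Submodule.span_induction with
  | mem x hx => obtain ⟨l, l', hl, hl', rfl⟩ := hx; exact hw l l' hl hl'
  | zero => exact hv 0 fun _ _ => rfl
  | add x y _ _ h1 h2 => exact ha _ _ h1 h2
  | smul r x _ h => exact hs r x h

lemma wordAct_cons_mul {ι : Type*} (x : ι → Module.End ℂ V) (i : ι) (l : List ι) :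
    wordAct x (i :: l) = x i * wordAct x l := by
  simp [wordAct]

lemma wordAct_nil_eq {ι : Type*} (x : ι → Module.End ℂ V) : wordAct x [] = 1 := rfl

lemma wordSpan_mono {k j j' : ℕ} (h : j ≤ j') : wordSpan T Y η k j ≤ wordSpan T Y η k j' :=
  sup_le_sup_right (Submodule.span_mono (by
    rintro _ ⟨l, l', hl, hl', hO⟩
    exact ⟨l, l', hl, hl'.trans_le h, hO⟩)) _

lemma Y_mul_mem_wordSpan (f : C) {k j : ℕ} {O : Module.End ℂ V} (hO : O ∈ wordSpan T Y η k j) :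
    Y f * O ∈ wordSpan T Y η (k + 1) j := by
  refine wordSpan_induction (p := fun O => Y f * O ∈ wordSpan T Y η (k + 1) j) ?_ ?_ ?_ ?_ hO
  · exact fun O h => mem_wordSpan_of_vanish fun v hv => by rw [Module.End.mul_apply, h v hv, map_zero]
  · intro l l' hl hl'
    rw [← mul_assoc, ← wordAct_cons_mul]
    exact mem_wordSpan_word _ _ (by simp [hl]) hl'
  · intro a b h1 h2; rw [mul_add]; exact add_mem h1 h2
  · intro r a h; rw [mul_smul_comm]; exact Submodule.smul_mem _ _ h

/-- Moving `η f` to the right through `Y`'s only costs shorter words. -/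
lemma eta_mul_word_sub_mem_wordSpan [CommMonoid C]
    (hη : ∀ f g, η f * Y g - Y g * η f = (-2 : ℂ) • Y (f * g))
    (f : C) {j : ℕ} (l l' : List C) (hl' : l'.length < j) :
    η f * (wordAct Y l * wordAct η l') - wordAct Y l * (η f * wordAct η l') ∈
      wordSpan T Y η l.length j := by
  induction l with
  | nil => simp [wordAct_nil_eq]
  | cons g l ih =>
    have h1 : η f * (wordAct Y (g :: l) * wordAct η l') -
        wordAct Y (g :: l) * (η f * wordAct η l') =
        Y g * (η f * (wordAct Y l * wordAct η l') - wordAct Y l * (η f * wordAct η l')) +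
        (-2 : ℂ) • (wordAct Y (f * g :: l) * wordAct η l') := by
      simp only [wordAct_cons_mul, ← mul_assoc, mul_sub]
      rw [sub_eq_iff_eq_add.mp (hη f g)]
      simp only [add_mul, smul_mul_assoc]
      abel
    rw [h1]
    exact add_mem (Y_mul_mem_wordSpan g ih)
      (Submodule.smul_mem _ _ (mem_wordSpan_word _ _ (by simp) hl'))

lemma eta_mul_mem_wordSpan [CommMonoid C] (hη : ∀ f g, η f * Y g - Y g * η f = (-2 : ℂ) • Y (f * g))
    (f : C) {k j : ℕ} {O : Module.End ℂ V} (hO : O ∈ wordSpan T Y η k j) :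
    η f * O ∈ wordSpan T Y η k (j + 1) := by
  refine wordSpan_induction (p := fun O => η f * O ∈ wordSpan T Y η k (j + 1)) ?_ ?_ ?_ ?_ hO
  · exact fun O h => mem_wordSpan_of_vanish fun v hv => by rw [Module.End.mul_apply, h v hv, map_zero]
  · intro l l' hl hl'
    have h1 := eta_mul_word_sub_mem_wordSpan (T := T) hη f l l' hl'
    rw [hl] at h1
    have h2 : wordAct Y l * (η f * wordAct η l') ∈ wordSpan T Y η k (j + 1) := by
      rw [← wordAct_cons_mul]
      exact mem_wordSpan_word _ _ hl (by simpa using hl')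
    simpa using add_mem (wordSpan_mono (Nat.le_succ j) h1) h2
  · intro a b h1 h2; rw [mul_add]; exact add_mem h1 h2
  · intro r a h; rw [mul_smul_comm]; exact Submodule.smul_mem _ _ h

lemma wordAct_mem {ι : Type*} {x : ι → Module.End ℂ V} (hx : ∀ i, ∀ v ∈ T, x i v ∈ T)
    (l : List ι) {v : V} (hv : v ∈ T) : wordAct x l v ∈ T := by
  induction l with
  | nil => exact hv
  | cons i l ih => rw [wordAct_cons]; exact hx _ _ ih

lemma X_mul_mem_wordSpan [CommMonoid C] {X : Module.End ℂ V} (hX : ∀ f, X * Y f - Y f * X = η f)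
    (hη : ∀ f g, η f * Y g - Y g * η f = (-2 : ℂ) • Y (f * g))
    (hXT : ∀ v ∈ T, X v = 0) (hηT : ∀ f, ∀ v ∈ T, η f v ∈ T)
    {k j : ℕ} {O : Module.End ℂ V} (hO : O ∈ wordSpan T Y η (k + 1) j) :
    X * O ∈ wordSpan T Y η k (j + 1) := by
  refine wordSpan_induction (p := fun O => X * O ∈ wordSpan T Y η k (j + 1)) ?_ ?_ ?_ ?_ hO
  · exact fun O h => mem_wordSpan_of_vanish fun v hv => by rw [Module.End.mul_apply, h v hv, map_zero]
  · intro l l' hl hl'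
    clear hO O
    induction l generalizing k with
    | nil => simp at hl
    | cons f l ih =>
      have h1 : X * (wordAct Y (f :: l) * wordAct η l') =
          Y f * (X * (wordAct Y l * wordAct η l')) + η f * (wordAct Y l * wordAct η l') := by
        simp only [wordAct_cons_mul, ← mul_assoc]
        rw [sub_eq_iff_eq_add.mp (hX f)]
        simp only [add_mul]
        abel
      have hl2 : l.length = k := by simpa using hl
      rw [h1]
      refine add_mem ?_ (eta_mul_mem_wordSpan hη f (mem_wordSpan_word l l' hl2 hl'))
      cases k with
      | zero =>
        have : l = [] := List.length_eq_zero_iff.mp hl2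
        subst this
        refine mem_wordSpan_of_vanish fun v hv => ?_
        simp only [Module.End.mul_apply, wordAct_nil]
        rw [hXT _ (wordAct_mem hηT l' hv), map_zero]
      | succ k => exact Y_mul_mem_wordSpan f (ih hl2)
  · intro a b h1 h2; rw [mul_add]; exact add_mem h1 h2
  · intro r a h; rw [mul_smul_comm]; exact Submodule.smul_mem _ _ h

lemma X_pow_mul_mem_wordSpan [CommMonoid C] {X : Module.End ℂ V} (hX : ∀ f, X * Y f - Y f * X = η f)
    (hη : ∀ f g, η f * Y g - Y g * η f = (-2 : ℂ) • Y (f * g))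
    (hXT : ∀ v ∈ T, X v = 0) (hηT : ∀ f, ∀ v ∈ T, η f v ∈ T)
    {k j : ℕ} {O : Module.End ℂ V} (hO : O ∈ wordSpan T Y η k j) :
    X ^ k * O ∈ wordSpan T Y η 0 (j + k) := by
  induction k generalizing j O with
  | zero => simpa using hO
  | succ k ih =>
    rw [pow_succ, mul_assoc]
    have := ih (X_mul_mem_wordSpan hX hη hXT hηT hO)
    rwa [show j + (k + 1) = j + 1 + k by ring]

lemma wordAct_replicate {ι : Type*} (x : ι → Module.End ℂ V) (i : ι) (k : ℕ) :
    wordAct x (List.replicate k i) = x i ^ k := by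
  simp [wordAct]

/-- To leading order, `X^k (Y f)^k` acts as `k! (η f)^k` on the space `T` killed by `X`. -/
lemma X_pow_mul_Y_pow_sub_mem_wordSpan [CommMonoid C] {X : Module.End ℂ V} (hX : ∀ f, X * Y f - Y f * X = η f)
    (hη : ∀ f g, η f * Y g - Y g * η f = (-2 : ℂ) • Y (f * g))
    (hXT : ∀ v ∈ T, X v = 0) (hηT : ∀ f, ∀ v ∈ T, η f v ∈ T) (f : C) (k m : ℕ) :
    X ^ k * (Y f ^ k * η f ^ m) - (k.factorial : ℂ) • η f ^ (k + m) ∈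
      wordSpan T Y η 0 (k + m) := by
  -- one step: `X (Y f)^(k+1) (η f)^m ≡ (k+1) (Y f)^k (η f)^(m+1)`
  have step : ∀ k m : ℕ, X * (Y f ^ (k + 1) * η f ^ m) -
      ((k : ℂ) + 1) • (Y f ^ k * η f ^ (m + 1)) ∈ wordSpan T Y η k (m + 1) := by
    intro k m
    have hcomm : ∀ k, η f * (Y f ^ k * η f ^ m) - Y f ^ k * η f ^ (m + 1) ∈
        wordSpan T Y η k (m + 1) := by
      intro k
      have := eta_mul_word_sub_mem_wordSpan (T := T) hη f (j := m + 1) (List.replicate k f)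
        (List.replicate m f) (by simp)
      simpa [wordAct_replicate, pow_succ'] using this
    induction k with
    | zero =>
      refine mem_wordSpan_of_vanish fun v hv => ?_
      have hm : (η f ^ m) v ∈ T := by
        rw [← wordAct_replicate]; exact wordAct_mem hηT _ hv
      have h1 := LinearMap.congr_fun (hX f) ((η f ^ m) v)
      simp only [LinearMap.sub_apply, Module.End.mul_apply, hXT _ hm, map_zero, sub_zero] at h1
      simp [h1, pow_succ']
    | succ k ih =>
      have h1 : X * (Y f ^ (k + 1 + 1) * η f ^ m) -
          (((k + 1 : ℕ) : ℂ) + 1) • (Y f ^ (k + 1) * η f ^ (m + 1)) =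
          Y f * (X * (Y f ^ (k + 1) * η f ^ m) - ((k : ℂ) + 1) • (Y f ^ k * η f ^ (m + 1))) +
          (η f * (Y f ^ (k + 1) * η f ^ m) - Y f ^ (k + 1) * η f ^ (m + 1)) := by
        have h2 : X * (Y f ^ (k + 1 + 1) * η f ^ m) =
            Y f * (X * (Y f ^ (k + 1) * η f ^ m)) + η f * (Y f ^ (k + 1) * η f ^ m) := by
          rw [pow_succ' (Y f) (k + 1)]
          simp only [← mul_assoc]
          rw [sub_eq_iff_eq_add.mp (hX f)]
          simp only [add_mul]
          abel
        rw [h2, mul_sub, mul_smul_comm, ← mul_assoc (Y f) (Y f ^ k), ← pow_succ']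
        push_cast
        module
      rw [h1]
      exact add_mem (Y_mul_mem_wordSpan f ih) (hcomm (k + 1))
  induction k generalizing m with
  | zero => simp
  | succ k ih =>
    have h1 := X_pow_mul_mem_wordSpan hX hη hXT hηT (step k m)
    have h2 := ih (m + 1)
    have h3 : X ^ (k + 1) * (Y f ^ (k + 1) * η f ^ m) -
        ((k + 1).factorial : ℂ) • η f ^ (k + 1 + m) =
        X ^ k * (X * (Y f ^ (k + 1) * η f ^ m) - ((k : ℂ) + 1) • (Y f ^ k * η f ^ (m + 1))) +
        ((k : ℂ) + 1) • (X ^ k * (Y f ^ k * η f ^ (m + 1)) -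
          (k.factorial : ℂ) • η f ^ (k + (m + 1))) := by
      rw [mul_sub, mul_smul_comm, ← mul_assoc (X ^ k) X, ← pow_succ, smul_sub, smul_smul,
        Nat.factorial_succ, show k + (m + 1) = k + 1 + m by ring]
      push_cast
      abel
    rw [h3, show k + 1 + m = m + 1 + k by ring]
    refine add_mem h1 (Submodule.smul_mem _ _ ?_)
    rwa [show m + 1 + k = k + (m + 1) by ring]

/-- The commutator with `U` lowers the length of words in the `η`'s, if it sends each `η f` to
an operator commuting with `U`. -/
lemma commutator_pow_word {U : Module.End ℂ V} {z : C → Module.End ℂ V}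
    (hU : ∀ f, U * η f - η f * U = z f) (hz : ∀ f, U * z f = z f * U) (D : Module.End ℂ (Module.End ℂ V))
    (hD : ∀ O, D O = U * O - O * U) :
    (∀ (l : List C) (j : ℕ), l.length < j → (D ^ j) (wordAct η l) = 0) ∧
    ∀ (f : C) (k : ℕ), (D ^ k) (η f ^ k) = (k.factorial : ℂ) • z f ^ k := by
  have leib : ∀ (f : C) (w : Module.End ℂ V) (j : ℕ), (D ^ (j + 1)) (η f * w) =
      η f * (D ^ (j + 1)) w + ((j : ℂ) + 1) • (z f * (D ^ j) w) := by
    have h1 : ∀ f w, D (η f * w) = η f * D w + z f * w := by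
      intro f w
      rw [hD, hD, ← hU, mul_sub, sub_mul]; simp only [mul_assoc]; abel
    have h2 : ∀ f w, D (z f * w) = z f * D w := by
      intro f w
      rw [hD, hD, mul_sub, ← mul_assoc, hz]; simp only [mul_assoc]
    intro f w j
    induction j with
    | zero => simp [h1]
    | succ j ih =>
      have h3 : ∀ (i : ℕ) (O : Module.End ℂ V), (D ^ (i + 1)) O = D ((D ^ i) O) := fun i O => by
        rw [pow_succ', Module.End.mul_apply]
      rw [h3 (j + 1), ih, map_add, h1, map_smul, h2, h3 (j + 1), ← h3 j]
      push_cast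
      module
  have hzero : ∀ (l : List C) (j : ℕ), l.length < j → (D ^ j) (wordAct η l) = 0 := by
    intro l
    induction l with
    | nil =>
      intro j hj
      obtain ⟨i, rfl⟩ := Nat.exists_eq_succ_of_ne_zero (show j ≠ 0 by simpa using hj.ne')
      rw [pow_succ, Module.End.mul_apply, hD, wordAct_nil_eq]
      simp
    | cons f l ih =>
      intro j hj
      obtain ⟨i, rfl⟩ := Nat.exists_eq_succ_of_ne_zero (show j ≠ 0 by simp at hj; omega)
      simp only [List.length_cons] at hj
      rw [wordAct_cons_mul, Nat.succ_eq_add_one, leib, ih (i + 1) (by omega), ih i (by omega)]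
      simp
  refine ⟨hzero, fun f k => ?_⟩
  induction k with
  | zero => simp
  | succ k ih =>
    have h0 := hzero (List.replicate k f) (k + 1) (by simp)
    rw [wordAct_replicate] at h0
    rw [pow_succ' (η f), leib, h0, ih, mul_zero, zero_add, mul_smul_comm, smul_smul, ← pow_succ',
      Nat.factorial_succ]
    push_cast
    rfl

/-- If `(Y f)^k` kills the space `T` of highest weight vectors, the commutator `z f` of `η f`
with the fixed operator `U` is nilpotent on `T`. -/
lemma commutator_nilpotent [CommMonoid C] {X U : Module.End ℂ V} {z : C → Module.End ℂ V}
    (hX : ∀ f, X * Y f - Y f * X = η f)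
    (hη : ∀ f g, η f * Y g - Y g * η f = (-2 : ℂ) • Y (f * g))
    (hXT : ∀ v ∈ T, X v = 0) (hηT : ∀ f, ∀ v ∈ T, η f v ∈ T) (hUT : ∀ v ∈ T, U v ∈ T)
    (hU : ∀ f, U * η f - η f * U = z f) (hz : ∀ f, U * z f = z f * U)
    (f : C) (k : ℕ) (hY : ∀ v ∈ T, (Y f ^ k) v = 0) : ∀ v ∈ T, (z f ^ k) v = 0 := by
  let D : Module.End ℂ (Module.End ℂ V) := LinearMap.mulLeft ℂ U - LinearMap.mulRight ℂ U
  have hD : ∀ O, D O = U * O - O * U := fun O => rfl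
  obtain ⟨h1, h2⟩ := commutator_pow_word hU hz D hD
  have h3 := X_pow_mul_Y_pow_sub_mem_wordSpan hX hη hXT hηT f k 0
  have hvan : ∀ O : Module.End ℂ V, (∀ v ∈ T, O v = 0) → ∀ j, ∀ v ∈ T, ((D ^ j) O) v = 0 := by
    intro O hO j
    induction j with
    | zero => simpa using hO
    | succ j ih =>
      intro v hv
      rw [pow_succ', Module.End.mul_apply, hD, LinearMap.sub_apply, Module.End.mul_apply,
        Module.End.mul_apply, ih v hv, ih _ (hUT v hv), map_zero, sub_zero]
  -- `k` commutators with `U` kill words of fewer than `k` factors `η`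
  have h4 : ∀ O ∈ wordSpan T Y η 0 k, ∀ v ∈ T, ((D ^ k) O) v = 0 := by
    intro O hO
    refine wordSpan_induction (p := fun O => ∀ v ∈ T, ((D ^ k) O) v = 0) ?_ ?_ ?_ ?_ hO
    · exact fun O hO => hvan O hO k
    · intro l l' hl hl' v _
      have : l = [] := List.length_eq_zero_iff.mp hl
      rw [this, wordAct_nil_eq, one_mul, h1 l' k hl', LinearMap.zero_apply]
    · intro a b ha hb v hv
      rw [map_add, LinearMap.add_apply, ha v hv, hb v hv, add_zero]
    · intro r a ha v hv
      rw [map_smul, LinearMap.smul_apply, ha v hv, smul_zero]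
  intro v hv
  simp only [pow_zero, mul_one, add_zero] at h3
  have h5 := h4 _ h3 v hv
  rw [map_sub, map_smul, h2, LinearMap.sub_apply,
    hvan _ (fun v hv => by rw [Module.End.mul_apply, hY v hv, map_zero]) k v hv, zero_sub,
    neg_eq_zero, smul_smul, LinearMap.smul_apply, smul_eq_zero] at h5
  have h6 : (k.factorial : ℂ) ≠ 0 := Nat.cast_ne_zero.mpr k.factorial_ne_zero
  exact h5.resolve_left (mul_ne_zero h6 h6)

end Heisenberg

section Garland

variable {V : Type*} [AddCommGroup V] [Module ℂ V]

/-- The span of the words `Y_{i_1} ⋯ Y_{i_k} v` with `∑ i ≤ s`, each vector paired with the sum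
of the coefficients of its words with `∑ i = s`. -/
def wordSymbol (Y : ℕ → Module.End ℂ V) (v : V) (k s : ℕ) : Submodule ℂ (V × ℂ) :=
  Submodule.span ℂ {q | ∃ l : List ℕ, l.length = k ∧
    ((l.sum = s ∧ q = (wordAct Y l v, 1)) ∨ (l.sum < s ∧ q = (wordAct Y l v, 0)))}

variable {Y H : ℕ → Module.End ℂ V} {X : Module.End ℂ V} {v : V}

lemma wordSymbol_top (l : List ℕ) {k s : ℕ} (hk : l.length = k) (hs : l.sum = s) :
    (wordAct Y l v, (1 : ℂ)) ∈ wordSymbol Y v k s :=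
  Submodule.subset_span ⟨l, hk, Or.inl ⟨hs, rfl⟩⟩

lemma wordSymbol_low (l : List ℕ) {k s : ℕ} (hk : l.length = k) (hs : l.sum < s) :
    (wordAct Y l v, (0 : ℂ)) ∈ wordSymbol Y v k s :=
  Submodule.subset_span ⟨l, hk, Or.inr ⟨hs, rfl⟩⟩

lemma wordSymbol_map {k s k' s' : ℕ} (O : Module.End ℂ V) (r : ℂ)
    (h : ∀ l : List ℕ, l.length = k →
      ((l.sum = s → (O (wordAct Y l v), r) ∈ wordSymbol Y v k' s') ∧
       (l.sum < s → (O (wordAct Y l v), (0 : ℂ)) ∈ wordSymbol Y v k' s')))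
    {w : V} {c : ℂ} (hw : (w, c) ∈ wordSymbol Y v k s) :
    (O w, r * c) ∈ wordSymbol Y v k' s' := by
  have : wordSymbol Y v k s ≤
      (wordSymbol Y v k' s').comap (LinearMap.prodMap O (r • LinearMap.id)) := by
    refine Submodule.span_le.mpr ?_
    rintro q ⟨l, hl, ⟨hs, rfl⟩ | ⟨hs, rfl⟩⟩
    · simpa using (h l hl).1 hs
    · simpa using (h l hl).2 hs
  simpa using this hw

lemma wordSymbol_lower {k s s' : ℕ} (hs : s < s') {w : V} {c : ℂ}
    (hw : (w, c) ∈ wordSymbol Y v k s) : (w, (0 : ℂ)) ∈ wordSymbol Y v k s' := by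
  have := wordSymbol_map (k' := k) (s' := s') (1 : Module.End ℂ V) 0 (fun l hl =>
    ⟨fun h => wordSymbol_low l hl (by omega), fun h => wordSymbol_low l hl (by omega)⟩) hw
  simpa using this

lemma wordSymbol_Y {k s : ℕ} (i : ℕ) {w : V} {c : ℂ} (hw : (w, c) ∈ wordSymbol Y v k s) :
    (Y i w, c) ∈ wordSymbol Y v (k + 1) (s + i) := by
  have := wordSymbol_map (k' := k + 1) (s' := s + i) (Y i) 1 (fun l hl =>
    ⟨fun h => by
      rw [← wordAct_cons]
      exact wordSymbol_top (i :: l) (by simp [hl]) (by simp [h, add_comm]),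
     fun h => by
      rw [← wordAct_cons]
      exact wordSymbol_low (i :: l) (by simp [hl]) (by simp; omega)⟩) hw
  simpa using this

lemma wordSymbol_H_word (hH : ∀ j i, H j * Y i - Y i * H j = (-2 : ℂ) • Y (i + j))
    {ψ : ℕ → ℂ} (hv : ∀ j, H j v = ψ j • v) {j : ℕ} (hj : 0 < j) (l : List ℕ) :
    (H j (wordAct Y l v), -2 * (l.length : ℂ)) ∈ wordSymbol Y v l.length (l.sum + j) := by
  induction l with
  | nil =>
    have := Submodule.smul_mem _ (ψ j)
      (wordSymbol_low (Y := Y) (v := v) [] rfl (show ([] : List ℕ).sum < 0 + j by simpa using hj))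
    simpa [hv] using this
  | cons i l ih =>
    have h1 := wordSymbol_Y i ih
    have h2 := wordSymbol_top (Y := Y) (v := v) ((i + j) :: l) rfl rfl
    have h3 := LinearMap.congr_fun (hH j i) (wordAct Y l v)
    simp only [LinearMap.sub_apply, Module.End.mul_apply, LinearMap.smul_apply] at h3
    have e1 : ((i + j) :: l).sum = (i :: l).sum + j := by simp; omega
    have e2 : l.sum + j + i = (i :: l).sum + j := by simp; omega
    rw [e1] at h2
    rw [e2] at h1
    have h4 := add_mem h1 (Submodule.smul_mem _ (-2 : ℂ) h2)
    rw [wordAct_cons, sub_eq_iff_eq_add.mp h3]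
    refine (congrArg (· ∈ wordSymbol Y v (l.length + 1) ((i :: l).sum + j))
      (Prod.ext ?_ ?_)).mpr h4
    · simp only [wordAct_cons, Prod.fst_add, Prod.smul_fst]; abel
    · simp; ring

/-- Applying `X` to a word in the `Y_i` shortens it, raises the sum of the indices by one and
multiplies the leading coefficient by `-k (k + 1)`. -/
lemma wordSymbol_X_word (hX : ∀ i, X * Y i - Y i * X = H (i + 1))
    (hH : ∀ j i, H j * Y i - Y i * H j = (-2 : ℂ) • Y (i + j))
    {ψ : ℕ → ℂ} (hv : ∀ j, H j v = ψ j • v) (hXv : X v = 0) (l : List ℕ) :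
    ∀ k, l.length = k + 1 → (X (wordAct Y l v), -((k : ℂ) * (k + 1))) ∈
      wordSymbol Y v k (l.sum + 1) := by
  induction l with
  | nil => intro k hk; simp at hk
  | cons i l ih =>
    intro k hk
    have hk' : l.length = k := by simpa using hk
    have h1 := wordSymbol_H_word hH hv (show 0 < i + 1 by omega) l
    have h3 := LinearMap.congr_fun (hX i) (wordAct Y l v)
    simp only [LinearMap.sub_apply, Module.End.mul_apply] at h3
    have e1 : l.sum + (i + 1) = (i :: l).sum + 1 := by simp; omega
    rw [e1, hk'] at h1
    rw [wordAct_cons, sub_eq_iff_eq_add.mp h3]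
    cases k with
    | zero =>
      have : l = [] := List.length_eq_zero_iff.mp hk'
      subst this
      simpa [hXv] using h1
    | succ k =>
      have h2 := wordSymbol_Y i (ih k hk')
      have e2 : l.sum + 1 + i = (i :: l).sum + 1 := by simp; omega
      rw [e2] at h2
      convert add_mem h1 h2 using 1
      refine Prod.ext ?_ ?_
      · simp [add_comm]
      · simp; ring

/-- A polynomial relation from local nilpotency: `X^k (Y_0)^{k+1} v` is a combination of
`Y_0 v, …, Y_k v` in which `Y_k v` has a nonzero coefficient.  This replaces Garland's formula
for the divided powers in the loop algebra of `sl₂`. -/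
lemma exists_relation_of_nilpotent (hX : ∀ i, X * Y i - Y i * X = H (i + 1))
    (hH : ∀ j i, H j * Y i - Y i * H j = (-2 : ℂ) • Y (i + j))
    {ψ : ℕ → ℂ} (hv : ∀ j, H j v = ψ j • v) (hXv : X v = 0)
    (hnil : ∃ k, (Y 0 ^ k) v = 0) :
    ∃ p : Polynomial ℂ, p ≠ 0 ∧ p.sum (fun j a => a • Y j v) = 0 := by
  have hiter : ∀ k s m (w : V) (c : ℂ), c ≠ 0 → (w, c) ∈ wordSymbol Y v (m + 1 + k) s →
      ∃ c' ≠ 0, ((X ^ k) w, c') ∈ wordSymbol Y v (m + 1) (s + k) := by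
    intro k
    induction k with
    | zero => intro s m w c hc hw; exact ⟨c, hc, by simpa using hw⟩
    | succ k ih =>
      intro s m w c hc hw
      have h1 := wordSymbol_map (k' := m + 1 + k) (s' := s + 1) X
        (-(((m + 1 + k : ℕ) : ℂ) * ((m + 1 + k : ℕ) + 1))) (fun l hl => ?_) hw
      · have h3 : -(((m + 1 + k : ℕ) : ℂ) * ((m + 1 + k : ℕ) + 1)) ≠ 0 := by
          rw [neg_ne_zero, ← Nat.cast_add_one, ← Nat.cast_mul, Nat.cast_ne_zero]
          positivity
        obtain ⟨c', hc', h2⟩ := ih (s + 1) m (X w) _ (mul_ne_zero h3 hc) h1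
        refine ⟨c', hc', ?_⟩
        rw [pow_succ, Module.End.mul_apply]
        rwa [show s + (k + 1) = s + 1 + k by ring]
      · have h2 := wordSymbol_X_word hX hH hv hXv l (m + 1 + k) (by omega)
        exact ⟨fun hs => by rwa [hs] at h2, fun hs => wordSymbol_lower (by omega) h2⟩
  have hone : ∀ s, ∀ q ∈ wordSymbol Y v 1 s,
      ∃ p : Polynomial ℂ, p.coeff s = q.2 ∧ p.sum (fun j a => a • Y j v) = q.1 := by
    intro s q hq
    induction hq using Submodule.span_induction with
    | mem q hq =>
      obtain ⟨l, hl, hq⟩ := hq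
      obtain ⟨i, rfl⟩ := List.length_eq_one_iff.mp hl
      refine ⟨Polynomial.monomial i 1, ?_, ?_⟩
      · rcases hq with ⟨hs, rfl⟩ | ⟨hs, rfl⟩
        · simp only [List.sum_singleton] at hs
          simp [hs]
        · simp only [List.sum_singleton] at hs
          simp [Polynomial.coeff_monomial, hs.ne]
      · rw [Polynomial.sum_monomial_index _ _ (by simp)]
        rcases hq with ⟨hs, rfl⟩ | ⟨hs, rfl⟩ <;> simp
    | zero => exact ⟨0, by simp, by simp⟩
    | add x y _ _ h1 h2 =>
      obtain ⟨p, hp, hp'⟩ := h1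
      obtain ⟨q, hq, hq'⟩ := h2
      refine ⟨p + q, by simp [hp, hq], ?_⟩
      rw [Polynomial.sum_add_index _ _ _ (by simp) (fun _ _ _ => add_smul _ _ _), hp', hq']
      rfl
    | smul r x _ h =>
      obtain ⟨p, hp, hp'⟩ := h
      refine ⟨r • p, by simp [hp], ?_⟩
      rw [Polynomial.sum_smul_index _ _ _ (by simp), Prod.smul_fst, ← hp', Polynomial.sum,
        Polynomial.sum, Finset.smul_sum]
      simp [mul_smul]
  obtain ⟨k, hk⟩ := hnil
  have h0 : (Y 0 ^ (k + 1)) v = 0 := by rw [pow_succ', Module.End.mul_apply, hk, map_zero]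
  have h1 := wordSymbol_top (Y := Y) (v := v) (List.replicate (k + 1) 0) (k := 0 + 1 + k) (s := 0)
    (by simp [add_comm]) (by simp)
  rw [wordAct_replicate, h0] at h1
  obtain ⟨c, hc, h2⟩ := hiter k 0 0 _ 1 one_ne_zero h1
  obtain ⟨p, hp, hp'⟩ := hone _ _ h2
  refine ⟨p, ?_, by simpa using hp'⟩
  rintro rfl
  exact hc (by simpa using hp.symm)

end Garland

/-! ### Root-theoretic preliminaries -/

section Roots

open LieAlgebra LieAlgebra.IsKilling LieModule

variable {g : Type*} [LieRing g] [LieAlgebra ℂ g] [FiniteDimensional ℂ g] [LieAlgebra.IsSimple ℂ g]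
  {H : LieSubalgebra ℂ g} [H.IsCartanSubalgebra]

/-- A coweight on which every root takes its height as value. -/
lemma exists_height_coweight (Δ : (rootSystem H).Base) :
    ∃ h : H, ∀ i : H.root, (i : Weight ℂ H g) h = (Δ.height i : ℂ) := by
  obtain ⟨φ, hφ⟩ : ∃ φ : Module.Dual ℂ (Module.Dual ℂ H),
      ∀ i ∈ Δ.support, φ ((rootSystem H).root i) = 1 := by
    let b := Module.Basis.extend Δ.linearIndepOn_root.id_image
    refine ⟨b.constr ℂ fun _ => (1 : ℂ), fun i hi => ?_⟩
    have hi' : (rootSystem H).root i ∈ Δ.linearIndepOn_root.id_image.extend (Set.subset_univ _) :=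
      Δ.linearIndepOn_root.id_image.subset_extend _ ⟨i, hi, rfl⟩
    have := b.constr_basis ℂ (fun _ => (1 : ℂ)) ⟨_, hi'⟩
    rwa [Module.Basis.extend_apply_self] at this
  obtain ⟨h, hh⟩ := (Module.evalEquiv ℂ H).surjective φ
  have hh' : ∀ μ : Module.Dual ℂ H, μ h = φ μ := fun μ => by rw [← hh]; rfl
  refine ⟨h, fun i => ?_⟩
  obtain ⟨f, -, -, hf⟩ := Δ.exists_root_eq_sum_int i
  have h1 : (i : Weight ℂ H g) h = (rootSystem H).root i h := rfl
  rw [h1, hh', RootPairing.Base.height_eq_sum hf, hf, map_sum, Int.cast_sum]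
  refine Finset.sum_congr rfl fun j hj => ?_
  rw [map_zsmul, hφ j hj]
  simp

/-- An `sl₂`-triple attached to a root, with the coroot as its neutral element. -/
lemma exists_sl2 (i : H.root) : ∃ e f : g,
    e ∈ rootSpace H (i : Weight ℂ H g) ∧ f ∈ rootSpace H (-(i : Weight ℂ H g)) ∧
    ⁅e, f⁆ = (coroot (i : Weight ℂ H g) : g) ∧
    ⁅(coroot (i : Weight ℂ H g) : g), e⁆ = (2 : ℂ) • e ∧
    ⁅(coroot (i : Weight ℂ H g) : g), f⁆ = -((2 : ℂ) • f) ∧ e ≠ 0 ∧ f ≠ 0 := by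
  have hi := H.isNonZero_coe_root i
  obtain ⟨h, e, f, t, he, hf⟩ := exists_isSl2Triple_of_weight_isNonZero hi
  have hh := t.h_eq_coroot hi he hf
  refine ⟨e, f, he, hf, ?_, ?_, ?_, t.e_ne_zero, t.f_ne_zero⟩
  · rw [← hh, t.lie_e_f]
  · rw [← hh, t.lie_h_e_smul ℂ]
  · rw [← hh, t.lie_lie_smul_f ℂ]

lemma rootSpace_eq_span {α : Weight ℂ H g} (hα : α.IsNonZero) {x : g} (hx : x ∈ rootSpace H α)
    (hx0 : x ≠ 0) {y : g} (hy : y ∈ rootSpace H α) : ∃ r : ℂ, y = r • x := by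
  have h1 := finrank_rootSpace_eq_one α hα
  obtain ⟨r, hr⟩ := (finrank_eq_one_iff_of_nonzero' (⟨x, hx⟩ : rootSpace H α)
    (fun h => hx0 (congrArg Subtype.val h))).mp h1 ⟨y, hy⟩
  exact ⟨r, (congrArg Subtype.val hr).symm⟩

lemma lie_of_mem_rootSpace {α : H → ℂ} {x : g} (hx : x ∈ rootSpace H α) (h : H) :
    ⁅(h : g), x⁆ = α h • x :=
  lie_eq_smul_of_mem_rootSpace hx h

/-- A Lie algebra is spanned by a Cartan subalgebra and the root vectors. -/
lemma rootVector_induction {p : g → Prop} (x : g) (hH : ∀ h : H, p h)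
    (hr : ∀ (i : H.root), ∀ y ∈ rootSpace H (i : Weight ℂ H g), p y)
    (ha : ∀ x y, p x → p y → p (x + y)) : p x := by
  have htop := LieModule.iSup_genWeightSpace_eq_top' ℂ H g
  have hx : x ∈ (⨆ χ : Weight ℂ H g, (genWeightSpace g χ).toSubmodule) := by
    rw [← LieSubmodule.iSup_toSubmodule, htop]; trivial
  refine Submodule.iSup_induction _ (motive := p) hx ?_ (by simpa using hH 0) ha
  intro χ y hy
  by_cases hχ : χ.IsZero
  · have hy' : y ∈ rootSpace H (0 : H → ℂ) := by
      have : (χ : H → ℂ) = 0 := hχ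
      rw [this] at hy; exact hy
    rw [LieAlgebra.rootSpace_zero_eq] at hy'
    exact hH ⟨y, hy'⟩
  · exact hr ⟨χ, by simpa using hχ⟩ y hy

instance nonempty_root : Nonempty H.root := by
  by_contra hne
  rw [not_nonempty_iff] at hne
  refine LieAlgebra.IsSimple.non_abelian ℂ (L := g) ⟨fun x y => ?_⟩
  refine rootVector_induction (H := H) (p := fun x => ⁅x, y⁆ = 0) x (fun h => ?_)
    (fun i => hne.elim i) (fun a b h1 h2 => by rw [add_lie, h1, h2, add_zero])
  refine rootVector_induction (H := H) (p := fun y => ⁅(h : g), y⁆ = 0) y (fun h' => ?_)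
    (fun i => hne.elim i) (fun a b h1 h2 => by rw [lie_add, h1, h2, add_zero])
  have := LieModule.IsTrivial.trivial (L := H) (M := H) h h'
  exact congrArg Subtype.val this

/-- Subtracting a root on which a weight is at least two shortens the weight. -/
lemma sum_sq_lt {z : H.root → ℤ} {μ : Module.Dual ℂ H}
    (hz : ∀ j : H.root, μ (coroot (j : Weight ℂ H g)) = z j) (i : H.root) (hi : 2 ≤ z i) :
    ∃ z' : H.root → ℤ, (∀ j : H.root, (μ - (i : Weight ℂ H g).toLinear)
      (coroot (j : Weight ℂ H g)) = z' j) ∧ ∑ j, z' j ^ 2 < ∑ j, z j ^ 2 := by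
  obtain ⟨m, hm⟩ : ∃ m : H.root → ℤ, ∀ j : H.root,
      (i : Weight ℂ H g) (coroot (j : Weight ℂ H g)) = m j :=
    ⟨fun j => (rootSystem H).pairingIn ℤ i j, fun j => by
      have := (rootSystem H).algebraMap_pairingIn ℤ i j
      rw [rootSystem_pairing_apply] at this
      rw [← this]; rfl⟩
  have hmi : m i = 2 := by
    have := root_apply_coroot (H.isNonZero_coe_root i)
    rw [hm i] at this
    exact_mod_cast this
  refine ⟨fun j => z j - m j, fun j => ?_, ?_⟩
  · rw [LinearMap.sub_apply, hz, Weight.toLinear_apply, hm]; push_cast; rfl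
  · have h1 := congrArg μ ((rootSystem H).rootForm_self_smul_coroot i)
    have h2 : μ ((rootSystem H).Polarization ((rootSystem H).root i)) =
        (rootSystem H).RootForm ((rootSystem H).root i) μ :=
      (rootSystem H).toLinearMap_apply_apply_Polarization _ _
    have h3 : ∀ j, (rootSystem H).coroot' j ((rootSystem H).root i) = m j := hm
    have h4 : ∀ j, (rootSystem H).coroot' j μ = z j := hz
    rw [map_smul, map_nsmul, h2, (rootSystem H).rootForm_apply_apply,
      (rootSystem H).rootForm_apply_apply, rootSystem_coroot_apply, hz] at h1
    simp only [h3, h4, smul_eq_mul, nsmul_eq_mul, Nat.cast_ofNat] at h1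
    have h5 : (∑ j, m j * m j) * z i = 2 * ∑ j, m j * z j := by
      apply Int.cast_injective (α := ℂ)
      push_cast
      exact h1
    have h6 : ∑ j, (z j - m j) ^ 2 = ∑ j, z j ^ 2 - 2 * ∑ j, m j * z j + ∑ j, m j * m j := by
      rw [Finset.mul_sum, ← Finset.sum_sub_distrib, ← Finset.sum_add_distrib]
      exact Finset.sum_congr rfl fun j _ => by ring
    have h7 : 0 < ∑ j, m j * m j :=
      Finset.sum_pos' (fun j _ => mul_self_nonneg _) ⟨i, Finset.mem_univ _, by rw [hmi]; norm_num⟩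
    rw [h6, ← h5]
    nlinarith

/-- Weights on which all coroots take the values `-1, 0, 1`. -/
noncomputable def IsSmall (μ : Module.Dual ℂ H) : Prop :=
  ∀ j : H.root, ∃ z : ℤ, |z| ≤ 1 ∧ μ (coroot (j : Weight ℂ H g)) = z

lemma finite_isSmall : {μ : Module.Dual ℂ H | IsSmall μ}.Finite := by
  have hinj : Function.Injective fun (μ : Module.Dual ℂ H) (j : H.root) =>
      μ (coroot (j : Weight ℂ H g)) := by
    intro μ ν h
    refine LinearMap.ext_on (s := Set.range (rootSystem H).coroot) ?_ ?_
    · exact RootPairing.IsRootSystem.span_coroot_eq_top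
    · rintro _ ⟨j, rfl⟩
      exact congrFun h j
  refine Set.Finite.of_finite_image (f := fun (μ : Module.Dual ℂ H) (j : H.root) =>
      μ (coroot (j : Weight ℂ H g))) ?_ hinj.injOn
  refine (Set.Finite.pi' (t := fun _ : H.root => (fun z : ℤ => (z : ℂ)) '' Set.Icc (-1) 1)
    fun _ => (Set.finite_Icc _ _).image _).subset ?_
  rintro _ ⟨μ, hμ, rfl⟩ j
  obtain ⟨z, hz, hz'⟩ := hμ j
  exact ⟨z, abs_le.mp hz, hz'.symm⟩

/-- The index of the negative of a root. -/
noncomputable def negRoot (i : H.root) : H.root :=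
  ⟨-(i : Weight ℂ H g), by simpa using H.isNonZero_coe_root i⟩

@[simp] lemma coe_negRoot (i : H.root) : (negRoot i : Weight ℂ H g) = -(i : Weight ℂ H g) := rfl

lemma exists_two_le_of_not_isSmall {z : H.root → ℤ} {μ : Module.Dual ℂ H}
    (hz : ∀ j : H.root, μ (coroot (j : Weight ℂ H g)) = z j) (h : ¬ IsSmall μ) :
    ∃ i, 2 ≤ z i := by
  simp only [IsSmall, not_forall, not_exists, not_and] at h
  obtain ⟨j, hj⟩ := h
  have h1 : ¬ |z j| ≤ 1 := fun hc => hj (z j) hc (hz j)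
  rcases le_total 0 (z j) with h0 | h0
  · rw [abs_of_nonneg h0] at h1
    exact ⟨j, by omega⟩
  · rw [abs_of_nonpos h0] at h1
    refine ⟨negRoot j, ?_⟩
    have h2 := hz (negRoot j)
    rw [coe_negRoot, coroot_neg, map_neg, hz j] at h2
    have : z (negRoot j) = - z j := by exact_mod_cast h2.symm
    omega

lemma form_coroot_ne_zero (F : InvariantForm g) (i : H.root) :
    F.form (coroot (i : Weight ℂ H g) : g) (coroot (i : Weight ℂ H g) : g) ≠ 0 := by
  obtain ⟨e, f, he, hf, hef, hhe, hhf, he0, hf0⟩ := exists_sl2 i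
  have h1 : F.form (coroot (i : Weight ℂ H g) : g) (coroot (i : Weight ℂ H g) : g) =
      2 * F.form e f := by
    have h2 := F.invariant e f (coroot (i : Weight ℂ H g) : g)
    rw [hef, ← lie_skew, hhe, map_neg, neg_neg, map_smul, F.symm f e, smul_eq_mul] at h2
    exact h2
  rw [h1]
  refine mul_ne_zero two_ne_zero fun h0 => he0 ?_
  -- `e` is orthogonal to all weight spaces but that of `-α`, and `f` spans the latter
  refine F.nondegenerate.1 e fun y => ?_
  have horth : ∀ (α β : H → ℂ) (x z : g), x ∈ rootSpace H α → z ∈ rootSpace H β → α + β ≠ 0 →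
      F.form x z = 0 := by
    intro α β x z hx hz hne
    obtain ⟨h, hh⟩ := Function.ne_iff.mp hne
    have h2 := F.invariant (h : g) x z
    rw [lie_of_mem_rootSpace hx, lie_of_mem_rootSpace hz, map_smul, map_smul,
      LinearMap.smul_apply, smul_eq_mul, smul_eq_mul] at h2
    have h3 : (α h + β h) * F.form x z = 0 := by linear_combination h2
    exact (mul_eq_zero.mp h3).resolve_left hh
  refine rootVector_induction (H := H) (p := fun y => F.form e y = 0) y (fun h => ?_)
    (fun j y hy => ?_) (fun a b h1 h2 => by rw [map_add, h1, h2, add_zero])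
  · refine horth _ 0 e h he ?_ ?_
    · rw [LieAlgebra.rootSpace_zero_eq]; exact h.2
    · rw [add_zero]; exact H.isNonZero_coe_root i
  · by_cases hj : ((i : Weight ℂ H g) : H → ℂ) + ((j : Weight ℂ H g) : H → ℂ) = 0
    · have hj' : (j : Weight ℂ H g) = -(i : Weight ℂ H g) :=
        DFunLike.coe_injective (by rw [Weight.coe_neg]; exact (neg_eq_of_add_eq_zero_right hj).symm)
      rw [hj'] at hy
      obtain ⟨r, rfl⟩ := rootSpace_eq_span (H.isNonZero_coe_root (negRoot i))
        (x := f) hf hf0 hy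
      rw [map_smul, h0, smul_zero]
    · exact horth _ _ e y he hy hj

/-- `g⁻`, the sum of the root spaces of the negative roots. -/
noncomputable def gMinus (Δ : (rootSystem H).Base) : Submodule ℂ g :=
  ⨆ α : {α // Δ.IsPos α}, (rootSpace H (-((α : H.root) : Weight ℂ H g))).toSubmodule

end Roots

/-! ### The action of the loop toroidal algebra by operators -/

section LieAct

variable {L V : Type*} [LieRing L] [LieAlgebra ℂ L] [AddCommGroup V] [Module ℂ V]
  [LieRingModule L V] [LieModule ℂ L V]

/-- The action of a Lie algebra on a module, as a linear map. -/
noncomputable def lieAct (L V : Type*) [LieRing L] [LieAlgebra ℂ L] [AddCommGroup V] [Module ℂ V]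
    [LieRingModule L V] [LieModule ℂ L V] : L →ₗ[ℂ] Module.End ℂ V :=
  LinearMap.mk₂ ℂ (fun x v => ⁅x, v⁆) (fun x y v => add_lie x y v) (fun r x v => smul_lie r x v)
    (fun x v w => lie_add x v w) (fun r x v => lie_smul r x v)

lemma lieAct_apply (x : L) (v : V) : lieAct L V x v = ⁅x, v⁆ := rfl

lemma lieAct_comm (x y : L) : lieAct L V x * lieAct L V y - lieAct L V y * lieAct L V x =
    lieAct L V ⁅x, y⁆ := by
  ext v
  simp [lieAct_apply]

end LieAct

section Elements

variable {n : ℕ} {g : Type*} [LieRing g] [LieAlgebra ℂ g]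
  {B : Type*} [CommRing B] [Algebra ℂ B]

/-- The element `c ⊗ x` of `τ_1 = (A ⊗ B) ⊗ g`, bilinearly in `c` and `x`. -/
noncomputable def ct : Coeff n B →ₗ[ℂ] g →ₗ[ℂ] Tau1 n g B :=
  (TensorProduct.mk ℂ (Coeff n B) g : Coeff n B →ₗ[ℂ] g →ₗ[ℂ] Coeff n B ⊗[ℂ] g)

lemma elt_eq_ct (a : Laurent n) (b : B) (x : g) : Tau1.elt a b x = ct (a ⊗ₜ b) x := rfl

lemma ct_lie (c c' : Coeff n B) (x y : g) : ⁅ct c x, ct c' y⁆ = ct (c * c') ⁅x, y⁆ :=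
  LieAlgebra.ExtendScalars.bracket_tmul ℂ (Coeff n B) g g c c' x y

lemma ct_induction {p : Tau1 n g B → Prop} (u : Tau1 n g B)
    (ht : ∀ c x, p (ct c x)) (ha : ∀ u v, p u → p v → p (u + v)) : p u :=
  tau1_induction u (fun a b x => ht (a ⊗ₜ b) x) ha

/-- `A ⊗ B` is spanned by the elements `t^m ⊗ b`. -/
lemma coeff_induction {p : Coeff n B → Prop} (c : Coeff n B)
    (hm : ∀ m b, p (mono m ⊗ₜ b)) (ha : ∀ x y, p x → p y → p (x + y)) : p c := by
  induction c using TensorProduct.induction_on with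
  | zero => simpa using hm 0 0
  | tmul a b =>
    revert b
    induction a using laurent_induction with
    | hm m => exact hm m
    | ha x y hx hy => intro b; rw [TensorProduct.add_tmul]; exact ha _ _ (hx b) (hy b)
    | hs r x hx => intro b; rw [TensorProduct.smul_tmul]; exact hx _
  | add x y hx hy => exact ha _ _ hx hy

/-- The pairing `(a ⊗ b, a' ⊗ b') ↦ (da) a' ⊗ b b'` with values in `Z ⊗ B`. -/
noncomputable def kappa (n : ℕ) (B : Type*) [CommRing B] [Algebra ℂ B] :
    Coeff n B →ₗ[ℂ] Coeff n B →ₗ[ℂ] ZB n B :=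
  TensorProduct.map₂ (dmul n) (LinearMap.mul ℂ B)

lemma kappa_tmul (a a' : Laurent n) (b b' : B) :
    kappa n B (a ⊗ₜ b) (a' ⊗ₜ b') = dmul n a a' ⊗ₜ (b * b') := rfl

/-- The pairing vanishes on `1 ⊗ 1`, whose differential is zero. -/
lemma kappa_one (c : Coeff n B) : kappa n B 1 c = 0 := by
  have h1 : dOmega n 1 = 0 := by
    ext1 i
    have : (1 : Laurent n) = mono 0 := rfl
    rw [this, dOmega, LinearMap.pi_apply, deg_mono]
    simp
  induction c using TensorProduct.induction_on with
  | zero => simp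
  | tmul a b =>
    rw [Algebra.TensorProduct.one_def, kappa_tmul, dmul_apply, h1]
    have : (fun i => (0 : Omega n) i * a) = 0 := by ext1 i; simp
    rw [this, map_zero, TensorProduct.zero_tmul]
  | add x y hx hy => rw [map_add, hx, hy, add_zero]

lemma mono_mul_mono (k m : Fin (n + 1) → ℤ) : (mono k * mono m : Laurent n) = mono (k + m) := by
  simp [mono, AddMonoidAlgebra.single_mul_single]

/-- `t^k K_j ∈ Z`. -/
noncomputable def tK (k : Fin (n + 1) → ℤ) (j : Fin (n + 1)) : ZA n :=
  (LinearMap.range (dOmega n)).mkQ (Pi.single j (mono k))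

lemma dmul_mono (k m : Fin (n + 1) → ℤ) :
    dmul n (mono k) (mono m) = ∑ i, (k i : ℂ) • tK (k + m) i := by
  rw [dmul_apply]
  simp only [tK, ← map_smul, ← map_sum]
  congr 1
  ext1 i
  simp only [dOmega, LinearMap.pi_apply, deg_mono, smul_mul_assoc, mono_mul_mono,
    Finset.sum_apply, Pi.smul_apply]
  rw [Finset.sum_eq_single i, Finset.sum_eq_single i]
  · simp
  · intro j _ hj; simp [Pi.single_eq_of_ne hj.symm]
  · simp
  · intro j _ hj; simp [Pi.single_eq_of_ne hj]
  · simp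

lemma dmul_single (k : Fin (n + 1) → ℤ) (j : Fin (n + 1)) :
    dmul n (mono (Pi.single j 1)) (mono (k - Pi.single j 1)) = tK k j := by
  rw [dmul_mono, add_sub_cancel, Finset.sum_eq_single j]
  · simp
  · intro i _ hi; simp [Pi.single_eq_of_ne hi]
  · simp

lemma tK_zero (j : Fin (n + 1)) : tK 0 j = centralK n (Pi.single j 1) := by
  rw [tK, centralK, LinearMap.comp_apply]
  congr 1
  ext1 i
  rcases eq_or_ne i j with rfl | h
  · simp; rfl
  · simp [Pi.single_eq_of_ne h]

/-- `Z ⊗ B` is spanned by the elements `t^k K_j ⊗ b`. -/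
lemma ZB_induction {p : ZB n B → Prop} (z : ZB n B) (hm : ∀ k j b, p (tK k j ⊗ₜ b))
    (ha : ∀ x y, p x → p y → p (x + y)) : p z := by
  induction z using TensorProduct.induction_on with
  | zero => simpa using hm 0 0 0
  | tmul z b =>
    obtain ⟨a, rfl⟩ := Submodule.mkQ_surjective _ z
    have h0 : p 0 := by simpa using hm 0 0 0
    have h1 : ∀ (x : Laurent n) j b, p ((LinearMap.range (dOmega n)).mkQ (Pi.single j x) ⊗ₜ b) := by
      intro x
      induction x using laurent_induction with
      | hm m => exact fun j b => hm m j b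
      | ha x y hx hy =>
        intro j b
        rw [Pi.single_add, map_add, TensorProduct.add_tmul]
        exact ha _ _ (hx j b) (hy j b)
      | hs r x hx =>
        intro j b
        rw [Pi.single_smul, map_smul, TensorProduct.smul_tmul]
        exact hx j _
    rw [← Finset.univ_sum_single a, map_sum, TensorProduct.sum_tmul]
    exact Finset.sum_induction _ p ha h0 fun j _ => h1 _ j b
  | add x y hx hy => exact ha _ _ hx hy

lemma degTau1_ct (c : Fin (n + 1) → ℂ) (m : Fin (n + 1) → ℤ) (b : B) (x : g) :
    degTau1 n g B c (ct (mono m ⊗ₜ b) x) = (∑ i, c i * (m i : ℂ)) • ct (mono m ⊗ₜ b) x := by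
  rw [← elt_eq_ct, degTau1_tmul, deg_mono, elt_smul]

lemma degZ_tK (c : Fin (n + 1) → ℂ) (k : Fin (n + 1) → ℤ) (j : Fin (n + 1)) :
    degZ n c (tK k j) = (∑ i, c i * (k i : ℂ)) • tK k j := by
  rw [tK, degZ_mkQ, ← map_smul]
  congr 1
  ext1 i
  rcases eq_or_ne i j with rfl | h
  · simp [deg_mono]
  · simp [Pi.single_eq_of_ne h]

variable (F : InvariantForm g)

lemma cocycle_ct (c c' : Coeff n B) (x y : g) :
    cocycle n B F (ct c x) (ct c' y) = F.form x y • kappa n B c c' := rfl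

lemma ofTau1_lie (u v : Tau1 n g B) : ⁅Tau.ofTau1 F u, Tau.ofTau1 F v⁆ =
    Tau.ofTau1 F ⁅u, v⁆ + Tau.ofZB F (cocycle n B F u v) := by
  refine Prod.ext ?_ (Prod.ext ?_ ?_)
  · change ⁅u, v⁆ + degTau1 n g B 0 v - degTau1 n g B 0 u = ⁅u, v⁆ + 0
    simp
  · change cocycle n B F u v + degZB n B 0 0 - degZB n B 0 0 = 0 + cocycle n B F u v
    simp
  · change (0 : Fin (n + 1) → ℂ) = 0 + 0
    simp

lemma ofZB_lie_ofTau1 (z : ZB n B) (v : Tau1 n g B) : ⁅Tau.ofZB F z, Tau.ofTau1 F v⁆ = 0 := by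
  refine Prod.ext ?_ (Prod.ext ?_ ?_)
  · change ⁅(0 : Tau1 n g B), v⁆ + degTau1 n g B 0 v - degTau1 n g B 0 0 = 0
    simp
  · change cocycle n B F 0 v + degZB n B 0 0 - degZB n B 0 z = 0
    simp
  · rfl

lemma ofZB_lie_ofZB (z z' : ZB n B) : ⁅Tau.ofZB F z, Tau.ofZB F z'⁆ = 0 := by
  refine Prod.ext ?_ (Prod.ext ?_ ?_)
  · change ⁅(0 : Tau1 n g B), (0 : Tau1 n g B)⁆ + degTau1 n g B 0 0 - degTau1 n g B 0 0 = 0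
    simp
  · change cocycle n B F 0 0 + degZB n B 0 z' - degZB n B 0 z = 0
    simp
  · rfl

lemma ofD_lie_ofTau1 (c : Fin (n + 1) → ℂ) (v : Tau1 n g B) :
    ⁅(Tau.ofD F c : Tau n B F), Tau.ofTau1 F v⁆ = Tau.ofTau1 F (degTau1 n g B c v) := by
  refine Prod.ext ?_ (Prod.ext ?_ ?_)
  · change ⁅(0 : Tau1 n g B), v⁆ + degTau1 n g B c v - degTau1 n g B 0 0 = degTau1 n g B c v
    simp
  · change cocycle n B F 0 v + degZB n B c 0 - degZB n B 0 0 = 0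
    simp
  · rfl

lemma ofD_lie_ofZB (c : Fin (n + 1) → ℂ) (z : ZB n B) :
    ⁅(Tau.ofD F c : Tau n B F), Tau.ofZB F z⁆ = Tau.ofZB F (degZB n B c z) := by
  refine Prod.ext ?_ (Prod.ext ?_ ?_)
  · change ⁅(0 : Tau1 n g B), (0 : Tau1 n g B)⁆ + degTau1 n g B c 0 - degTau1 n g B 0 0 = 0
    simp
  · change cocycle n B F 0 0 + degZB n B c z - degZB n B 0 0 = degZB n B c z
    simp
  · rfl

lemma ofD_lie_ofD (c c' : Fin (n + 1) → ℂ) :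
    ⁅(Tau.ofD F c : Tau n B F), (Tau.ofD F c' : Tau n B F)⁆ = 0 := by
  refine Prod.ext ?_ (Prod.ext ?_ ?_)
  · change ⁅(0 : Tau1 n g B), (0 : Tau1 n g B)⁆ + degTau1 n g B c 0 - degTau1 n g B c' 0 = 0
    simp
  · change cocycle n B F 0 0 + degZB n B c 0 - degZB n B c' 0 = 0
    simp
  · rfl

lemma tau_eq (x : Tau n B F) :
    x = Tau.ofTau1 F x.1 + Tau.ofZB F x.2.1 + Tau.ofD F x.2.2 := by
  refine Prod.ext ?_ (Prod.ext ?_ ?_)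
  · change x.1 = x.1 + 0 + 0; simp
  · change x.2.1 = 0 + x.2.1 + 0; simp
  · change x.2.2 = 0 + 0 + x.2.2; simp

end Elements

/-! ### Weights of integrable modules with trivial centre -/

section Weights

open LieAlgebra LieAlgebra.IsKilling LieModule

variable {n : ℕ} {g : Type*} [LieRing g] [LieAlgebra ℂ g]
  {B : Type*} [CommRing B] [Algebra ℂ B] (F : InvariantForm g)
  (V : Type*) [AddCommGroup V] [Module ℂ V] [LieRingModule (Tau n B F) V]
  [LieModule ℂ (Tau n B F) V]

variable (n B)

/-- The operators by which `τ_1 ⊆ τ(B)` acts. -/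
noncomputable def aT : Tau1 n g B →ₗ[ℂ] Module.End ℂ V := lieAct (Tau n B F) V ∘ₗ Tau.ofTau1 F

/-- The operators by which `Z ⊗ B ⊆ τ(B)` acts. -/
noncomputable def aZ : ZB n B →ₗ[ℂ] Module.End ℂ V := lieAct (Tau n B F) V ∘ₗ Tau.ofZB F

/-- The operators by which `D ⊆ τ(B)` acts. -/
noncomputable def aD : (Fin (n + 1) → ℂ) →ₗ[ℂ] Module.End ℂ V :=
  lieAct (Tau n B F) V ∘ₗ Tau.ofD F

variable {n B V}

lemma aT_comm (u v : Tau1 n g B) : aT n B F V u * aT n B F V v - aT n B F V v * aT n B F V u =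
    aT n B F V ⁅u, v⁆ + aZ n B F V (cocycle n B F u v) := by
  have := lieAct_comm (V := V) (Tau.ofTau1 F u) (Tau.ofTau1 F v)
  rw [ofTau1_lie, map_add] at this
  exact this

lemma aT_comm_ct (c c' : Coeff n B) (x y : g) :
    aT n B F V (ct c x) * aT n B F V (ct c' y) - aT n B F V (ct c' y) * aT n B F V (ct c x) =
    aT n B F V (ct (c * c') ⁅x, y⁆) + F.form x y • aZ n B F V (kappa n B c c') := by
  rw [aT_comm, ct_lie, cocycle_ct, map_smul]

lemma aZ_comm_aT (z : ZB n B) (v : Tau1 n g B) : aZ n B F V z * aT n B F V v = aT n B F V v * aZ n B F V z := by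
  have := lieAct_comm (V := V) (Tau.ofZB F z) (Tau.ofTau1 F v)
  rw [ofZB_lie_ofTau1, map_zero, sub_eq_zero] at this
  exact this

lemma aZ_comm_aZ (z z' : ZB n B) : aZ n B F V z * aZ n B F V z' = aZ n B F V z' * aZ n B F V z := by
  have := lieAct_comm (V := V) (Tau.ofZB F z) (Tau.ofZB F z')
  rw [ofZB_lie_ofZB, map_zero, sub_eq_zero] at this
  exact this

lemma aD_comm_aT (c : Fin (n + 1) → ℂ) (v : Tau1 n g B) :
    aD n B F V c * aT n B F V v - aT n B F V v * aD n B F V c = aT n B F V (degTau1 n g B c v) := by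
  have := lieAct_comm (V := V) (Tau.ofD F c : Tau n B F) (Tau.ofTau1 F v)
  rw [ofD_lie_ofTau1] at this
  exact this

lemma aD_comm_aZ (c : Fin (n + 1) → ℂ) (z : ZB n B) :
    aD n B F V c * aZ n B F V z - aZ n B F V z * aD n B F V c = aZ n B F V (degZB n B c z) := by
  have := lieAct_comm (V := V) (Tau.ofD F c : Tau n B F) (Tau.ofZB F z)
  rw [ofD_lie_ofZB] at this
  exact this

lemma aD_comm_aD (c c' : Fin (n + 1) → ℂ) : aD n B F V c * aD n B F V c' = aD n B F V c' * aD n B F V c := by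
  have := lieAct_comm (V := V) (Tau.ofD F c : Tau n B F) (Tau.ofD F c')
  rw [ofD_lie_ofD, map_zero, sub_eq_zero] at this
  exact this

lemma lie_eq (x : Tau n B F) (v : V) :
    ⁅x, v⁆ = aT n B F V x.1 v + aZ n B F V x.2.1 v + aD n B F V x.2.2 v := by
  conv_lhs => rw [tau_eq F x]
  rw [add_lie, add_lie]; rfl

/-- In an irreducible module, a nonzero subspace stable under the three kinds of operators is
everything. -/
lemma eq_top_of_stable (hirr : LieModule.IsIrreducible ℂ (Tau n B F) V) (S : Submodule ℂ V)
    (hS : S ≠ ⊥) (hT : ∀ u, ∀ v ∈ S, aT n B F V u v ∈ S) (hZ : ∀ z, ∀ v ∈ S, aZ n B F V z v ∈ S)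
    (hD : ∀ c, ∀ v ∈ S, aD n B F V c v ∈ S) : S = ⊤ := by
  let S' : LieSubmodule ℂ (Tau n B F) V :=
    { S with
      lie_mem := by
        intro x v hv
        rw [lie_eq]
        exact add_mem (add_mem (hT _ _ hv) (hZ _ _ hv)) (hD _ _ hv) }
  have hS' : S'.toSubmodule = S := rfl
  rcases hirr.eq_bot_or_eq_top S' with h | h
  · exact absurd (by rw [← hS', h]; rfl) hS
  · rw [← hS', h]; rfl

/-- A central element of `Z ⊗ B` that acts with a kernel acts by zero. -/
lemma aZ_eq_zero_of_ker (hirr : LieModule.IsIrreducible ℂ (Tau n B F) V)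
    (k : Fin (n + 1) → ℤ) (j : Fin (n + 1)) (b : B) {v : V} (hv : v ≠ 0)
    (hzv : aZ n B F V (tK k j ⊗ₜ b) v = 0) : aZ n B F V (tK k j ⊗ₜ b) = 0 := by
  rw [← LinearMap.ker_eq_top]
  refine eq_top_of_stable F hirr _ (fun h => hv ?_) ?_ ?_ ?_
  · rwa [← LinearMap.mem_ker, h] at hzv
  · intro u w hw
    rw [LinearMap.mem_ker] at hw ⊢
    rw [← Module.End.mul_apply, aZ_comm_aT, Module.End.mul_apply, hw, map_zero]
  · intro u w hw
    rw [LinearMap.mem_ker] at hw ⊢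
    rw [← Module.End.mul_apply, aZ_comm_aZ, Module.End.mul_apply, hw, map_zero]
  · intro c w hw
    rw [LinearMap.mem_ker] at hw ⊢
    have := LinearMap.congr_fun (aD_comm_aZ (V := V) F c (tK k j ⊗ₜ b)) w
    rw [degZB_tmul, degZ_tK, ← TensorProduct.smul_tmul', map_smul, LinearMap.sub_apply,
      Module.End.mul_apply, Module.End.mul_apply, hw, map_zero, zero_sub, LinearMap.smul_apply, hw,
      smul_zero, neg_eq_zero] at this
    exact this

variable (n B V) (H : LieSubalgebra ℂ g)

/-- The simultaneous eigenspace for `h` (eigenvalue `lam`) and `D` (eigenvalue `d`). -/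
def wt (lam : Module.Dual ℂ H) (d : Fin (n + 1) → ℂ) : Submodule ℂ V where
  carrier := {v | (∀ h : H, aT n B F V (ct 1 (h : g)) v = lam h • v) ∧
    ∀ c, aD n B F V c v = (∑ i, c i * d i) • v}
  zero_mem' := ⟨fun h => by simp, fun c => by simp⟩
  add_mem' := fun ha hb => ⟨fun h => by rw [map_add, ha.1, hb.1, smul_add],
    fun c => by rw [map_add, ha.2, hb.2, smul_add]⟩
  smul_mem' := fun r v hv => ⟨fun h => by rw [map_smul, hv.1, smul_comm],
    fun c => by rw [map_smul, hv.2, smul_comm]⟩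

variable {n}

/-- An integral vector as a complex one. -/
def intVec (m : Fin (n + 1) → ℤ) : Fin (n + 1) → ℂ := fun i => (m i : ℂ)

lemma intVec_add (m k : Fin (n + 1) → ℤ) : intVec (m + k) = intVec m + intVec k := by
  ext i; simp [intVec]

lemma intVec_zero : intVec (0 : Fin (n + 1) → ℤ) = 0 := by
  ext i; simp [intVec]

lemma intVec_neg (m : Fin (n + 1) → ℤ) : intVec (-m) = -intVec m := by
  ext i; simp [intVec]

variable {B V H}

lemma mem_wt {lam : Module.Dual ℂ H} {d : Fin (n + 1) → ℂ} {v : V} :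
    v ∈ wt n B F V H lam d ↔ (∀ h : H, aT n B F V (ct 1 (h : g)) v = lam h • v) ∧
      ∀ c, aD n B F V c v = (∑ i, c i * d i) • v := Iff.rfl

lemma aT_mem_wt {lam : Module.Dual ℂ H} {d : Fin (n + 1) → ℂ} {v : V} (hv : v ∈ wt n B F V H lam d)
    {α : Module.Dual ℂ H} {x : g} (hx : ∀ h : H, ⁅(h : g), x⁆ = α h • x)
    (m : Fin (n + 1) → ℤ) (b : B) :
    aT n B F V (ct (mono m ⊗ₜ b) x) v ∈ wt n B F V H (lam + α) (d + intVec m) := by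
  refine ⟨fun h => ?_, fun c => ?_⟩
  · have := LinearMap.congr_fun (aT_comm_ct (V := V) F 1 (mono m ⊗ₜ b) (h : g) x) v
    rw [kappa_one, map_zero, smul_zero, add_zero, one_mul, hx, map_smul, map_smul,
      LinearMap.sub_apply, Module.End.mul_apply, Module.End.mul_apply, hv.1, map_smul,
      sub_eq_iff_eq_add] at this
    rw [this, LinearMap.smul_apply, LinearMap.add_apply, add_smul, add_comm]
  · have := LinearMap.congr_fun (aD_comm_aT (V := V) F c (ct (mono m ⊗ₜ b) x)) v
    rw [degTau1_ct, map_smul, LinearMap.sub_apply, Module.End.mul_apply, Module.End.mul_apply,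
      hv.2, map_smul, sub_eq_iff_eq_add] at this
    rw [this, LinearMap.smul_apply, ← add_smul]
    congr 1
    simp only [Pi.add_apply, mul_add, Finset.sum_add_distrib, intVec]
    ring

lemma iSup_wt_eq_top [LieRing.IsNilpotent H] (hint : IsIntegrable n B F H V) :
    (⨆ p : Module.Dual ℂ H × (Fin (n + 1) → ℂ), wt n B F V H p.1 p.2) = ⊤ := by
  classical
  rw [eq_top_iff, ← hint.weight.submodule_iSup_eq_top, iSup_le_iff]
  intro lam
  refine le_trans ?_ (le_iSup (fun p : Module.Dual ℂ H × (Fin (n + 1) → ℂ) => wt n B F V H p.1 p.2)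
    (lam ∘ₗ LinearMap.inl ℂ H _, fun i => lam (0, 0, Pi.single i 1)))
  intro v hv
  refine ⟨fun h => ?_, fun c => ?_⟩
  · have := hv (h, 0, 0)
    simp only [FullCartan.toTau, map_zero, TensorProduct.zero_tmul, add_zero] at this
    exact this
  · have := hv (0, 0, c)
    have hc : lam (0, 0, c) = ∑ i, c i * lam (0, 0, Pi.single i 1) := by
      have h1 : ((0, 0, c) : FullCartan n H) = ∑ i, c i • ((0, 0, Pi.single i 1) : FullCartan n H) := by
        refine Prod.ext (by simp [Prod.fst_sum]) (Prod.ext (by simp [Prod.snd_sum, Prod.fst_sum]) ?_)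
        simp only [Prod.snd_sum, Prod.smul_mk]
        ext j
        simp [Finset.sum_apply, Pi.single_apply]
      rw [h1, map_sum]
      exact Finset.sum_congr rfl fun i _ => by rw [map_smul, smul_eq_mul]
    rw [hc] at this
    rw [← this]
    have h2 : (Tau1.elt 1 1 0 : Tau1 n g B) = 0 := map_zero (ct 1)
    simp only [FullCartan.toTau, ZeroMemClass.coe_zero, h2, map_zero, TensorProduct.zero_tmul,
      zero_add]
    rfl

lemma aZ_centralK (hK : ∀ (i : Fin (n + 1)) (v : V),
      ⁅Tau.ofZB F (centralK n (Pi.single i 1) ⊗ₜ[ℂ] (1 : B)), v⁆ = 0)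
    (c : Fin (n + 1) → ℂ) : aZ n B F V (centralK n c ⊗ₜ 1) = 0 := by
  have h : centralK n c = ∑ i, c i • centralK n (Pi.single i 1) := by
    simp only [← map_smul, ← map_sum]
    congr 1
    ext j
    simp [Finset.sum_apply, Pi.single_apply]
  rw [h, TensorProduct.sum_tmul, map_sum]
  refine Finset.sum_eq_zero fun i _ => ?_
  rw [← TensorProduct.smul_tmul', map_smul]
  have : aZ n B F V (centralK n (Pi.single i 1) ⊗ₜ 1) = 0 := LinearMap.ext fun v => hK i v
  rw [this, smul_zero]

/-- The linear form on the full Cartan subalgebra that gives the weight space `wt lam d`. -/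
def fullWeight (lam : Module.Dual ℂ H) (d : Fin (n + 1) → ℂ) : Module.Dual ℂ (FullCartan n H) :=
  lam.coprod ((0 : (Fin (n + 1) → ℂ) →ₗ[ℂ] ℂ).coprod (∑ i, d i • LinearMap.proj i))

lemma wt_le_weightSpace (hK : ∀ (i : Fin (n + 1)) (v : V),
      ⁅Tau.ofZB F (centralK n (Pi.single i 1) ⊗ₜ[ℂ] (1 : B)), v⁆ = 0)
    (lam : Module.Dual ℂ H) (d : Fin (n + 1) → ℂ) :
    wt n B F V H lam d ≤ weightSpace n B F H V (fullWeight lam d) := by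
  intro v hv x
  have h1 : ⁅(x.toTau F H : Tau n B F), v⁆ = aT n B F V (ct 1 (x.1 : g)) v +
      aZ n B F V (centralK n x.2.1 ⊗ₜ 1) v + aD n B F V x.2.2 v := by
    rw [FullCartan.toTau, add_lie, add_lie]; rfl
  rw [h1, aZ_centralK F hK, hv.1, hv.2, LinearMap.zero_apply, add_zero, ← add_smul]
  congr 1
  simp [fullWeight, LinearMap.sum_apply, mul_comm]

end Weights

/-! ### Finiteness of weights, vanishing of the centre, and highest weight vectors -/

section Highest

open LieAlgebra LieAlgebra.IsKilling LieModule

variable {n : ℕ} {g : Type*} [LieRing g] [LieAlgebra ℂ g] [FiniteDimensional ℂ g]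
  [LieAlgebra.IsSimple ℂ g] {H : LieSubalgebra ℂ g} [H.IsCartanSubalgebra]
  {B : Type*} [CommRing B] [Algebra ℂ B] (F : InvariantForm g)
  {V : Type*} [AddCommGroup V] [Module ℂ V] [LieRingModule (Tau n B F) V]
  [LieModule ℂ (Tau n B F) V]

lemma aT_nilpotent (hint : IsIntegrable n B F H V) (i : H.root) {x : g}
    (hx : x ∈ rootSpace H (i : Weight ℂ H g)) (m : Fin (n + 1) → ℤ) (b : B) (v : V) :
    ∃ k : ℕ, ((aT n B F V (ct (mono m ⊗ₜ b) x)) ^ k) v = 0 :=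
  hint.nilpotent i (H.isNonZero_coe_root i) x hx m b v

/-- At level zero, `e ⊗ t^m`, `f ⊗ t^{-m}` and `h ⊗ 1` form an `sl₂`-triple of operators. -/
lemma aT_sl2 (hK : ∀ (i : Fin (n + 1)) (v : V),
      ⁅Tau.ofZB F (centralK n (Pi.single i 1) ⊗ₜ[ℂ] (1 : B)), v⁆ = 0)
    {e f h : g} (hef : ⁅e, f⁆ = h) (hhe : ⁅h, e⁆ = (2 : ℂ) • e) (hhf : ⁅h, f⁆ = -((2 : ℂ) • f))
    (m : Fin (n + 1) → ℤ) :
    aT n B F V (ct (mono m ⊗ₜ 1) e) * aT n B F V (ct (mono (-m) ⊗ₜ 1) f) -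
      aT n B F V (ct (mono (-m) ⊗ₜ 1) f) * aT n B F V (ct (mono m ⊗ₜ 1) e) =
      aT n B F V (ct 1 h) ∧
    aT n B F V (ct 1 h) * aT n B F V (ct (mono m ⊗ₜ 1) e) -
      aT n B F V (ct (mono m ⊗ₜ 1) e) * aT n B F V (ct 1 h) =
      (2 : ℂ) • aT n B F V (ct (mono m ⊗ₜ 1) e) ∧
    aT n B F V (ct 1 h) * aT n B F V (ct (mono (-m) ⊗ₜ 1) f) -
      aT n B F V (ct (mono (-m) ⊗ₜ 1) f) * aT n B F V (ct 1 h) =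
      -((2 : ℂ) • aT n B F V (ct (mono (-m) ⊗ₜ 1) f)) := by
  refine ⟨?_, ?_, ?_⟩
  · rw [aT_comm_ct, hef, kappa_tmul, dmul_mono, add_neg_cancel, Algebra.TensorProduct.tmul_mul_tmul,
      mono_mul_mono, add_neg_cancel, mul_one]
    have h1 : ∑ i, (m i : ℂ) • tK (0 : Fin (n + 1) → ℤ) i = centralK n (intVec m) := by
      simp only [tK_zero, ← map_smul, ← map_sum]
      congr 1
      ext j
      simp [Finset.sum_apply, Pi.single_apply, intVec]
    rw [h1, aZ_centralK F hK, smul_zero, add_zero]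
    rfl
  · rw [aT_comm_ct, kappa_one, map_zero, smul_zero, add_zero, one_mul, hhe, map_smul, map_smul]
  · rw [aT_comm_ct, kappa_one, map_zero, smul_zero, add_zero, one_mul, hhf, map_neg, map_neg,
      map_smul, map_smul]

lemma weight_integral (hK : ∀ (i : Fin (n + 1)) (v : V),
      ⁅Tau.ofZB F (centralK n (Pi.single i 1) ⊗ₜ[ℂ] (1 : B)), v⁆ = 0)
    (hint : IsIntegrable n B F H V) {lam : Module.Dual ℂ H} {d : Fin (n + 1) → ℂ}
    (h : wt n B F V H lam d ≠ ⊥) :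
    ∃ z : H.root → ℤ, ∀ j : H.root, lam (coroot (j : Weight ℂ H g)) = z j := by
  obtain ⟨v, hv, hv0⟩ := Submodule.exists_mem_ne_zero_of_ne_bot h
  have : ∀ j : H.root, ∃ z : ℤ, lam (coroot (j : Weight ℂ H g)) = z := by
    intro j
    obtain ⟨e, f, he, hf, hef, hhe, hhf, -, -⟩ := exists_sl2 j
    obtain ⟨h1, h2, h3⟩ := aT_sl2 (B := B) (V := V) F hK hef hhe hhf 0
    exact sl2_int h1 h2 h3 (aT_nilpotent F hint j he _ _) (aT_nilpotent F hint (negRoot j) hf _ _)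
      hv0 (hv.1 _)
  choose z hz using this
  exact ⟨z, hz⟩

lemma lie_rootVector (i : H.root) {x : g} (hx : x ∈ rootSpace H (i : Weight ℂ H g)) (h : H) :
    ⁅(h : g), x⁆ = Weight.toLinear ℂ H g i h • x :=
  lie_of_mem_rootSpace hx h

lemma lie_negRootVector (i : H.root) {x : g} (hx : x ∈ rootSpace H (-(i : Weight ℂ H g))) (h : H) :
    ⁅(h : g), x⁆ = (-(Weight.toLinear ℂ H g i)) h • x := by
  have := lie_of_mem_rootSpace hx h
  rw [this]
  simp

/-- A weight on which a coroot is at least two is reached by raising: its weight space lies in each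
stable subspace that contains the weight space one root lower, in any other degree. -/
lemma mem_of_lower_mem (hK : ∀ (i : Fin (n + 1)) (v : V),
      ⁅Tau.ofZB F (centralK n (Pi.single i 1) ⊗ₜ[ℂ] (1 : B)), v⁆ = 0)
    (hint : IsIntegrable n B F H V) {lam : Module.Dual ℂ H} {d : Fin (n + 1) → ℂ}
    (i : H.root) {z : ℤ} (hz : lam (coroot (i : Weight ℂ H g)) = z) (hz2 : 2 ≤ z)
    (m : Fin (n + 1) → ℤ) (E : Submodule ℂ V)
    (hE : ∀ x : g, ∀ k, ∀ v ∈ E, aT n B F V (ct (mono k ⊗ₜ 1) x) v ∈ E)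
    (hle : wt n B F V H (lam - Weight.toLinear ℂ H g i) (d - intVec m) ≤ E) :
    wt n B F V H lam d ≤ E := by
  intro v hv
  obtain ⟨e, f, he, hf, hef, hhe, hhf, -, -⟩ := exists_sl2 i
  obtain ⟨h1, h2, h3⟩ := aT_sl2 (B := B) (V := V) F hK hef hhe hhf m
  obtain ⟨p, rfl⟩ := Int.eq_ofNat_of_zero_le (show 0 ≤ z by omega)
  refine sl2_mem h1 h2 E (hE _ _) (hE _ _) (p := p) (by omega) ?_
    (aT_nilpotent F hint i he _ _ v) (hle ?_)
  · rw [hv.1, hz]; simp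
  · have := aT_mem_wt F hv (lie_negRootVector i hf) (-m) 1
    rwa [intVec_neg, ← sub_eq_add_neg, ← sub_eq_add_neg] at this

/-- Each `D`-homogeneous component is finite-dimensional: it is contained in the `g`-module
generated by the finitely many weight spaces of small weight. -/
lemma exists_finiteDimensional_component (hK : ∀ (i : Fin (n + 1)) (v : V),
      ⁅Tau.ofZB F (centralK n (Pi.single i 1) ⊗ₜ[ℂ] (1 : B)), v⁆ = 0)
    (hint : IsIntegrable n B F H V)
    (hfin : ∀ lam : Module.Dual ℂ (FullCartan n H), FiniteDimensional ℂ (weightSpace n B F H V lam))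
    (d : Fin (n + 1) → ℂ) :
    ∃ E : Submodule ℂ V, FiniteDimensional ℂ E ∧ ∀ lam, wt n B F V H lam d ≤ E := by
  classical
  have hwfin : ∀ lam, FiniteDimensional ℂ (wt n B F V H lam d) := fun lam => by
    have := hfin (fullWeight lam d)
    exact Submodule.finiteDimensional_of_le (wt_le_weightSpace F hK lam d)
  let s : Finset (Module.Dual ℂ H) := (finite_isSmall (H := H)).toFinset
  let W : Submodule ℂ V := s.sup fun lam => wt n B F V H lam d
  have : FiniteDimensional ℂ W := Submodule.finiteDimensional_finset_sup _ _
  choose e f he hf hef hhe hhf he0 hf0 using fun i : H.root => exists_sl2 i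
  let bH := Module.finBasis ℂ H
  -- root vectors and a basis of `H`
  let w : H.root ⊕ Fin (Module.finrank ℂ H) → g := Sum.elim e fun j => (bH j : g)
  have hspan : ∀ x : g, x ∈ Submodule.span ℂ (Set.range w) := by
    intro x
    refine rootVector_induction (H := H) (p := fun x => x ∈ Submodule.span ℂ (Set.range w)) x ?_ ?_
      (fun x y => add_mem)
    · intro h
      rw [← bH.sum_repr h]
      simp only [AddSubmonoidClass.coe_finsetSum, SetLike.val_smul]
      exact Submodule.sum_mem _ fun j _ =>
        Submodule.smul_mem _ _ (Submodule.subset_span ⟨Sum.inr j, rfl⟩)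
    · intro i y hy
      obtain ⟨r, rfl⟩ := rootSpace_eq_span (H.isNonZero_coe_root i) (he i) (he0 i) hy
      exact Submodule.smul_mem _ _ (Submodule.subset_span ⟨Sum.inl i, rfl⟩)
  let A : g →ₗ[ℂ] Module.End ℂ V := aT n B F V ∘ₗ ct 1
  have hA : ∀ x y, A x * A y - A y * A x = A ⁅x, y⁆ := by
    intro x y
    have := aT_comm_ct (V := V) F (1 : Coeff n B) 1 x y
    rwa [kappa_one, map_zero, smul_zero, add_zero, one_mul] at this
  have hAspan : ∀ x, A x ∈ Submodule.span ℂ (Set.range fun i => A (w i)) := by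
    intro x
    have := Submodule.mem_map_of_mem (f := A) (hspan x)
    rwa [Submodule.map_span, ← Set.range_comp] at this
  obtain ⟨E, hEfin, hWE, hE⟩ := exists_finiteDimensional_stable (fun i => A (w i))
    (fun i j => by rw [hA]; exact hAspan _) (by
      rintro (i | j) v
      · exact locallyFinite_of_nilpotent (aT_nilpotent F hint i (he i) 0 1 v)
      · have hv : v ∈ (⨆ p : Module.Dual ℂ H × (Fin (n + 1) → ℂ), wt n B F V H p.1 p.2) := by
          rw [iSup_wt_eq_top F hint]; trivial
        refine Submodule.iSup_induction _ (motive := fun v => ∃ S : Submodule ℂ V,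
          FiniteDimensional ℂ S ∧ v ∈ S ∧ ∀ u ∈ S, A (w (Sum.inr j)) u ∈ S) hv ?_ ?_ ?_
        · intro p v hv
          refine ⟨Submodule.span ℂ {v}, inferInstance, Submodule.mem_span_singleton_self v, ?_⟩
          intro u hu
          obtain ⟨r, rfl⟩ := Submodule.mem_span_singleton.mp hu
          have : A (w (Sum.inr j)) v = p.1 (bH j) • v := hv.1 _
          rw [map_smul, this]
          exact Submodule.smul_mem _ _ (Submodule.smul_mem _ _ (Submodule.mem_span_singleton_self v))
        · exact ⟨⊥, inferInstance, by simp, fun u hu => by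
            rw [(Submodule.mem_bot ℂ).mp hu, map_zero]; simp⟩
        · rintro u v ⟨S, hS, hu, hSu⟩ ⟨S', hS', hv, hSv⟩
          refine ⟨S ⊔ S', inferInstance, add_mem (Submodule.mem_sup_left hu)
            (Submodule.mem_sup_right hv), fun x hx => ?_⟩
          obtain ⟨y, hy, z, hz, rfl⟩ := Submodule.mem_sup.mp hx
          rw [map_add]
          exact add_mem (Submodule.mem_sup_left (hSu y hy)) (Submodule.mem_sup_right (hSv z hz))) W
  refine ⟨E, hEfin, ?_⟩
  have hEx : ∀ x : g, ∀ v ∈ E, A x v ∈ E := by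
    intro x v hv
    have hgen : ∀ T ∈ Submodule.span ℂ (Set.range fun i => A (w i)), T v ∈ E := by
      intro T hT
      induction hT using Submodule.span_induction with
      | mem T hT => obtain ⟨i, rfl⟩ := hT; exact hE i v hv
      | zero => simp
      | add u v _ _ h1 h2 => exact add_mem h1 h2
      | smul r u _ h => exact Submodule.smul_mem _ _ h
    exact hgen _ (hAspan x)
  -- induction on the length of the weight, subtracting a root with coroot value at least two
  have key : ∀ N : ℕ, ∀ (z : H.root → ℤ) (lam : Module.Dual ℂ H),
      (∀ j : H.root, lam (coroot (j : Weight ℂ H g)) = z j) → ∑ j, z j ^ 2 = N →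
      wt n B F V H lam d ≤ E := by
    intro N
    induction N using Nat.strong_induction_on with
    | _ N ih =>
      intro z lam hz hN
      by_cases hsm : IsSmall lam
      · exact le_trans (Finset.le_sup (f := fun lam => wt n B F V H lam d)
          (by simpa [s] using hsm)) hWE
      · obtain ⟨i, hi⟩ := exists_two_le_of_not_isSmall hz hsm
        obtain ⟨z', hz', hlt⟩ := sum_sq_lt hz i hi
        obtain ⟨N', hN'⟩ := Int.eq_ofNat_of_zero_le
          (Finset.sum_nonneg fun j _ => sq_nonneg (z' j) : 0 ≤ ∑ j, z' j ^ 2)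
        have hle := ih N' (by omega) z' _ hz' hN'
        intro v hv
        obtain ⟨h1, h2, h3⟩ := aT_sl2 (B := B) (V := V) F hK (hef i) (hhe i) (hhf i) 0
        obtain ⟨p, hp⟩ := Int.eq_ofNat_of_zero_le (show 0 ≤ z i by omega)
        have h0 : (mono (-(0 : Fin (n + 1) → ℤ)) ⊗ₜ 1 : Coeff n B) = 1 := by rw [neg_zero]; rfl
        rw [h0] at h1
        refine sl2_mem (p := p) h1 h2 E (hEx (e i)) (hEx (f i)) (by omega) ?_
          (aT_nilpotent F hint i (he i) 0 1 v) (hle ?_)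
        · rw [hv.1, hz, hp]; simp
        · have := aT_mem_wt F hv (lie_negRootVector i (hf i)) 0 1
          rw [intVec_zero, add_zero, ← sub_eq_add_neg] at this
          exact this
  intro lam
  by_cases hbot : wt n B F V H lam d = ⊥
  · rw [hbot]; exact bot_le
  · obtain ⟨z, hz⟩ := weight_integral F hK hint hbot
    obtain ⟨N, hN⟩ := Int.eq_ofNat_of_zero_le
      (Finset.sum_nonneg fun j _ => sq_nonneg (z j) : 0 ≤ ∑ j, z j ^ 2)
    exact key N z lam hz hN

lemma fullWeight_injective (d : Fin (n + 1) → ℂ) :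
    Function.Injective fun lam : Module.Dual ℂ H => fullWeight lam d := by
  intro lam mu h
  ext x
  have := LinearMap.congr_fun h (x, 0, 0)
  simpa [fullWeight] using this

lemma finite_weights_component (hK : ∀ (i : Fin (n + 1)) (v : V),
      ⁅Tau.ofZB F (centralK n (Pi.single i 1) ⊗ₜ[ℂ] (1 : B)), v⁆ = 0)
    (hint : IsIntegrable n B F H V)
    (hfin : ∀ lam : Module.Dual ℂ (FullCartan n H), FiniteDimensional ℂ (weightSpace n B F H V lam))
    (d : Fin (n + 1) → ℂ) : {lam | wt n B F V H lam d ≠ ⊥}.Finite := by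
  classical
  obtain ⟨E, hE, hle⟩ := exists_finiteDimensional_component F hK hint hfin d
  have hind : iSupIndep fun lam => wt n B F V H lam d := by
    have h1 := hint.weight.submodule_iSupIndep.comp (fullWeight_injective (H := H) d)
    exact h1.mono fun lam => wt_le_weightSpace F hK lam d
  choose v hv hv0 using fun lam : {lam | wt n B F V H lam d ≠ ⊥} =>
    Submodule.exists_mem_ne_zero_of_ne_bot lam.2
  have hlin : LinearIndependent ℂ v :=
    (hind.comp Subtype.val_injective).linearIndependent _ hv hv0
  have hlin' : LinearIndependent ℂ fun lam => (⟨v lam, hle _ (hv lam)⟩ : E) :=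
    LinearIndependent.of_comp E.subtype hlin
  exact Set.finite_coe_iff.mp hlin'.finite

/-- Integrable modules of level zero have finitely many `H`-weights: a weight vector of large
weight is moved into a fixed `D`-component by some `X_{-α} ⊗ t^m`. -/
lemma finite_weights (hK : ∀ (i : Fin (n + 1)) (v : V),
      ⁅Tau.ofZB F (centralK n (Pi.single i 1) ⊗ₜ[ℂ] (1 : B)), v⁆ = 0)
    (hint : IsIntegrable n B F H V)
    (hfin : ∀ lam : Module.Dual ℂ (FullCartan n H), FiniteDimensional ℂ (weightSpace n B F H V lam))
    (d : Fin (n + 1) → ℂ) :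
    {lam | ∃ m : Fin (n + 1) → ℤ, wt n B F V H lam (d + intVec m) ≠ ⊥}.Finite := by
  have h0 := finite_weights_component F hK hint hfin d
  refine ((finite_isSmall (H := H)).union (Set.finite_iUnion fun i : H.root =>
    h0.image fun mu => mu + Weight.toLinear ℂ H g i)).subset ?_
  rintro lam ⟨m, hm⟩
  by_cases hsm : IsSmall lam
  · exact Or.inl hsm
  · right
    obtain ⟨z, hz⟩ := weight_integral F hK hint hm
    obtain ⟨i, hi⟩ := exists_two_le_of_not_isSmall hz hsm
    refine Set.mem_iUnion.mpr ⟨i, lam - Weight.toLinear ℂ H g i, fun hbot => hm ?_, by simp⟩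
    rw [eq_bot_iff]
    refine mem_of_lower_mem F hK hint i (hz i) hi m ⊥ (fun x k v hv => ?_) ?_
    · rw [(Submodule.mem_bot ℂ).mp hv, map_zero]; exact zero_mem _
    · rw [add_sub_cancel_right, hbot]

variable (n B V) in
/-- The sum of the weight spaces of `H`-weight `lam` and `D`-weight in `d + ℤ^{n+1}`. -/
noncomputable def wtSum (H : LieSubalgebra ℂ g) (lam : Module.Dual ℂ H) (d : Fin (n + 1) → ℂ) :
    Submodule ℂ V :=
  ⨆ m : Fin (n + 1) → ℤ, wt n B F V H lam (d + intVec m)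

lemma aT_mem_wtSum {lam : Module.Dual ℂ H} {d : Fin (n + 1) → ℂ} {v : V}
    (hv : v ∈ wtSum n B F V H lam d) {α : Module.Dual ℂ H} {x : g}
    (hx : ∀ h : H, ⁅(h : g), x⁆ = α h • x) (c : Coeff n B) :
    aT n B F V (ct c x) v ∈ wtSum n B F V H (lam + α) d := by
  induction c using coeff_induction with
  | hm m b =>
    have : wtSum n B F V H lam d ≤ (wtSum n B F V H (lam + α) d).comap (aT n B F V (ct (mono m ⊗ₜ b) x)) := by
      refine iSup_le fun k w hw => ?_
      have h1 := aT_mem_wt F hw hx m b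
      rw [add_assoc, ← intVec_add] at h1
      exact (le_iSup (fun m : Fin (n + 1) → ℤ => wt n B F V H (lam + α) (d + intVec m)) (k + m)) h1
    exact this hv
  | ha c c' h1 h2 =>
    rw [map_add, LinearMap.add_apply, map_add, LinearMap.add_apply]
    exact add_mem h1 h2

/-- The Cartan subalgebra is orthogonal to the root vectors, here for a coroot and its `f`. -/
lemma form_cartan_root (i : H.root) {f : g}
    (hhf : ⁅(coroot (i : Weight ℂ H g) : g), f⁆ = -((2 : ℂ) • f)) :
    F.form (coroot (i : Weight ℂ H g) : g) f = 0 := by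
  have := F.invariant (coroot (i : Weight ℂ H g) : g) (coroot (i : Weight ℂ H g) : g) f
  rw [lie_self, map_zero, LinearMap.zero_apply, hhf, map_neg, map_smul, neg_neg, eq_comm,
    smul_eq_zero] at this
  exact this.resolve_left two_ne_zero

/-- An irreducible integrable module of level zero with finite-dimensional weight spaces has a
highest weight vector, and all of `Z ⊗ B` acts on it by zero. -/
theorem exists_highestWeightVector (Δ : (rootSystem H).Base)
    (hirr : LieModule.IsIrreducible ℂ (Tau n B F) V)
    (hK : ∀ (i : Fin (n + 1)) (v : V),
      ⁅Tau.ofZB F (centralK n (Pi.single i 1) ⊗ₜ[ℂ] (1 : B)), v⁆ = 0)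
    (hint : IsIntegrable n B F H V)
    (hfin : ∀ lam : Module.Dual ℂ (FullCartan n H),
      FiniteDimensional ℂ (weightSpace n B F H V lam)) :
    (∀ z, aZ n B F V z = 0) ∧ ∃ (lam : Module.Dual ℂ H) (d : Fin (n + 1) → ℂ) (v : V), v ≠ 0 ∧
      v ∈ wt n B F V H lam d ∧ ∀ i : H.root, Δ.IsPos i →
        ∀ x ∈ rootSpace H (i : Weight ℂ H g), ∀ c, aT n B F V (ct c x) v = 0 := by
  classical
  obtain ⟨lam1, d, h1⟩ : ∃ lam d, wt n B F V H lam d ≠ ⊥ := by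
    by_contra! hcon
    have h0 := iSup_wt_eq_top F hint
    simp only [hcon, iSup_bot] at h0
    have hbt : (⊥ : LieSubmodule ℂ (Tau n B F) V) = ⊤ := by
      rw [← LieSubmodule.toSubmodule_inj]; simpa using h0
    exact absurd hbt hirr.bot_ne_top
  have hΛ := finite_weights F hK hint hfin d
  set Λ := {lam | ∃ m : Fin (n + 1) → ℤ, wt n B F V H lam (d + intVec m) ≠ ⊥} with hΛdef
  have hbot : ∀ lam, lam ∉ Λ → wtSum n B F V H lam d = ⊥ := by
    intro lam hlam
    rw [hΛdef, Set.mem_ofPred_eq] at hlam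
    push Not at hlam
    exact iSup_eq_bot.mpr hlam
  obtain ⟨h0, hh0⟩ := exists_height_coweight Δ
  obtain ⟨lam, hlam, hmax⟩ := hΛ.exists_maximalFor (fun mu : Module.Dual ℂ H => (mu h0).re) _
    ⟨lam1, 0, by rwa [intVec_zero, add_zero]⟩
  have hpos : ∀ i : H.root, Δ.IsPos i → ∀ x ∈ rootSpace H (i : Weight ℂ H g), ∀ c,
      ∀ v ∈ wtSum n B F V H lam d, aT n B F V (ct c x) v = 0 := by
    intro i hi x hx c v hv
    have h2 := aT_mem_wtSum F hv (lie_rootVector i hx) c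
    rw [hbot, Submodule.mem_bot] at h2
    · exact h2
    · intro hmem
      have h3 : (lam h0).re ≤ ((lam + Weight.toLinear ℂ H g i) h0).re := by
        rw [LinearMap.add_apply, Complex.add_re, Weight.toLinear_apply, hh0 i, Complex.intCast_re]
        have : (0 : ℝ) < Δ.height i := by exact_mod_cast hi
        linarith
      have h4 := hmax hmem h3
      simp only [LinearMap.add_apply, Complex.add_re, Weight.toLinear_apply, hh0 i,
        Complex.intCast_re] at h4
      have : (0 : ℝ) < Δ.height i := by exact_mod_cast hi
      linarith
  obtain ⟨m0, hm0⟩ := hlam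
  obtain ⟨v, hv, hv0⟩ := Submodule.exists_mem_ne_zero_of_ne_bot hm0
  have hvT : v ∈ wtSum n B F V H lam d :=
    (le_iSup (fun m : Fin (n + 1) → ℤ => wt n B F V H lam (d + intVec m)) m0) hv
  refine ⟨fun z => ?_, lam, _, v, hv0, hv, fun i hi x hx c => hpos i hi x hx c v hvT⟩
  -- the operators `f ⊗ c` are nilpotent on the highest weight vectors, and so is the centre
  obtain ⟨i, hi⟩ : ∃ i : H.root, Δ.IsPos i := by
    obtain ⟨i, hi⟩ := Δ.support_nonempty
    exact ⟨i, RootPairing.Base.isPos_of_mem_support hi⟩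
  obtain ⟨e, f, he, hf, hef, hhe, hhf, -, hf0⟩ := exists_sl2 i
  set h : g := (coroot (i : Weight ℂ H g) : g) with hh
  induction z using ZB_induction with
  | ha x y hx hy => rw [map_add, hx, hy, add_zero]
  | hm k j b =>
    -- write `t^k K_j ⊗ b` as `(du) a` with `u = t_j ⊗ b`
    let u : Coeff n B := mono (Pi.single j 1) ⊗ₜ b
    let a : Coeff n B := mono (k - Pi.single j 1) ⊗ₜ 1
    have hua : kappa n B u a = tK k j ⊗ₜ b := by
      rw [kappa_tmul, dmul_single, mul_one]
    have hcart : ∀ c, ∀ w ∈ wtSum n B F V H lam d, aT n B F V (ct c h) w ∈ wtSum n B F V H lam d := by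
      intro c w hw
      have := aT_mem_wtSum F hw (α := 0) (x := h) (fun h' => ?_) c
      · rwa [add_zero] at this
      · have := LieModule.IsTrivial.trivial (L := H) (M := H) h' (coroot (i : Weight ℂ H g))
        rw [LinearMap.zero_apply, zero_smul]
        exact congrArg Subtype.val this
    obtain ⟨N, hN⟩ : ∃ N : ℕ, ∀ w ∈ wtSum n B F V H lam d, ((aT n B F V (ct a f)) ^ N) w = 0 := by
      have hpow : ∀ N : ℕ, ∀ w ∈ wtSum n B F V H lam d, ((aT n B F V (ct a f)) ^ N) w ∈
          wtSum n B F V H (lam + N • (-Weight.toLinear ℂ H g i)) d := by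
        intro N
        induction N with
        | zero => intro w hw; simpa using hw
        | succ N ih =>
          intro w hw
          rw [pow_succ', Module.End.mul_apply, succ_nsmul, ← add_assoc]
          exact aT_mem_wtSum F (ih w hw) (lie_negRootVector i hf) a
      have hinj : Function.Injective fun N : ℕ => lam + N • (-Weight.toLinear ℂ H g i) := by
        intro N M hNM
        have h5 := LinearMap.congr_fun hNM (coroot (i : Weight ℂ H g))
        simp only [LinearMap.add_apply, LinearMap.smul_apply, LinearMap.neg_apply,
          Weight.toLinear_apply, root_apply_coroot (H.isNonZero_coe_root i), nsmul_eq_mul] at h5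
        have h6 : (N : ℂ) = M := by linear_combination (-1 / 2 : ℂ) * h5
        exact_mod_cast h6
      obtain ⟨N, hN⟩ : ∃ N : ℕ, lam + N • (-Weight.toLinear ℂ H g i) ∉ Λ := by
        by_contra! hcon
        exact Set.infinite_range_of_injective hinj (hΛ.subset (Set.range_subset_iff.mpr hcon))
      refine ⟨N, fun w hw => ?_⟩
      have := hpow N w hw
      rwa [hbot _ hN, Submodule.mem_bot] at this
    have hnil := commutator_nilpotent (T := wtSum n B F V H lam d)
      (X := aT n B F V (ct 1 e)) (U := aT n B F V (ct u h))
      (Y := fun c : Coeff n B => aT n B F V (ct c f)) (η := fun c => aT n B F V (ct c h))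
      (z := fun c => F.form h h • aZ n B F V (kappa n B u c))
      (fun c => by
        rw [aT_comm_ct, kappa_one, map_zero, smul_zero, add_zero, one_mul, hef])
      (fun c c' => by
        rw [aT_comm_ct, form_cartan_root F i hhf, zero_smul, add_zero, hhf, map_neg, map_neg,
          map_smul, map_smul, neg_smul])
      (fun w hw => hpos i hi e he 1 w hw) (fun c => hcart c) (hcart u)
      (fun c => by
        rw [aT_comm_ct, lie_self, map_zero, map_zero, zero_add])
      (fun c => by
        rw [mul_smul_comm, smul_mul_assoc, aZ_comm_aT]) a N hN v hvT
    rw [hua] at hnil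
    set Zop := aZ n B F V (tK k j ⊗ₜ b) with hZop
    have hne : F.form h h ≠ 0 := form_coroot_ne_zero F i
    rw [smul_pow, LinearMap.smul_apply, smul_eq_zero] at hnil
    have hnil' := hnil.resolve_left (pow_ne_zero N hne)
    have hex : ∃ N, (Zop ^ N) v = 0 := ⟨N, hnil'⟩
    cases hfind : Nat.find hex with
    | zero =>
      have := Nat.find_spec hex
      rw [hfind] at this
      exact absurd (by simpa using this) hv0
    | succ M =>
      have h7 := Nat.find_spec hex
      rw [hfind, pow_succ', Module.End.mul_apply] at h7
      exact aZ_eq_zero_of_ker F hirr k j b (Nat.find_min hex (m := M) (by omega)) h7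

end Highest

/-! ### The triangular decomposition -/

section Triangular

open LieAlgebra LieAlgebra.IsKilling LieModule

variable {g : Type*} [LieRing g] [LieAlgebra ℂ g] [FiniteDimensional ℂ g]
  [LieAlgebra.IsSimple ℂ g] {H : LieSubalgebra ℂ g} [H.IsCartanSubalgebra]
  (Δ : (rootSystem H).Base)

/-- An element of the Cartan subalgebra on which each root takes its height as value. -/
noncomputable def heightCoweight : H := (exists_height_coweight Δ).choose

lemma root_heightCoweight (i : H.root) :
    (i : Weight ℂ H g) (heightCoweight Δ) = (Δ.height i : ℂ) :=
  (exists_height_coweight Δ).choose_spec i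

lemma mem_gPlus {i : H.root} (hi : Δ.IsPos i) {x : g}
    (hx : x ∈ rootSpace H (i : Weight ℂ H g)) : x ∈ gPlus Δ :=
  (le_iSup (fun α : {α // Δ.IsPos α} =>
    (rootSpace H ((rootSystem H).root α)).toSubmodule) ⟨i, hi⟩) hx

lemma mem_gMinus {i : H.root} (hi : Δ.IsPos i) {x : g}
    (hx : x ∈ rootSpace H (-(i : Weight ℂ H g))) : x ∈ gMinus Δ :=
  (le_iSup (fun α : {α // Δ.IsPos α} =>
    (rootSpace H (-((α : H.root) : Weight ℂ H g))).toSubmodule) ⟨i, hi⟩) hx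

lemma gPlus_induction {p : g → Prop} {x : g} (hx : x ∈ gPlus Δ)
    (hr : ∀ i : H.root, Δ.IsPos i → ∀ y ∈ rootSpace H (i : Weight ℂ H g), p y)
    (h0 : p 0) (ha : ∀ x y, p x → p y → p (x + y)) : p x :=
  Submodule.iSup_induction _ (motive := p) hx (fun i y hy => hr i.1 i.2 y hy) h0 ha

lemma gMinus_induction {p : g → Prop} {x : g} (hx : x ∈ gMinus Δ)
    (hr : ∀ i : H.root, Δ.IsPos i → ∀ y ∈ rootSpace H (-(i : Weight ℂ H g)), p y)
    (h0 : p 0) (ha : ∀ x y, p x → p y → p (x + y)) : p x :=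
  Submodule.iSup_induction _ (motive := p) hx (fun i y hy => hr i.1 i.2 y hy) h0 ha

lemma height_negRoot (i : H.root) : Δ.height (negRoot i) = -Δ.height i := by
  have h1 := root_heightCoweight Δ (negRoot i)
  rw [coe_negRoot, Weight.coe_neg, Pi.neg_apply, root_heightCoweight Δ i] at h1
  exact_mod_cast h1.symm

lemma isPos_or_negRoot (i : H.root) : Δ.IsPos i ∨ Δ.IsPos (negRoot i) := by
  rw [RootPairing.Base.isPos_iff, RootPairing.Base.isPos_iff, height_negRoot]
  have := Δ.height_ne_zero i
  omega

lemma mem_triangular (x : g) : x ∈ gMinus Δ ⊔ (H.toSubmodule ⊔ gPlus Δ) := by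
  refine rootVector_induction (H := H) (p := fun x => x ∈ gMinus Δ ⊔ (H.toSubmodule ⊔ gPlus Δ)) x
    (fun h => ?_) (fun i y hy => ?_) (fun x y => add_mem)
  · exact Submodule.mem_sup_right (Submodule.mem_sup_left h.2)
  · rcases isPos_or_negRoot Δ i with hi | hi
    · exact Submodule.mem_sup_right (Submodule.mem_sup_right (mem_gPlus Δ hi hy))
    · refine Submodule.mem_sup_left (mem_gMinus Δ hi ?_)
      rw [coe_negRoot, Weight.coe_neg, neg_neg]
      exact hy

lemma lie_mem_gMinus {x y : g} (hx : x ∈ gMinus Δ) (hy : y ∈ gMinus Δ) : ⁅x, y⁆ ∈ gMinus Δ := by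
  refine gMinus_induction Δ (p := fun x => ⁅x, y⁆ ∈ gMinus Δ) hx (fun i hi x hx => ?_) (by simp)
    (fun a b h1 h2 => by rw [add_lie]; exact add_mem h1 h2)
  refine gMinus_induction Δ (p := fun y => ⁅x, y⁆ ∈ gMinus Δ) hy (fun j hj y hy => ?_) (by simp)
    (fun a b h1 h2 => by rw [lie_add]; exact add_mem h1 h2)
  have hxy : ⁅x, y⁆ ∈ rootSpace H
      (-((i : Weight ℂ H g) : H → ℂ) + -((j : Weight ℂ H g) : H → ℂ)) :=
    LieAlgebra.lie_mem_genWeightSpace_of_mem_genWeightSpace hx hy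
  by_cases hbot : rootSpace H (-((i : Weight ℂ H g) : H → ℂ) + -((j : Weight ℂ H g) : H → ℂ)) = ⊥
  · rw [hbot] at hxy
    rw [(LieSubmodule.mem_bot _).mp hxy]
    exact zero_mem _
  · let k : Weight ℂ H g := ⟨_, hbot⟩
    have hval : k (heightCoweight Δ) = -((Δ.height i : ℂ) + Δ.height j) := by
      change -((i : Weight ℂ H g) (heightCoweight Δ)) + -((j : Weight ℂ H g) (heightCoweight Δ)) = _
      rw [root_heightCoweight, root_heightCoweight]
      ring
    have hi' : 0 < Δ.height i := hi
    have hj' : 0 < Δ.height j := hj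
    have hk : k.IsNonZero := by
      intro hz
      rw [Weight.IsZero] at hz
      rw [hz, Pi.zero_apply, eq_comm, neg_eq_zero] at hval
      have : Δ.height i + Δ.height j = 0 := by exact_mod_cast hval
      omega
    let r : H.root := ⟨k, by simpa using hk⟩
    have hr : Δ.IsPos (negRoot r) := by
      have h1 : (Δ.height r : ℂ) = -((Δ.height i : ℂ) + Δ.height j) := by
        rw [← hval, ← root_heightCoweight]
      have h2 : Δ.height r = -(Δ.height i + Δ.height j) := by exact_mod_cast h1
      rw [RootPairing.Base.isPos_iff, height_negRoot, h2]
      omega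
    refine mem_gMinus Δ hr ?_
    rw [coe_negRoot, Weight.coe_neg, neg_neg]
    exact hxy

variable {n : ℕ} {B : Type*} [CommRing B] [Algebra ℂ B] {V : Type*} [AddCommGroup V] [Module ℂ V]

/-- The operators by which `g⁻ ⊗ A ⊗ B` acts. -/
noncomputable def lowering (a : Tau1 n g B →ₗ[ℂ] Module.End ℂ V) :
    Submodule ℂ (Module.End ℂ V) :=
  Submodule.span ℂ {y | ∃ c, ∃ f ∈ gMinus Δ, y = a (ct c f)}

/-- The operators by which `(h ⊕ g⁺) ⊗ A ⊗ B` acts. -/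
noncomputable def nonneg (a : Tau1 n g B →ₗ[ℂ] Module.End ℂ V) :
    Submodule ℂ (Module.End ℂ V) :=
  Submodule.span ℂ {y | ∃ c, ∃ x ∈ H.toSubmodule ⊔ gPlus Δ, y = a (ct c x)}

variable {a : Tau1 n g B →ₗ[ℂ] Module.End ℂ V}

lemma mem_lowering (c : Coeff n B) {f : g} (hf : f ∈ gMinus Δ) : a (ct c f) ∈ lowering Δ a :=
  Submodule.subset_span ⟨c, f, hf, rfl⟩

lemma ct_mem_sup (c : Coeff n B) (x : g) : a (ct c x) ∈ lowering Δ a ⊔ nonneg Δ a := by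
  obtain ⟨y, hy, z, hz, rfl⟩ := Submodule.mem_sup.mp (mem_triangular Δ x)
  rw [map_add, map_add]
  exact add_mem (Submodule.mem_sup_left (mem_lowering Δ c hy))
    (Submodule.mem_sup_right (Submodule.subset_span ⟨c, z, hz, rfl⟩))

lemma span_commutator {N : Submodule ℂ (Module.End ℂ V)} {S T : Set (Module.End ℂ V)}
    (h : ∀ x ∈ S, ∀ y ∈ T, x * y - y * x ∈ N) {x y : Module.End ℂ V}
    (hx : x ∈ Submodule.span ℂ S) (hy : y ∈ Submodule.span ℂ T) : x * y - y * x ∈ N := by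
  induction hx using Submodule.span_induction with
  | mem x hx =>
    induction hy using Submodule.span_induction with
    | mem y hy => exact h x hx y hy
    | zero => simp
    | add y z _ _ h1 h2 =>
      have : x * (y + z) - (y + z) * x = (x * y - y * x) + (x * z - z * x) := by noncomm_ring
      rw [this]; exact add_mem h1 h2
    | smul r y _ h1 =>
      rw [mul_smul_comm, smul_mul_assoc, ← smul_sub]
      exact N.smul_mem r h1
  | zero => simp
  | add x z _ _ h1 h2 =>
    have : (x + z) * y - y * (x + z) = (x * y - y * x) + (z * y - y * z) := by noncomm_ring
    rw [this]; exact add_mem h1 h2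
  | smul r x _ h1 =>
    rw [mul_smul_comm, smul_mul_assoc, ← smul_sub]
    exact N.smul_mem r h1

/-- A subspace stable under `(h ⊕ g⁺) ⊗ A ⊗ B` and under a set `D` of operators normalizing
`g⁻ ⊗ A ⊗ B` generates a submodule under `g⁻ ⊗ A ⊗ B` alone. -/
lemma opClosure_lowering_stable (ha : ∀ x y, a x * a y - a y * a x = a ⁅x, y⁆)
    {D : Set (Module.End ℂ V)} {W : Submodule ℂ V}
    (hW : ∀ c, ∀ x ∈ H.toSubmodule ⊔ gPlus Δ, ∀ w ∈ W, a (ct c x) w ∈ W)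
    (hD : ∀ d ∈ D, ∀ w ∈ W, d w ∈ W)
    (hDc : ∀ d ∈ D, ∀ c, ∀ f ∈ gMinus Δ, d * a (ct c f) - a (ct c f) * d ∈ lowering Δ a) :
    (∀ u, ∀ s ∈ opClosure (lowering Δ a : Set _) W, a u s ∈ opClosure (lowering Δ a : Set _) W) ∧
      ∀ d ∈ D, ∀ s ∈ opClosure (lowering Δ a : Set _) W,
        d s ∈ opClosure (lowering Δ a : Set _) W := by
  have key : ∀ x ∈ nonneg Δ a ⊔ Submodule.span ℂ D, ∀ s ∈ opClosure (lowering Δ a : Set _) W,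
      x s ∈ opClosure (lowering Δ a : Set _) W := by
    intro x hx s hs
    rw [nonneg, ← Submodule.span_union] at hx
    refine opClosure_stable_of_commutator
      (b := Submodule.span ℂ ({y | ∃ c, ∃ x ∈ H.toSubmodule ⊔ gPlus Δ, y = a (ct c x)} ∪ D))
      ?_ ?_ hx hs
    · intro x hx w hw
      induction hx using Submodule.span_induction with
      | mem x hx =>
        rcases hx with ⟨c, y, hy, rfl⟩ | hx
        · exact hW c y hy w hw
        · exact hD x hx w hw
      | zero => simp
      | add x y _ _ h1 h2 => exact add_mem h1 h2
      | smul r x _ h1 => exact W.smul_mem r h1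
    · intro x hx y hy
      refine span_commutator ?_ hx hy
      rintro x (⟨c, y, hy, rfl⟩ | hx) _ ⟨c', f, hf, rfl⟩
      · rw [ha, ct_lie, Submodule.span_union, ← sup_assoc]
        exact Submodule.mem_sup_left (ct_mem_sup Δ _ _)
      · exact Submodule.mem_sup_left (hDc x hx c' f hf)
  refine ⟨fun u s hs => ?_, fun d hd s hs =>
    key d (Submodule.mem_sup_right (Submodule.subset_span hd)) s hs⟩
  induction u using ct_induction with
  | ht c x =>
    obtain ⟨y, hy, z, hz, hyz⟩ := Submodule.mem_sup.mp (ct_mem_sup (a := a) Δ c x)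
    rw [← hyz, LinearMap.add_apply]
    exact add_mem (opClosure_stable hy hs) (key z (Submodule.mem_sup_left hz) s hs)
  | ha u v h1 h2 => rw [map_add, LinearMap.add_apply]; exact add_mem h1 h2

/-- The operator of the height coweight, whose eigenvalues drop under `g⁻ ⊗ A ⊗ B`. -/
noncomputable def heightOp (a : Tau1 n g B →ₗ[ℂ] Module.End ℂ V) : Module.End ℂ V :=
  a (ct 1 (heightCoweight Δ : g))

/-- Below the highest weight space `W`, the operators of `g⁻ ⊗ A ⊗ B` produce only vectors of
smaller height. -/
lemma opClosure_lowering_le (ha : ∀ x y, a x * a y - a y * a x = a ⁅x, y⁆) {W : Submodule ℂ V}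
    {c : ℂ} (hW : ∀ w ∈ W, heightOp Δ a w = c • w) :
    opClosure (lowering Δ a : Set _) W ≤ W ⊔ lowPart (heightOp Δ a) c := by
  refine opClosure_le_sup_lowPart hW (Submodule.span_le.mpr ?_)
  rintro _ ⟨c', f, hf, rfl⟩
  refine gMinus_induction Δ (p := fun f => a (ct c' f) ∈ Submodule.span ℂ {y | ∃ k : ℕ, 0 < k ∧
    heightOp Δ a * y - y * heightOp Δ a = -((k : ℂ) • y)}) hf (fun i hi f hf => ?_) (by simp)
    (fun x y h1 h2 => by rw [map_add, map_add]; exact add_mem h1 h2)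
  have hi' : 0 < Δ.height i := hi
  obtain ⟨k, hk⟩ := Int.eq_ofNat_of_zero_le hi'.le
  refine Submodule.subset_span ⟨k, by omega, ?_⟩
  rw [heightOp, ha, ct_lie, one_mul, lie_of_mem_rootSpace hf, Pi.neg_apply,
    root_heightCoweight, hk, map_smul, map_smul]
  simp

end Triangular

/-! ### Induced modules -/

section Induced

attribute [local instance] LieRing.ofAssociativeRing

variable {L : Type*} [LieRing L] [LieAlgebra ℂ L]
  {P W : Type*} [AddCommGroup P] [Module ℂ P] [AddCommGroup W] [Module ℂ W]
  {j : P →ₗ[ℂ] L} {act : P →ₗ[ℂ] Module.End ℂ W}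

variable (j act) in
/-- The map `w ↦ 1 ⊗ w` into the induced module. -/
noncomputable def Induced.top : W →ₗ[ℂ] Induced L j act where
  toFun w := (inducedRel L j act).mkQ (1 ⊗ₜ w)
  map_add' w w' := by rw [TensorProduct.tmul_add, map_add]; rfl
  map_smul' r w := by
    rw [TensorProduct.tmul_smul]
    rfl

lemma Induced.lie_def (x : L) (m : Induced L j act) :
    ⁅x, m⁆ = UniversalEnvelopingAlgebra.ι ℂ x • m := rfl

lemma Induced.lie_top (p : P) (w : W) :
    ⁅j p, Induced.top j act w⁆ = Induced.top j act (act p w) := by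
  have h : ((1 * UniversalEnvelopingAlgebra.ι ℂ (j p)) ⊗ₜ[ℂ] w - 1 ⊗ₜ[ℂ] act p w :
      UniversalEnvelopingAlgebra ℂ L ⊗[ℂ] W) ∈ inducedRel L j act :=
    Submodule.subset_span ⟨1, p, w, rfl⟩
  have h2 := (Submodule.Quotient.eq _).mpr h
  refine Eq.trans ?_ h2
  rw [one_mul, Induced.lie_def]
  change UniversalEnvelopingAlgebra.ι ℂ (j p) • (inducedRel L j act).mkQ (1 ⊗ₜ w) = _
  rw [← map_smul, TensorProduct.smul_tmul', smul_eq_mul, mul_one]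
  rfl

/-- The induced module is generated by `1 ⊗ W`. -/
lemma Induced.eq_top_of_stable (S : Submodule ℂ (Induced L j act))
    (h1 : ∀ w, Induced.top j act w ∈ S) (hS : ∀ (x : L), ∀ m ∈ S, ⁅x, m⁆ ∈ S) : S = ⊤ := by
  let T : Subalgebra ℂ (UniversalEnvelopingAlgebra ℂ L) :=
    { carrier := {u | ∀ m ∈ S, u • m ∈ S}
      mul_mem' := fun {u v} hu hv m hm => by rw [mul_smul]; exact hu _ (hv m hm)
      add_mem' := fun {u v} hu hv m hm => by rw [add_smul]; exact add_mem (hu m hm) (hv m hm)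
      algebraMap_mem' := fun r m hm => by rw [algebraMap_smul]; exact S.smul_mem r hm }
  rw [eq_top_iff]
  rintro m -
  obtain ⟨t, rfl⟩ := Submodule.mkQ_surjective (inducedRel L j act) m
  induction t using TensorProduct.induction_on with
  | zero => rw [map_zero]; exact S.zero_mem
  | tmul u w =>
    have hu : ∀ m ∈ S, u • m ∈ S := GradedHom.uea_induction T (fun x m hm => hS x m hm) u
    have h2 := hu _ (h1 w)
    have h3 : u • Induced.top j act w = (inducedRel L j act).mkQ (u ⊗ₜ w) := by
      change u • (inducedRel L j act).mkQ (1 ⊗ₜ w) = _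
      rw [← map_smul, TensorProduct.smul_tmul', smul_eq_mul, mul_one]
    exact h3 ▸ h2
  | add x y hx hy => rw [map_add]; exact S.add_mem hx hy

variable {V : Type*} [AddCommGroup V] [Module ℂ V]

/-- The universal property of the induced module. -/
lemma Induced.exists_lift (ρ : L →ₗ[ℂ] Module.End ℂ V)
    (hρ : ∀ x y, ρ x * ρ y - ρ y * ρ x = ρ ⁅x, y⁆) (φ : W →ₗ[ℂ] V)
    (hφ : ∀ p w, ρ (j p) (φ w) = φ (act p w)) :
    ∃ Φ : Induced L j act →ₗ[ℂ] V, (∀ w, Φ (Induced.top j act w) = φ w) ∧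
      ∀ (x : L) m, Φ ⁅x, m⁆ = ρ x (Φ m) := by
  let R : L →ₗ⁅ℂ⁆ Module.End ℂ V := { ρ with map_lie' := fun {x y} => (hρ x y).symm }
  let σ := UniversalEnvelopingAlgebra.lift ℂ R
  have hσ : ∀ x, σ (UniversalEnvelopingAlgebra.ι ℂ x) = ρ x := fun x =>
    UniversalEnvelopingAlgebra.lift_ι_apply ℂ R x
  let Ψ : UniversalEnvelopingAlgebra ℂ L ⊗[ℂ] W →ₗ[ℂ] V :=
    TensorProduct.lift ((LinearMap.lcomp ℂ V φ) ∘ₗ σ.toLinearMap)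
  have hΨt : ∀ u w, Ψ (u ⊗ₜ w) = σ u (φ w) := fun u w => rfl
  have hΨ : ∀ u t, Ψ (u • t) = σ u (Ψ t) := by
    intro u t
    induction t using TensorProduct.induction_on with
    | zero => simp
    | tmul v w =>
      rw [TensorProduct.smul_tmul', hΨt, hΨt, smul_eq_mul, map_mul, Module.End.mul_apply]
    | add x y hx hy => rw [smul_add, map_add, map_add, map_add, hx, hy]
  have hker : (inducedRel L j act).restrictScalars ℂ ≤ LinearMap.ker Ψ := by
    intro t ht
    have ht' : t ∈ inducedRel L j act := ht
    rw [inducedRel] at ht'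
    clear ht
    induction ht' using Submodule.span_induction with
    | mem t ht =>
      obtain ⟨u, p, w, rfl⟩ := ht
      rw [LinearMap.mem_ker, map_sub, hΨt, hΨt, map_mul, hσ, Module.End.mul_apply, hφ, sub_self]
    | zero => exact zero_mem _
    | add x y hx hy h1 h2 => exact add_mem h1 h2
    | smul u x hx h =>
      rw [LinearMap.mem_ker, hΨ, LinearMap.mem_ker.mp h, map_zero]
  let Φ : Induced L j act →ₗ[ℂ] V :=
    ((inducedRel L j act).restrictScalars ℂ).liftQ Ψ hker ∘ₗ
      (Submodule.Quotient.restrictScalarsEquiv ℂ (inducedRel L j act)).symm.toLinearMap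
  have hΦ : ∀ t, Φ ((inducedRel L j act).mkQ t) = Ψ t := fun t => rfl
  refine ⟨Φ, fun w => ?_, fun x m => ?_⟩
  · refine (hΦ _).trans ?_
    rw [hΨt, map_one, Module.End.one_apply]
  · obtain ⟨t, rfl⟩ := Submodule.mkQ_surjective (inducedRel L j act) m
    let m : Induced L j act := (inducedRel L j act).mkQ t
    have h : ⁅x, m⁆ =
        (inducedRel L j act).mkQ (UniversalEnvelopingAlgebra.ι ℂ x • t) :=
      (map_smul (inducedRel L j act).mkQ _ t).symm
    refine (congrArg Φ h).trans ((hΦ _).trans ?_)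
    rw [hΨ, hσ]
    exact congrArg (ρ x) (hΦ t).symm

section Coprod

variable {P₁ P₂ : Type*} [AddCommGroup P₁] [Module ℂ P₁] [AddCommGroup P₂] [Module ℂ P₂]
  {j₁ : P₁ →ₗ[ℂ] L} {j₂ : P₂ →ₗ[ℂ] L} {act₁ : P₁ →ₗ[ℂ] Module.End ℂ W}
  {act₂ : P₂ →ₗ[ℂ] Module.End ℂ W}

lemma Induced.lie_top_left (p : P₁) (w : W) :
    ⁅j₁ p, Induced.top (j₁.coprod j₂) (act₁.coprod act₂) w⁆ =
      Induced.top (j₁.coprod j₂) (act₁.coprod act₂) (act₁ p w) := by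
  simpa using Induced.lie_top (j := j₁.coprod j₂) (act := act₁.coprod act₂) (p, 0) w

lemma Induced.lie_top_right (p : P₂) (w : W) :
    ⁅j₂ p, Induced.top (j₁.coprod j₂) (act₁.coprod act₂) w⁆ =
      Induced.top (j₁.coprod j₂) (act₁.coprod act₂) (act₂ p w) := by
  simpa using Induced.lie_top (j := j₁.coprod j₂) (act := act₁.coprod act₂) (0, p) w

lemma Induced.coprod_compat {ρ : L →ₗ[ℂ] Module.End ℂ V} {φ : W →ₗ[ℂ] V}
    (h₁ : ∀ p w, ρ (j₁ p) (φ w) = φ (act₁ p w)) (h₂ : ∀ p w, ρ (j₂ p) (φ w) = φ (act₂ p w))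
    (p : P₁ × P₂) (w : W) :
    ρ ((j₁.coprod j₂) p) (φ w) = φ ((act₁.coprod act₂) p w) := by
  rw [LinearMap.coprod_apply, LinearMap.coprod_apply, map_add, LinearMap.add_apply, h₁, h₂,
    LinearMap.add_apply, map_add]

end Coprod

end Induced

/-! ### Integrable highest weight modules of `g ⊗ A ⊗ B` are finite-dimensional -/

section FiniteDim

open LieAlgebra LieAlgebra.IsKilling LieModule

variable {n : ℕ} {g : Type*} [LieRing g] [LieAlgebra ℂ g] [FiniteDimensional ℂ g]
  [LieAlgebra.IsSimple ℂ g] {H : LieSubalgebra ℂ g} [H.IsCartanSubalgebra]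
  {Δ : (rootSystem H).Base} {B : Type*} [CommRing B] [Algebra ℂ B]
  {U : Type*} [AddCommGroup U] [Module ℂ U] {a : Tau1 n g B →ₗ[ℂ] Module.End ℂ U}

lemma coeff_finiteType [Algebra.FiniteType ℂ B] (n : ℕ) : Algebra.FiniteType ℂ (Coeff n B) :=
  Algebra.FiniteType.trans (S := Laurent n) inferInstance inferInstance

/-- If every element of a finitely generated algebra is algebraic modulo an ideal, then finitely
many members of any spanning family span the algebra modulo this ideal. -/
lemma exists_finset_span_mod {C : Type*} [CommRing C] [Algebra ℂ C] [Algebra.FiniteType ℂ C]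
    (I : Ideal C) (hI : ∀ c : C, ∃ p : Polynomial ℂ, p ≠ 0 ∧ Polynomial.aeval c p ∈ I)
    {ι : Type*} (e : ι → C) (he : Submodule.span ℂ (Set.range e) = ⊤) :
    ∃ s : Finset ι, ∀ c, ∃ y ∈ Submodule.span ℂ (Set.range fun q : s => e q), c - y ∈ I := by
  classical
  have aux : ∀ (Q : Type _) [CommRing Q] [Algebra ℂ Q] (π : C →ₐ[ℂ] Q),
      Function.Surjective π → (∀ c, π c = 0 ↔ c ∈ I) →
      ∃ s : Finset ι, ∀ c, ∃ y ∈ Submodule.span ℂ (Set.range fun q : s => e q), c - y ∈ I := by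
    intro Q _ _ π hπ hker
    have : Algebra.FiniteType ℂ Q := Algebra.FiniteType.of_surjective π hπ
    have : Algebra.IsIntegral ℂ Q := ⟨fun x => by
      obtain ⟨c, rfl⟩ := hπ x
      obtain ⟨p, hp, hpc⟩ := hI c
      refine isAlgebraic_iff_isIntegral.mp ⟨p, hp, ?_⟩
      rw [Polynomial.aeval_algHom_apply]
      exact (hker _).mpr hpc⟩
    have hfin : Module.Finite ℂ Q := Algebra.IsIntegral.finite
    have htop : Submodule.span ℂ (Set.range fun q => π (e q)) = ⊤ := by
      have h1 := Submodule.map_span π.toLinearMap (Set.range e)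
      rw [he, Submodule.map_top, LinearMap.range_eq_top.mpr hπ, ← Set.range_comp] at h1
      exact h1.symm
    obtain ⟨s', hs', hspan⟩ := (Submodule.fg_span_iff_fg_span_finset_subset _).mp
      (htop ▸ hfin.fg_top)
    choose q hq using fun x : s' => hs' x.2
    refine ⟨s'.attach.image q, fun c => ?_⟩
    have hc : π c ∈ Submodule.span ℂ (s' : Set Q) := by
      rw [← hspan, htop]; trivial
    have hle : Submodule.span ℂ (s' : Set Q) ≤ (Submodule.span ℂ (Set.range
        fun q : (s'.attach.image q) => e q)).map π.toLinearMap := by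
      refine Submodule.span_le.mpr fun x hx => ?_
      refine ⟨e (q ⟨x, hx⟩), Submodule.subset_span ⟨⟨q ⟨x, hx⟩, ?_⟩, rfl⟩, hq ⟨x, hx⟩⟩
      exact Finset.mem_image_of_mem _ (Finset.mem_attach _ _)
    obtain ⟨y, hy, hyc⟩ := hle hc
    refine ⟨y, hy, (hker _).mp ?_⟩
    rw [map_sub, sub_eq_zero]
    exact hyc.symm
  exact aux (C ⧸ I) (Ideal.Quotient.mkₐ ℂ I) (Ideal.Quotient.mkₐ_surjective ℂ I)
    fun c => Ideal.Quotient.eq_zero_iff_mem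

lemma span_mono_tmul : Submodule.span ℂ (Set.range fun q : (Fin (n + 1) → ℤ) × B =>
    (mono q.1 ⊗ₜ[ℂ] q.2 : Coeff n B)) = ⊤ := by
  rw [eq_top_iff]
  rintro c -
  induction c using coeff_induction with
  | hm m b => exact Submodule.subset_span ⟨(m, b), rfl⟩
  | ha x y h1 h2 => exact add_mem h1 h2

/-- The coefficients `c` with `(f ⊗ c) v = 0` form an ideal. -/
lemma lowering_smul_eq_zero (ha : ∀ x y, a x * a y - a y * a x = a ⁅x, y⁆) {v : U}
    (hcart : ∀ c (h : H), ∃ r : ℂ, a (ct c (h : g)) v = r • v) (i : H.root) {f : g}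
    (hf : f ∈ rootSpace H (-(i : Weight ℂ H g))) {c : Coeff n B} (hc : a (ct c f) v = 0)
    (c' : Coeff n B) : a (ct (c' * c) f) v = 0 := by
  have h1 := LinearMap.congr_fun (ha (ct c' (coroot (i : Weight ℂ H g) : g)) (ct c f)) v
  obtain ⟨r, hr⟩ := hcart c' (coroot (i : Weight ℂ H g))
  rw [LinearMap.sub_apply, Module.End.mul_apply, Module.End.mul_apply, hc, hr, map_zero, map_smul,
    hc, smul_zero, sub_zero, ct_lie, lie_of_mem_rootSpace hf, map_smul, map_smul,
    LinearMap.smul_apply, eq_comm, smul_eq_zero] at h1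
  refine h1.resolve_left ?_
  rw [Pi.neg_apply, root_apply_coroot (H.isNonZero_coe_root i)]
  norm_num

variable (Δ) in
/-- The ideal of those `c` with `(g⁻ ⊗ c) v = 0`, for a highest weight vector `v`. -/
noncomputable def annIdeal (ha : ∀ x y, a x * a y - a y * a x = a ⁅x, y⁆) {v : U}
    (hcart : ∀ c (h : H), ∃ r : ℂ, a (ct c (h : g)) v = r • v) : Ideal (Coeff n B) where
  carrier := {c | ∀ f ∈ gMinus Δ, a (ct c f) v = 0}
  add_mem' := fun {c c'} h h' f hf => by
    rw [map_add, LinearMap.add_apply, map_add, LinearMap.add_apply, h f hf, h' f hf, add_zero]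
  zero_mem' := fun f _ => by simp
  smul_mem' := fun c' c h f hf => by
    refine gMinus_induction Δ (p := fun f => a (ct (c' * c) f) v = 0) hf (fun i hi f hf => ?_)
      (by simp) (fun x y h1 h2 => by rw [map_add, map_add, LinearMap.add_apply, h1, h2, add_zero])
    exact lowering_smul_eq_zero ha hcart i hf (h f (mem_gMinus Δ hi hf)) c'

/-- Local nilpotency of `g⁻` makes each coefficient algebraic modulo the annihilator of a highest
weight vector. -/
lemma exists_aeval_mem_annIdeal (ha : ∀ x y, a x * a y - a y * a x = a ⁅x, y⁆) {v : U}
    (hplus : ∀ c, ∀ x ∈ gPlus Δ, a (ct c x) v = 0)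
    (hcart : ∀ c (h : H), ∃ r : ℂ, a (ct c (h : g)) v = r • v)
    (hnil : ∀ i : H.root, ∀ x ∈ rootSpace H (i : Weight ℂ H g), ∀ (m : Fin (n + 1) → ℤ) (b : B) w,
      ∃ k : ℕ, ((a (ct (mono m ⊗ₜ b) x)) ^ k) w = 0) (c : Coeff n B) :
    ∃ p : Polynomial ℂ, p ≠ 0 ∧ Polynomial.aeval c p ∈ annIdeal Δ ha hcart := by
  classical
  choose e f he hf hef hhe hhf he0 hf0 using fun i : H.root => exists_sl2 i
  have hrel : ∀ i : H.root, ∃ p : Polynomial ℂ, p ≠ 0 ∧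
      (Δ.IsPos i → a (ct (Polynomial.aeval c p) (f i)) v = 0) := by
    intro i
    by_cases hi : Δ.IsPos i
    · choose r hr using id hcart
      obtain ⟨p, hp, hpv⟩ := exists_relation_of_nilpotent (v := v)
        (X := a (ct c (e i))) (Y := fun k => a (ct (c ^ k) (f i)))
        (H := fun k => a (ct (c ^ k) (coroot (i : Weight ℂ H g) : g)))
        (ψ := fun k => r (c ^ k) (coroot (i : Weight ℂ H g)))
        (fun k => by rw [ha, ct_lie, hef, ← pow_succ'])
        (fun j k => by
          rw [ha, ct_lie, hhf, ← pow_add, map_neg, map_smul, map_neg, map_smul, neg_smul,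
            add_comm j k])
        (fun j => hr _ _) (hplus _ _ (mem_gPlus Δ hi (he i)))
        (hnil (negRoot i) (f i) (hf i) 0 1 v)
      refine ⟨p, hp, fun _ => ?_⟩
      rw [Polynomial.aeval_eq_sum_range, ← hpv, Polynomial.sum_over_range _ (by simp)]
      simp [LinearMap.sum_apply]
    · exact ⟨1, one_ne_zero, fun h => absurd h hi⟩
  choose p hp hpv using hrel
  refine ⟨∏ i, p i, Finset.prod_ne_zero_iff.mpr fun i _ => hp i, fun y hy => ?_⟩
  refine gMinus_induction Δ (p := fun y => a (ct (Polynomial.aeval c (∏ i, p i)) y) v = 0) hy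
    (fun i hi y hy => ?_) (by simp)
    (fun x y h1 h2 => by rw [map_add, map_add, LinearMap.add_apply, h1, h2, add_zero])
  obtain ⟨r, rfl⟩ := rootSpace_eq_span (H.isNonZero_coe_root (negRoot i)) (hf i) (hf0 i) hy
  obtain ⟨q, hq⟩ := Finset.dvd_prod_of_mem p (Finset.mem_univ i)
  rw [hq, mul_comm, map_mul, map_smul, map_smul, LinearMap.smul_apply,
    lowering_smul_eq_zero ha hcart i (hf i) (hpv i hi), smul_zero]

/-- The coefficients killing a cyclic highest weight vector act by zero. -/
lemma eq_zero_of_mem_annIdeal (ha : ∀ x y, a x * a y - a y * a x = a ⁅x, y⁆) {v : U}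
    (hgen : ∀ S : Submodule ℂ U, v ∈ S → (∀ u, ∀ s ∈ S, a u s ∈ S) → S = ⊤)
    (hplus : ∀ c, ∀ x ∈ gPlus Δ, a (ct c x) v = 0)
    (hcart : ∀ c (h : H), ∃ r : ℂ, a (ct c (h : g)) v = r • v) {c : Coeff n B}
    (hc : c ∈ annIdeal Δ ha hcart) (x : g) : a (ct c x) = 0 := by
  choose e f he hf hef hhe hhf he0 hf0 using fun i : H.root => exists_sl2 i
  let I := annIdeal Δ ha hcart
  -- the vectors killed by `g ⊗ I` form a submodule, and `v` is one of them
  let K : Submodule ℂ U :=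
    { carrier := {w | ∀ c ∈ I, ∀ x : g, a (ct c x) w = 0}
      add_mem' := fun {w w'} h h' c hc x => by rw [map_add, h c hc, h' c hc, add_zero]
      zero_mem' := fun c _ x => map_zero _
      smul_mem' := fun r w h c hc x => by rw [map_smul, h c hc, smul_zero] }
  have hK : K = ⊤ := by
    refine hgen K (fun c hc x => ?_) (fun u w hw => ?_)
    · have hcor : ∀ i : H.root, Δ.IsPos i →
          a (ct c (coroot (i : Weight ℂ H g) : g)) v = 0 := by
        intro i hi
        have h1 := LinearMap.congr_fun (ha (ct 1 (e i)) (ct c (f i))) v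
        rw [LinearMap.sub_apply, Module.End.mul_apply, Module.End.mul_apply,
          hc _ (mem_gMinus Δ hi (hf i)), hplus _ _ (mem_gPlus Δ hi (he i)), map_zero, map_zero,
          sub_zero, ct_lie, one_mul, hef] at h1
        exact h1.symm
      have hcart0 : ∀ h : H, a (ct c (h : g)) v = 0 := by
        intro h
        have hh : h ∈ Submodule.span ℂ (Set.range fun i : H.root =>
            coroot (i : Weight ℂ H g)) := by
          have : Submodule.span ℂ (Set.range fun i : H.root =>
            coroot (i : Weight ℂ H g)) = ⊤ :=
            RootPairing.IsRootSystem.span_coroot_eq_top (P := rootSystem H)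
          rw [this]; trivial
        induction hh using Submodule.span_induction with
        | mem h hh =>
          obtain ⟨i, rfl⟩ := hh
          rcases isPos_or_negRoot Δ i with hi | hi
          · exact hcor i hi
          · have := hcor _ hi
            simpa [coroot_neg] using this
        | zero => simp
        | add x y _ _ h1 h2 =>
          rw [AddMemClass.coe_add, map_add, map_add, LinearMap.add_apply, h1, h2, add_zero]
        | smul r x _ h1 =>
          rw [SetLike.val_smul, map_smul, map_smul, LinearMap.smul_apply, h1, smul_zero]
      obtain ⟨y, hy, z, hz, rfl⟩ := Submodule.mem_sup.mp (mem_triangular Δ x)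
      obtain ⟨h, hh, z, hz', rfl⟩ := Submodule.mem_sup.mp hz
      simp only [map_add, LinearMap.add_apply]
      rw [hc y hy, hcart0 ⟨h, hh⟩, hplus c z hz', add_zero, add_zero]
    · induction u using ct_induction with
      | ht c' y =>
        intro c hc x
        have h1 := LinearMap.congr_fun (ha (ct c x) (ct c' y)) w
        rw [LinearMap.sub_apply, Module.End.mul_apply, Module.End.mul_apply, hw c hc, map_zero,
          sub_zero, ct_lie, hw _ (I.mul_mem_right c' hc)] at h1
        exact h1
      | ha u u' h1 h2 => rw [map_add, LinearMap.add_apply]; exact add_mem h1 h2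
  ext w
  have : w ∈ K := by rw [hK]; trivial
  exact this c hc x

lemma exists_finset_span_mod_annIdeal [Algebra.FiniteType ℂ B]
    (ha : ∀ x y, a x * a y - a y * a x = a ⁅x, y⁆) {v : U}
    (hplus : ∀ c, ∀ x ∈ gPlus Δ, a (ct c x) v = 0)
    (hcart : ∀ c (h : H), ∃ r : ℂ, a (ct c (h : g)) v = r • v)
    (hnil : ∀ i : H.root, ∀ x ∈ rootSpace H (i : Weight ℂ H g), ∀ (m : Fin (n + 1) → ℤ) (b : B) w,
      ∃ k : ℕ, ((a (ct (mono m ⊗ₜ b) x)) ^ k) w = 0) :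
    ∃ s : Finset ((Fin (n + 1) → ℤ) × B), ∀ c, ∃ y ∈ Submodule.span ℂ
      (Set.range fun q : s => (mono q.1.1 ⊗ₜ[ℂ] q.1.2 : Coeff n B)),
      c - y ∈ annIdeal Δ ha hcart := by
  have hf := coeff_finiteType (B := B) n
  have h1 := exists_finset_span_mod (C := Coeff n B) (annIdeal Δ ha hcart)
    (exists_aeval_mem_annIdeal ha hplus hcart hnil) (ι := (Fin (n + 1) → ℤ) × B)
    (fun q => mono q.1 ⊗ₜ[ℂ] q.2)
  have h2 := h1 ?_
  · refine h2.imp fun s hs c => ?_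
    obtain ⟨y, hy, hyc⟩ := hs c
    exact ⟨y, hy, hyc⟩
  · exact span_mono_tmul

/-- The line of a highest weight vector is stable under `(h ⊕ g⁺) ⊗ A ⊗ B`. -/
lemma span_singleton_stable {v : U} (hplus : ∀ c, ∀ x ∈ gPlus Δ, a (ct c x) v = 0)
    (hcart : ∀ c (h : H), ∃ r : ℂ, a (ct c (h : g)) v = r • v) (c : Coeff n B) (y : g)
    (hy : y ∈ H.toSubmodule ⊔ gPlus Δ) (w : U) (hw : w ∈ Submodule.span ℂ {v}) :
    a (ct c y) w ∈ Submodule.span ℂ {v} := by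
  obtain ⟨r, rfl⟩ := Submodule.mem_span_singleton.mp hw
  obtain ⟨h, hh, z, hz, rfl⟩ := Submodule.mem_sup.mp hy
  obtain ⟨t, ht⟩ := hcart c ⟨h, hh⟩
  rw [map_smul]
  refine Submodule.smul_mem _ _ ?_
  rw [map_add, map_add, LinearMap.add_apply, hplus c z hz, add_zero]
  change a (ct c h) v = _ at ht
  rw [ht]
  exact Submodule.smul_mem _ _ (Submodule.mem_span_singleton_self v)

/-- A `g ⊗ A ⊗ B`-module generated by a highest weight vector, on which root vectors act locally
nilpotently, is finite-dimensional. -/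
theorem finiteDimensional_of_highestWeight [Algebra.FiniteType ℂ B]
    (ha : ∀ x y, a x * a y - a y * a x = a ⁅x, y⁆) {v : U}
    (hgen : ∀ S : Submodule ℂ U, v ∈ S → (∀ u, ∀ s ∈ S, a u s ∈ S) → S = ⊤)
    (hplus : ∀ c, ∀ x ∈ gPlus Δ, a (ct c x) v = 0)
    (hcart : ∀ c (h : H), ∃ r : ℂ, a (ct c (h : g)) v = r • v)
    (hnil : ∀ i : H.root, ∀ x ∈ rootSpace H (i : Weight ℂ H g), ∀ (m : Fin (n + 1) → ℤ) (b : B) w,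
      ∃ k : ℕ, ((a (ct (mono m ⊗ₜ b) x)) ^ k) w = 0) : FiniteDimensional ℂ U := by
  classical
  choose e f he hf hef hhe hhf he0 hf0 using fun i : H.root => exists_sl2 i
  obtain ⟨s, hs⟩ := exists_finset_span_mod_annIdeal ha hplus hcart hnil
  let x : s × {i : H.root // Δ.IsPos i} → Module.End ℂ U := fun q =>
    a (ct (mono q.1.1.1 ⊗ₜ q.1.1.2) (f q.2))
  have hx : ∀ c, ∀ y ∈ gMinus Δ, a (ct c y) ∈ Submodule.span ℂ (Set.range x) := by
    intro c y hy
    refine gMinus_induction Δ (p := fun y => a (ct c y) ∈ Submodule.span ℂ (Set.range x)) hy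
      (fun i hi y hy => ?_) (by simp)
      (fun x y h1 h2 => by rw [map_add, map_add]; exact add_mem h1 h2)
    obtain ⟨r, rfl⟩ := rootSpace_eq_span (H.isNonZero_coe_root (negRoot i)) (hf i) (hf0 i) hy
    rw [map_smul, map_smul]
    refine Submodule.smul_mem _ _ ?_
    obtain ⟨y, hy, hyc⟩ := hs c
    have h1 : a (ct c (f i)) = a (ct y (f i)) := by
      have := eq_zero_of_mem_annIdeal ha hgen hplus hcart hyc (f i)
      rwa [map_sub, LinearMap.sub_apply, map_sub, sub_eq_zero] at this
    rw [h1]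
    have h2 := Submodule.mem_map_of_mem (f := a ∘ₗ ct.flip (f i)) hy
    rw [Submodule.map_span] at h2
    refine Submodule.span_mono ?_ h2
    rintro _ ⟨_, ⟨q, rfl⟩, rfl⟩
    exact ⟨(q, ⟨i, hi⟩), rfl⟩
  obtain ⟨E, hE, hvE, hEx⟩ := exists_finiteDimensional_stable x
    (fun q q' => by
      rw [ha, ct_lie]
      exact hx _ _ (lie_mem_gMinus Δ (mem_gMinus Δ q.2.2 (hf _)) (mem_gMinus Δ q'.2.2 (hf _))))
    (fun q w => locallyFinite_of_nilpotent (hnil (negRoot q.2.1) (f q.2) (hf _) _ _ w))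
    (Submodule.span ℂ {v})
  have hEx' : ∀ T ∈ Submodule.span ℂ (Set.range x), ∀ w ∈ E, T w ∈ E := by
    intro T hT w hw
    induction hT using Submodule.span_induction with
    | mem T hT => obtain ⟨q, rfl⟩ := hT; exact hEx q w hw
    | zero => simp
    | add u v _ _ h1 h2 => exact add_mem h1 h2
    | smul r u _ h => exact Submodule.smul_mem _ _ h
  have hle : opClosure (lowering Δ a : Set _) (Submodule.span ℂ {v}) ≤ E := by
    refine opClosure_le hvE fun y hy w hw => hEx' y ?_ w hw
    refine (Submodule.span_le.mpr ?_ : lowering Δ a ≤ _) hy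
    rintro _ ⟨c, y, hy, rfl⟩
    exact hx c y hy
  have htop := hgen _ (le_opClosure (lowering Δ a : Set _) (Submodule.span ℂ {v})
      (Submodule.mem_span_singleton_self v))
    (opClosure_lowering_stable Δ ha (D := ∅) (span_singleton_stable hplus hcart) (by simp) (by simp)).1
  have hET : E = ⊤ := top_le_iff.mp (htop ▸ hle)
  rw [hET] at hE
  exact Module.Finite.equiv (Submodule.topEquiv)

end FiniteDim

/-! ### The modules `V(ψ)` -/

section IrredQuotient

variable {L : Type*} [LieRing L] [LieAlgebra ℂ L] {M : Type*} [AddCommGroup M] [Module ℂ M]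
  [LieRingModule L M] [LieModule ℂ L M]

/-- If the proper submodules do not add up to `M`, their sum is the largest proper submodule and
the quotient is irreducible. -/
lemma irreducible_irredQuotient (h : sSup {N : LieSubmodule ℂ L M | N ≠ ⊤} ≠ ⊤) :
    LieModule.IsIrreducible ℂ L (IrredQuotient L M) := by
  set S := sSup {N : LieSubmodule ℂ L M | N ≠ ⊤} with hS
  have : Nontrivial (M ⧸ S) := by
    refine Submodule.Quotient.nontrivial_iff.mpr fun h' => h ?_
    rw [← LieSubmodule.toSubmodule_inj, h']; rfl
  refine LieModule.IsIrreducible.mk fun N hN => ?_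
  have h1 : N.comap (LieSubmodule.Quotient.mk' S) = ⊤ := by
    by_contra hne
    have hle : N.comap (LieSubmodule.Quotient.mk' S) ≤ S := le_sSup hne
    refine hN ((LieSubmodule.eq_bot_iff _).mpr fun x hx => ?_)
    obtain ⟨m, rfl⟩ := LieSubmodule.Quotient.surjective_mk' S x
    exact LieSubmodule.Quotient.mk_eq_zero'.mpr (hle hx)
  rw [eq_top_iff]
  rintro x -
  obtain ⟨m, rfl⟩ := LieSubmodule.Quotient.surjective_mk' S x
  have : m ∈ N.comap (LieSubmodule.Quotient.mk' S) := by rw [h1]; trivial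
  exact this

end IrredQuotient

section Nongraded

open LieAlgebra LieAlgebra.IsKilling LieModule

variable {n : ℕ} {g : Type*} [LieRing g] [LieAlgebra ℂ g] [FiniteDimensional ℂ g]
  [LieAlgebra.IsSimple ℂ g] {H : LieSubalgebra ℂ g} [H.IsCartanSubalgebra]
  (Δ : (rootSystem H).Base) {B : Type*} [CommRing B] [Algebra ℂ B]

lemma inclCartan_ct (c : Coeff n B) (h : H) :
    inclCartan (ct c h : Cartan1 n H B) = (ct c (h : g) : Tau1 n g B) := rfl

lemma ct_lie_plus {M : Type*} [AddCommGroup M] [Module ℂ M]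
    {a : Tau1 n g B →ₗ[ℂ] Module.End ℂ M} {v : M}
    (h : ∀ c, ∀ x ∈ gPlus Δ, a (ct c x) v = 0) (y : Coeff n B ⊗[ℂ] gPlus Δ) :
    a (inclPlus Δ y) v = 0 := by
  induction y using TensorProduct.induction_on with
  | zero => simp
  | tmul c x => exact h c x x.2
  | add y z h1 h2 => rw [map_add, map_add, LinearMap.add_apply, h1, h2, add_zero]

/-- The canonical generator of `M(ψ)`. -/
noncomputable def hwVec (ψ : Module.Dual ℂ (Cartan1 n H B)) : MNongraded Δ ψ :=
  Induced.top _ _ (1 : ℂ)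

lemma plus_lie_hwVec (ψ : Module.Dual ℂ (Cartan1 n H B)) (y : Coeff n B ⊗[ℂ] gPlus Δ) :
    ⁅inclPlus Δ y, hwVec Δ ψ⁆ = 0 := by
  have h1 := Induced.lie_top_left (P₁ := Coeff n B ⊗[ℂ] gPlus Δ) (j₁ := inclPlus Δ) (j₂ := inclCartan)
    (act₁ := (0 : Coeff n B ⊗[ℂ] gPlus Δ →ₗ[ℂ] Module.End ℂ ℂ))
    (act₂ := ψ.smulRight (1 : Module.End ℂ ℂ)) y 1
  rw [LinearMap.zero_apply, LinearMap.zero_apply, map_zero] at h1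
  exact h1

lemma cartan_lie_hwVec (ψ : Module.Dual ℂ (Cartan1 n H B)) (x : Cartan1 n H B) :
    ⁅(inclCartan x : Tau1 n g B), hwVec Δ ψ⁆ = ψ x • hwVec Δ ψ := by
  have h1 := Induced.lie_top_right (P₁ := Coeff n B ⊗[ℂ] gPlus Δ) (j₁ := inclPlus Δ) (j₂ := inclCartan)
    (act₁ := (0 : Coeff n B ⊗[ℂ] gPlus Δ →ₗ[ℂ] Module.End ℂ ℂ))
    (act₂ := ψ.smulRight (1 : Module.End ℂ ℂ)) x 1
  rw [LinearMap.smulRight_apply, LinearMap.smul_apply, Module.End.one_apply, map_smul] at h1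
  exact h1

lemma mNongraded_eq_top {ψ : Module.Dual ℂ (Cartan1 n H B)} (S : Submodule ℂ (MNongraded Δ ψ))
    (h1 : hwVec Δ ψ ∈ S) (h2 : ∀ (u : Tau1 n g B), ∀ s ∈ S, ⁅u, s⁆ ∈ S) : S = ⊤ := by
  refine Induced.eq_top_of_stable S (fun w => ?_) h2
  have : w = w • (1 : ℂ) := by simp
  rw [this, map_smul]
  exact S.smul_mem _ h1

/-- The universal property of `M(ψ)`. -/
lemma mNongraded_lift (ψ : Module.Dual ℂ (Cartan1 n H B)) {U : Type*} [AddCommGroup U] [Module ℂ U]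
    {a : Tau1 n g B →ₗ[ℂ] Module.End ℂ U}
    (ha : ∀ x y, a x * a y - a y * a x = a ⁅x, y⁆) {v : U}
    (hplus : ∀ c, ∀ x ∈ gPlus Δ, a (ct c x) v = 0)
    (hcart : ∀ x : Cartan1 n H B, a (inclCartan x) v = ψ x • v) :
    ∃ Φ : MNongraded Δ ψ →ₗ[ℂ] U, Φ (hwVec Δ ψ) = v ∧ ∀ x m, Φ ⁅x, m⁆ = a x (Φ m) := by
  have h1 := Induced.coprod_compat (P₁ := Coeff n B ⊗[ℂ] gPlus Δ) (P₂ := Cartan1 n H B)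
      (j₁ := inclPlus Δ) (j₂ := inclCartan) (ρ := a)
      (φ := LinearMap.toSpanSingleton ℂ U v)
      (act₁ := (0 : Coeff n B ⊗[ℂ] gPlus Δ →ₗ[ℂ] Module.End ℂ ℂ))
      (act₂ := ψ.smulRight (1 : Module.End ℂ ℂ))
      (fun y w => by
        rw [LinearMap.toSpanSingleton_apply, map_smul, ct_lie_plus Δ hplus, LinearMap.zero_apply,
          LinearMap.zero_apply, map_zero, smul_zero])
      (fun x w => by
        rw [LinearMap.toSpanSingleton_apply, map_smul, hcart, LinearMap.smulRight_apply,
          LinearMap.smul_apply, Module.End.one_apply, map_smul, LinearMap.toSpanSingleton_apply,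
          smul_comm])
  have h2 := Induced.exists_lift (P := (Coeff n B ⊗[ℂ] gPlus Δ) × Cartan1 n H B)
    (j := (inclPlus Δ).coprod inclCartan)
    (act := (0 : Coeff n B ⊗[ℂ] gPlus Δ →ₗ[ℂ] Module.End ℂ ℂ).coprod
      (ψ.smulRight (1 : Module.End ℂ ℂ))) a ha (LinearMap.toSpanSingleton ℂ U v) h1
  obtain ⟨Φ, hΦ1, hΦ⟩ := h2
  refine ⟨Φ, (hΦ1 1).trans ?_, hΦ⟩
  rw [LinearMap.toSpanSingleton_apply, one_smul]

/-- If `ψ` is the highest weight of some integrable highest weight module, then `V(ψ)` is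
irreducible and finite-dimensional. -/
theorem irreducible_finiteDimensional_vNongraded [Algebra.FiniteType ℂ B]
    (ψ : Module.Dual ℂ (Cartan1 n H B)) {U : Type*} [AddCommGroup U] [Module ℂ U]
    {a : Tau1 n g B →ₗ[ℂ] Module.End ℂ U}
    (ha : ∀ x y, a x * a y - a y * a x = a ⁅x, y⁆) {v : U} (hv : v ≠ 0)
    (hgen : ∀ S : Submodule ℂ U, v ∈ S → (∀ u, ∀ s ∈ S, a u s ∈ S) → S = ⊤)
    (hplus : ∀ c, ∀ x ∈ gPlus Δ, a (ct c x) v = 0)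
    (hcart : ∀ x : Cartan1 n H B, a (inclCartan x) v = ψ x • v)
    (hnil : ∀ i : H.root, ∀ x ∈ rootSpace H (i : Weight ℂ H g), ∀ (m : Fin (n + 1) → ℤ) (b : B) w,
      ∃ k : ℕ, ((a (ct (mono m ⊗ₜ b) x)) ^ k) w = 0) :
    LieModule.IsIrreducible ℂ (Tau1 n g B) (VNongraded Δ ψ) ∧
      FiniteDimensional ℂ (VNongraded Δ ψ) := by
  let M := MNongraded (n := n) (B := B) Δ ψ
  let v₁ : M := hwVec Δ ψ
  let aM : Tau1 n g B →ₗ[ℂ] Module.End ℂ M := lieAct (Tau1 n g B) M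
  have haM : ∀ x y, aM x * aM y - aM y * aM x = aM ⁅x, y⁆ := lieAct_comm
  have hplusM : ∀ c, ∀ x ∈ gPlus Δ, aM (ct c x) v₁ = 0 := fun c x hx =>
    plus_lie_hwVec Δ ψ (c ⊗ₜ ⟨x, hx⟩)
  have hcartM : ∀ x : Cartan1 n H B, aM (inclCartan x) v₁ = ψ x • v₁ := cartan_lie_hwVec Δ ψ
  have hgenM : ∀ S : Submodule ℂ M, v₁ ∈ S → (∀ u, ∀ s ∈ S, aM u s ∈ S) → S = ⊤ :=
    mNongraded_eq_top Δ
  obtain ⟨Φ, hΦv, hΦ⟩ := mNongraded_lift Δ ψ ha hplus hcart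
  have hv₁ : v₁ ≠ 0 := fun h => hv (by rw [← hΦv, show hwVec Δ ψ = 0 from h, map_zero])
  let K : LieSubmodule ℂ (Tau1 n g B) M :=
    { LinearMap.ker Φ with
      lie_mem := fun {x m} hm => by
        change Φ ⁅x, m⁆ = 0
        rw [hΦ, show Φ m = 0 from hm, map_zero] }
  have hK : K ≠ ⊤ := by
    intro h
    have : v₁ ∈ K := by rw [h]; trivial
    exact hv (hΦv ▸ this)
  -- every proper submodule lies in the span of the lower weight spaces
  have hW : ∀ w ∈ Submodule.span ℂ {v₁}, heightOp Δ aM w = ψ (ct 1 (heightCoweight Δ)) • w := by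
    intro w hw
    obtain ⟨r, rfl⟩ := Submodule.mem_span_singleton.mp hw
    rw [map_smul, heightOp, ← inclCartan_ct, hcartM, smul_comm]
  have htop := hgenM _ (le_opClosure (lowering Δ aM : Set _) (Submodule.span ℂ {v₁})
      (Submodule.mem_span_singleton_self v₁))
    (opClosure_lowering_stable Δ haM (D := ∅) (span_singleton_stable hplusM
      fun c h => ⟨ψ (ct c h), hcartM (ct c h)⟩) (by simp) (by simp)).1
  have hlow : ∀ N : LieSubmodule ℂ (Tau1 n g B) M, N ≠ ⊤ →
      N.toSubmodule ≤ lowPart (heightOp Δ aM) (ψ (ct 1 (heightCoweight Δ))) := by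
    intro N hN m hm
    have hm' : m ∈ opClosure (lowering Δ aM : Set _) (Submodule.span ℂ {v₁}) := by
      rw [htop]; trivial
    obtain ⟨w, hw, l, hl, rfl⟩ := Submodule.mem_sup.mp (opClosure_lowering_le Δ haM hW hm')
    have hwN : w ∈ N.toSubmodule :=
      mem_of_add_lowPart_mem (fun x hx => N.lie_mem hx) (hW w hw) hl hm
    obtain ⟨r, rfl⟩ := Submodule.mem_span_singleton.mp hw
    by_cases hr : r = 0
    · rwa [hr, zero_smul, zero_add]
    · refine absurd ?_ hN
      rw [← LieSubmodule.toSubmodule_inj]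
      refine hgenM _ ?_ fun u s hs => N.lie_mem hs
      have := N.toSubmodule.smul_mem r⁻¹ hwN
      rwa [inv_smul_smul₀ hr] at this
  have hS : sSup {N : LieSubmodule ℂ (Tau1 n g B) M | N ≠ ⊤} ≠ ⊤ := by
    intro h
    have h1 : (sSup {N : LieSubmodule ℂ (Tau1 n g B) M | N ≠ ⊤}).toSubmodule ≤
        lowPart (heightOp Δ aM) (ψ (ct 1 (heightCoweight Δ))) := by
      rw [LieSubmodule.sSup_toSubmodule]
      refine sSup_le ?_
      rintro _ ⟨N, hN, rfl⟩
      exact hlow N hN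
    rw [h] at h1
    exact hv₁ (eq_zero_of_mem_lowPart (hW v₁ (Submodule.mem_span_singleton_self v₁))
      (h1 (Submodule.mem_top)))
  refine ⟨irreducible_irredQuotient hS, ?_⟩
  have hU : FiniteDimensional ℂ U := finiteDimensional_of_highestWeight ha hgen hplus
    (fun c h => ⟨ψ (ct c h), hcart (ct c h)⟩) hnil
  have hquot : FiniteDimensional ℂ (M ⧸ K.toSubmodule) :=
    Module.Finite.equiv (Φ.quotKerEquivRange).symm
  have hle : K.toSubmodule ≤ (sSup {N : LieSubmodule ℂ (Tau1 n g B) M | N ≠ ⊤}).toSubmodule :=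
    LieSubmodule.toSubmodule_le_toSubmodule _ _ |>.mpr (le_sSup hK)
  exact Module.Finite.of_surjective (Submodule.factor hle) (Submodule.factor_surjective hle)

end Nongraded

/-! ### Graded fields over `ℂ` embed in Laurent polynomials -/

section GradedField

variable {n : ℕ} {R : Type*} [CommRing R] [Algebra ℂ R]
  {𝒜 : (Fin (n + 1) → ℤ) → Submodule ℂ R}

/-- In a graded ring, a homogeneous unit has a homogeneous inverse. -/
lemma exists_homogeneous_inverse (h1 : (1 : R) ∈ 𝒜 0)
    (hmul : ∀ m k, ∀ x ∈ 𝒜 m, ∀ y ∈ 𝒜 k, x * y ∈ 𝒜 (m + k)) (hind : iSupIndep 𝒜)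
    (htop : ⨆ m, 𝒜 m = ⊤) {m : Fin (n + 1) → ℤ} {x y : R} (hx : x ∈ 𝒜 m) (hxy : x * y = 1) :
    y ∈ 𝒜 (-m) := by
  have hy : y ∈ 𝒜 (-m) ⊔ ⨆ j, ⨆ (_ : j ≠ -m), 𝒜 j := by
    have : (⊤ : Submodule ℂ R) ≤ 𝒜 (-m) ⊔ ⨆ j, ⨆ (_ : j ≠ -m), 𝒜 j := by
      rw [← htop]
      refine iSup_le fun j => ?_
      by_cases hj : j = -m
      · exact hj ▸ le_sup_left
      · exact le_trans (le_iSup₂ (f := fun j (_ : j ≠ -m) => 𝒜 j) j hj) le_sup_right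
    exact this trivial
  obtain ⟨y', hy', z, hz, rfl⟩ := Submodule.mem_sup.mp hy
  have hxz : x * z ∈ ⨆ j, ⨆ (_ : j ≠ 0), 𝒜 j := by
    have : (⨆ j, ⨆ (_ : j ≠ -m), 𝒜 j) ≤
        (⨆ j, ⨆ (_ : j ≠ 0), 𝒜 j).comap (LinearMap.mulLeft ℂ x) := by
      refine iSup₂_le fun j hj w hw => ?_
      exact (le_iSup₂ (f := fun j (_ : j ≠ 0) => 𝒜 j) (m + j)
        (fun h => hj (eq_neg_of_add_eq_zero_right h))) (hmul m j x hx w hw)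
    exact this hz
  have h0 : x * z ∈ 𝒜 0 := by
    have h2 : x * z = 1 - x * y' := by rw [← hxy]; ring
    have h3 := hmul m (-m) x hx y' hy'
    rw [add_neg_cancel] at h3
    rw [h2]
    exact sub_mem h1 h3
  have hxz0 : x * z = 0 := Submodule.disjoint_def.mp (hind 0) _ h0 hxz
  have hz0 : z = 0 := by
    have h4 : (y' + z) * (x * z) = z := by
      rw [← mul_assoc, mul_comm (y' + z) x, hxy, one_mul]
    rw [← h4, hxz0, mul_zero]
  rw [hz0, add_zero]
  exact hy'

/-- If the component of degree zero of a graded field over `ℂ` is finite-dimensional, then it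
consists of scalars. -/
lemma eq_smul_one_of_mem_zero [Nontrivial R] (h1 : (1 : R) ∈ 𝒜 0)
    (hmul : ∀ m k, ∀ x ∈ 𝒜 m, ∀ y ∈ 𝒜 k, x * y ∈ 𝒜 (m + k))
    (hunit : ∀ m, ∀ x ∈ 𝒜 m, x ≠ 0 → ∃ y, x * y = 1) (hfin : FiniteDimensional ℂ (𝒜 0))
    {x : R} (hx : x ∈ 𝒜 0) : ∃ r : ℂ, x = r • (1 : R) := by
  have hst : ∀ y ∈ 𝒜 0, LinearMap.mulLeft ℂ x y ∈ 𝒜 0 := by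
    intro y hy
    simpa using hmul 0 0 x hx y hy
  have : Nontrivial (𝒜 0) := ⟨⟨⟨1, h1⟩, 0, fun h => one_ne_zero (congrArg Subtype.val h)⟩⟩
  obtain ⟨μ, hμ⟩ := Module.End.exists_eigenvalue ((LinearMap.mulLeft ℂ x).restrict hst)
  obtain ⟨y, hy⟩ := hμ.exists_hasEigenvector
  have h2 : x * (y : R) = μ • (y : R) := congrArg Subtype.val hy.apply_eq_smul
  obtain ⟨z, hz⟩ := hunit 0 y y.2 fun h => hy.2 (Subtype.ext h)
  refine ⟨μ, ?_⟩
  rw [← hz, ← smul_mul_assoc, ← h2, mul_assoc, hz, mul_one]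

variable (𝒜) in
/-- The homogeneous units of a graded ring, together with their degrees. -/
def homogeneousUnits (h1 : (1 : R) ∈ 𝒜 0)
    (hmul : ∀ m k, ∀ x ∈ 𝒜 m, ∀ y ∈ 𝒜 k, x * y ∈ 𝒜 (m + k)) (hind : iSupIndep 𝒜)
    (htop : ⨆ m, 𝒜 m = ⊤) : Subgroup (Rˣ × Multiplicative (Fin (n + 1) → ℤ)) where
  carrier := {p | (p.1 : R) ∈ 𝒜 p.2.toAdd}
  mul_mem' := fun hp hq => hmul _ _ _ hp _ hq
  one_mem' := h1
  inv_mem' := fun {p} hp => exists_homogeneous_inverse h1 hmul hind htop hp p.1.mul_inv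

/-- A graded field over `ℂ` with finite-dimensional component of degree zero embeds, as a graded
algebra, in the algebra of Laurent polynomials: its degrees form a free abelian group, so
homogeneous units can be chosen multiplicatively. -/
theorem exists_graded_embedding [Nontrivial R] (h1 : (1 : R) ∈ 𝒜 0)
    (hmul : ∀ m k, ∀ x ∈ 𝒜 m, ∀ y ∈ 𝒜 k, x * y ∈ 𝒜 (m + k)) (hind : iSupIndep 𝒜)
    (htop : ⨆ m, 𝒜 m = ⊤) (hunit : ∀ m, ∀ x ∈ 𝒜 m, x ≠ 0 → ∃ y, x * y = 1)
    (hfin : FiniteDimensional ℂ (𝒜 0)) :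
    ∃ χ : R →ₐ[ℂ] Laurent n, Function.Injective χ ∧
      ∀ m, ∀ x ∈ 𝒜 m, χ x ∈ Submodule.span ℂ {mono m} := by
  classical
  let G := homogeneousUnits 𝒜 h1 hmul hind htop
  let f : Additive G →+ (Fin (n + 1) → ℤ) :=
    { toFun := fun p => p.toMul.1.2.toAdd
      map_zero' := rfl
      map_add' := fun p q => rfl }
  let N := LinearMap.range f.toIntLinearMap
  -- a subgroup of `ℤ^{n+1}` is free, so the degree map splits
  obtain ⟨s, hs⟩ := Module.projective_lifting_property f.toIntLinearMap.rangeRestrict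
    (LinearMap.id : N →ₗ[ℤ] N) (LinearMap.surjective_rangeRestrict _)
  let r : N → R := fun k => (((s k).toMul.1.1 : Rˣ) : R)
  have hdeg : ∀ k : N, (s k).toMul.1.2.toAdd = k := fun k =>
    congrArg Subtype.val (LinearMap.congr_fun hs k)
  have hr : ∀ k : N, r k ∈ 𝒜 k := fun k => by
    have h2 : r k ∈ 𝒜 ((s k).toMul.1.2.toAdd) := (s k).toMul.2
    rwa [hdeg] at h2
  have hradd : ∀ k l : N, r (k + l) = r k * r l := fun k l => by
    simp only [r, map_add]; rfl
  have hr0 : ∀ k, r k ≠ 0 := fun k => Units.ne_zero _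
  have hli : LinearIndependent ℂ r :=
    (hind.comp (Subtype.val_injective (p := fun x => x ∈ N))).linearIndependent _ hr hr0
  have hspan : ∀ m, ∀ x ∈ 𝒜 m, x ≠ 0 → ∃ hm : m ∈ N, ∃ c : ℂ, x = c • r ⟨m, hm⟩ := by
    intro m x hx hx0
    obtain ⟨y, hxy⟩ := hunit m x hx hx0
    let u : Rˣ := ⟨x, y, hxy, by rw [mul_comm, hxy]⟩
    have hm : m ∈ N := ⟨Additive.ofMul (⟨(u, Multiplicative.ofAdd m), hx⟩ : G), rfl⟩
    refine ⟨hm, ?_⟩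
    let k : N := ⟨m, hm⟩
    have h2 := hmul _ _ x hx _ (hr (-k))
    have h3 : m + ((-k : N) : Fin (n + 1) → ℤ) = 0 := by simp [k]
    rw [h3] at h2
    obtain ⟨c, hc⟩ := eq_smul_one_of_mem_zero h1 hmul hunit hfin h2
    refine ⟨c, ?_⟩
    have h4 : r (-k) * r k = 1 := by
      rw [← hradd, neg_add_cancel]
      simp only [r, map_zero]; rfl
    rw [show r ⟨m, hm⟩ = r k from rfl, ← one_mul (r k), ← smul_mul_assoc, ← hc, mul_assoc, h4,
      mul_one]
  let b : Module.Basis N ℂ R := Module.Basis.mk hli (by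
    rw [← htop]
    refine iSup_le fun m x hx => ?_
    by_cases hx0 : x = 0
    · rw [hx0]; exact zero_mem _
    · obtain ⟨hm, c, rfl⟩ := hspan m x hx hx0
      exact Submodule.smul_mem _ _ (Submodule.subset_span ⟨_, rfl⟩))
  have hb : ∀ k, b k = r k := fun k => Module.Basis.mk_apply _ _ k
  let χ₀ : R →ₗ[ℂ] Laurent n := b.constr ℂ fun k => mono (k : Fin (n + 1) → ℤ)
  have hχ₀ : ∀ k, χ₀ (r k) = mono (k : Fin (n + 1) → ℤ) := fun k => by
    rw [← hb]; exact b.constr_basis ℂ _ k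
  have hr00 : r 0 = 1 := by simp only [r, map_zero]; rfl
  have hχmul : ∀ x y, χ₀ (x * y) = χ₀ x * χ₀ y := by
    have h2 : (LinearMap.mul ℂ R).compr₂ χ₀ = (LinearMap.mul ℂ (Laurent n)).compl₁₂ χ₀ χ₀ := by
      refine b.ext fun k => b.ext fun l => ?_
      simp only [LinearMap.compr₂_apply, LinearMap.compl₁₂_apply, LinearMap.mul_apply', hb]
      rw [← hradd, hχ₀, hχ₀, hχ₀, mono_mul_mono]
      rfl
    exact fun x y => LinearMap.congr_fun (LinearMap.congr_fun h2 x) y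
  let χ : R →ₐ[ℂ] Laurent n := AlgHom.ofLinearMap χ₀ (by rw [← hr00, hχ₀]; rfl) hχmul
  refine ⟨χ, ?_, fun m x hx => ?_⟩
  · -- a left inverse, zero on the monomials whose degree does not occur
    let η : Laurent n →ₗ[ℂ] R := (AddMonoidAlgebra.basis (Fin (n + 1) → ℤ) ℂ).constr ℂ fun m =>
      if hm : m ∈ N then r ⟨m, hm⟩ else 0
    have hη : η ∘ₗ χ₀ = LinearMap.id := by
      refine b.ext fun k => ?_
      rw [LinearMap.comp_apply, hb, hχ₀, LinearMap.id_apply]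
      have h2 := (AddMonoidAlgebra.basis (Fin (n + 1) → ℤ) ℂ).constr_basis ℂ
        (fun m => if hm : m ∈ N then r ⟨m, hm⟩ else 0) (k : Fin (n + 1) → ℤ)
      rw [dif_pos k.2] at h2
      exact h2
    exact Function.LeftInverse.injective (g := η) fun x => LinearMap.congr_fun hη x
  · by_cases hx0 : x = 0
    · rw [hx0, map_zero]; exact zero_mem _
    · obtain ⟨hm, c, rfl⟩ := hspan m x hx hx0
      rw [map_smul]
      refine Submodule.smul_mem _ _ ?_
      rw [show χ (r ⟨m, hm⟩) = mono m from hχ₀ ⟨m, hm⟩]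
      exact Submodule.mem_span_singleton_self _

end GradedField

/-! ### The graded commutative algebra `U(h ⊗ A ⊗ B)` and its cyclic modules -/

section CyclicModule

/-- A cyclic module over a commutative algebra `C` is the quotient of `C` by an ideal. -/
lemma exists_quotient_of_cyclic.{u, v} {C : Type u} {V : Type v} [CommRing C] [Algebra ℂ C] [AddCommGroup V]
    [Module ℂ V] (π : C →ₐ[ℂ] Module.End ℂ V) (v : V) :
    ∃ (R : Type u) (_ : CommRing R) (_ : Algebra ℂ R) (q : C →ₐ[ℂ] R) (ε : R →ₗ[ℂ] V),
      Function.Surjective q ∧ Function.Injective ε ∧ ∀ u, ε (q u) = π u v := by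
  let J : Ideal C :=
    { carrier := {u | π u v = 0}
      add_mem' := fun {u w} hu hw => by
        change π (u + w) v = 0
        rw [map_add, LinearMap.add_apply, show π u v = 0 from hu, show π w v = 0 from hw, add_zero]
      zero_mem' := by change π 0 v = 0; simp
      smul_mem' := fun c u hu => by
        change π (c * u) v = 0
        rw [map_mul, Module.End.mul_apply, show π u v = 0 from hu, map_zero] }
  let ev : C →ₗ[ℂ] V := (LinearMap.applyₗ v) ∘ₗ π.toLinearMap
  have hle : J.restrictScalars ℂ ≤ LinearMap.ker ev := fun u hu => hu
  let ε : C ⧸ J →ₗ[ℂ] V := (J.restrictScalars ℂ).liftQ ev hle ∘ₗ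
    (Submodule.Quotient.restrictScalarsEquiv ℂ J).symm.toLinearMap
  have hε : ∀ u, ε (Ideal.Quotient.mkₐ ℂ J u) = π u v := fun u => rfl
  refine ⟨C ⧸ J, inferInstance, inferInstance, Ideal.Quotient.mkₐ ℂ J, ε,
    Ideal.Quotient.mkₐ_surjective ℂ J, ?_, hε⟩
  rw [injective_iff_map_eq_zero]
  intro x hx
  obtain ⟨u, rfl⟩ := Ideal.Quotient.mkₐ_surjective ℂ J x
  rw [hε] at hx
  exact Ideal.Quotient.eq_zero_iff_mem.mpr hx

end CyclicModule

section Enveloping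

attribute [local instance] LieRing.ofAssociativeRing

/-- The enveloping algebra of an abelian Lie algebra is commutative. -/
lemma uea_mul_comm {L : Type*} [LieRing L] [LieAlgebra ℂ L] (hL : ∀ x y : L, ⁅x, y⁆ = 0)
    (u w : UniversalEnvelopingAlgebra ℂ L) : u * w = w * u := by
  have h1 : ∀ (x : L) (w : UniversalEnvelopingAlgebra ℂ L),
      w ∈ Subalgebra.centralizer ℂ {UniversalEnvelopingAlgebra.ι ℂ x} := by
    intro x
    refine GradedHom.uea_induction _ fun y => ?_
    rw [Subalgebra.mem_centralizer_iff]
    rintro _ rfl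
    rw [← sub_eq_zero, ← LieRing.of_associative_ring_bracket, ← LieHom.map_lie, hL, map_zero]
  have h2 : u ∈ Subalgebra.centralizer ℂ {w} := by
    refine GradedHom.uea_induction _ (fun x => ?_) u
    rw [Subalgebra.mem_centralizer_iff]
    intro z hz
    rw [Set.mem_singleton_iff.mp hz]
    exact ((Subalgebra.mem_centralizer_iff ℂ).mp (h1 x w) _ rfl).symm
  exact ((Subalgebra.mem_centralizer_iff ℂ).mp h2 w rfl).symm

variable {n : ℕ} {g : Type*} [LieRing g] [LieAlgebra ℂ g] [FiniteDimensional ℂ g]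
  [LieAlgebra.IsSimple ℂ g] {H : LieSubalgebra ℂ g} [H.IsCartanSubalgebra]
  {B : Type*} [CommRing B] [Algebra ℂ B]

lemma cartan1_lie (x y : Cartan1 n H B) : ⁅x, y⁆ = 0 := by
  induction x using ct_induction with
  | ht c h =>
    induction y using ct_induction with
    | ht c' h' => rw [ct_lie, trivial_lie_zero, map_zero]
    | ha u w hu hw => rw [lie_add, hu, hw, add_zero]
  | ha u w hu hw => rw [add_lie, hu, hw, add_zero]

lemma inclCartan_lie (x y : Cartan1 n H B) :
    ⁅(inclCartan x : Tau1 n g B), inclCartan y⁆ = 0 := by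
  induction x using ct_induction with
  | ht c h =>
    induction y using ct_induction with
    | ht c' h' =>
      rw [inclCartan_ct, inclCartan_ct, ct_lie, ← LieSubalgebra.coe_bracket, trivial_lie_zero]
      simp
    | ha u w hu hw => rw [map_add, lie_add, hu, hw, add_zero]
  | ha u w hu hw => rw [map_add, add_lie, hu, hw, add_zero]

variable (n H B) in
/-- `U(h_1)` as a commutative ring. -/
noncomputable abbrev ueaCommRing : CommRing (UniversalEnvelopingAlgebra ℂ (Cartan1 n H B)) :=
  { (inferInstance : Ring (UniversalEnvelopingAlgebra ℂ (Cartan1 n H B))) with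
    mul_comm := uea_mul_comm cartan1_lie }

lemma one_mem_gradedPiece : (1 : UniversalEnvelopingAlgebra ℂ (Cartan1 n H B)) ∈
    gradedPiece n H B 0 :=
  Submodule.subset_span ⟨[], by simp, by simp⟩

lemma mul_mem_gradedPiece {m k : Fin (n + 1) → ℤ}
    {u w : UniversalEnvelopingAlgebra ℂ (Cartan1 n H B)} (hu : u ∈ gradedPiece n H B m)
    (hw : w ∈ gradedPiece n H B k) : u * w ∈ gradedPiece n H B (m + k) := by
  have h1 := Submodule.mul_mem_mul hu hw
  rw [gradedPiece, gradedPiece, Submodule.span_mul_span] at h1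
  refine Submodule.span_mono ?_ h1
  rintro _ ⟨_, ⟨l, hl, rfl⟩, _, ⟨l', hl', rfl⟩, rfl⟩
  exact ⟨l ++ l', by simp [hl, hl'], by simp⟩

lemma gen_mem_gradedPiece (r : Fin (n + 1) → ℤ) (b : B) (h : H) :
    gen r b h ∈ gradedPiece n H B r :=
  Submodule.subset_span ⟨[(r, b, h)], by simp, by simp⟩

lemma iSup_gradedPiece : ⨆ m, gradedPiece n H B m = ⊤ := by
  let T : Subalgebra ℂ (UniversalEnvelopingAlgebra ℂ (Cartan1 n H B)) :=
    { carrier := (⨆ m, gradedPiece n H B m : Submodule ℂ _)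
      mul_mem' := fun {u w} hu hw => by
        have hle : ∀ m, gradedPiece n H B m ≤
            (⨆ m, gradedPiece n H B m).comap (LinearMap.mulRight ℂ w) := by
          intro m u hu
          have hle' : (⨆ m, gradedPiece n H B m) ≤
              (⨆ m, gradedPiece n H B m).comap (LinearMap.mulLeft ℂ u) :=
            iSup_le fun k w hw => (le_iSup (gradedPiece n H B) (m + k)) (mul_mem_gradedPiece hu hw)
          exact hle' hw
        exact (iSup_le hle) hu
      add_mem' := fun {u w} hu hw => add_mem hu hw
      algebraMap_mem' := fun r => by
        rw [Algebra.algebraMap_eq_smul_one]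
        exact Submodule.smul_mem _ _ ((le_iSup (gradedPiece n H B) 0) one_mem_gradedPiece) }
  rw [eq_top_iff]
  rintro u -
  refine GradedHom.uea_induction T (fun x => ?_) u
  change UniversalEnvelopingAlgebra.ι ℂ x ∈ ⨆ m, gradedPiece n H B m
  induction x using ct_induction with
  | ht c h =>
    induction c using coeff_induction with
    | hm m b => exact (le_iSup (gradedPiece n H B) m) (gen_mem_gradedPiece m b h)
    | ha x y hx hy => rw [map_add, LinearMap.add_apply, map_add]; exact add_mem hx hy
  | ha x y hx hy => rw [map_add]; exact add_mem hx hy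

variable {V : Type*} [AddCommGroup V] [Module ℂ V] {a : Tau1 n g B →ₗ[ℂ] Module.End ℂ V}

/-- The action of `U(h_1)` on a `τ_1`-module. -/
noncomputable def cartanAct (ha : ∀ x y, a x * a y - a y * a x = a ⁅x, y⁆) :
    UniversalEnvelopingAlgebra ℂ (Cartan1 n H B) →ₐ[ℂ] Module.End ℂ V :=
  UniversalEnvelopingAlgebra.lift ℂ
    { a ∘ₗ inclCartan with
      map_lie' := fun {x y} => by
        change a (inclCartan ⁅x, y⁆) = ⁅a (inclCartan x), a (inclCartan y)⁆
        rw [cartan1_lie, LieRing.of_associative_ring_bracket, ha, inclCartan_lie, map_zero,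
          map_zero] }

lemma cartanAct_ι (ha : ∀ x y, a x * a y - a y * a x = a ⁅x, y⁆) (x : Cartan1 n H B) :
    cartanAct ha (UniversalEnvelopingAlgebra.ι ℂ x) = a (inclCartan x) :=
  UniversalEnvelopingAlgebra.lift_ι_apply ℂ _ x

/-- Subspaces stable under `h_1` are stable under `U(h_1)`. -/
lemma cartanAct_mem (ha : ∀ x y, a x * a y - a y * a x = a ⁅x, y⁆) {S : Submodule ℂ V}
    (hS : ∀ x : Cartan1 n H B, ∀ v ∈ S, a (inclCartan x) v ∈ S)
    (u : UniversalEnvelopingAlgebra ℂ (Cartan1 n H B)) {v : V} (hv : v ∈ S) :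
    cartanAct ha u v ∈ S := by
  let T : Subalgebra ℂ (UniversalEnvelopingAlgebra ℂ (Cartan1 n H B)) :=
    { carrier := {u | ∀ v ∈ S, cartanAct ha u v ∈ S}
      mul_mem' := fun {u w} hu hw v hv => by
        rw [map_mul, Module.End.mul_apply]; exact hu _ (hw v hv)
      add_mem' := fun {u w} hu hw v hv => by
        rw [map_add, LinearMap.add_apply]; exact add_mem (hu v hv) (hw v hv)
      algebraMap_mem' := fun r v hv => by
        rw [AlgHom.commutes, Module.algebraMap_end_apply]; exact S.smul_mem r hv }
  exact GradedHom.uea_induction T (fun x v hv => by rw [cartanAct_ι]; exact hS x v hv) u v hv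

end Enveloping

/-! ### The graded morphism attached to a highest weight vector -/

section HighestWeightSystem

attribute [local instance] LieRing.ofAssociativeRing

open LieAlgebra LieAlgebra.IsKilling LieModule

variable {n : ℕ} {g : Type*} [LieRing g] [LieAlgebra ℂ g] [FiniteDimensional ℂ g]
  [LieAlgebra.IsSimple ℂ g] {H : LieSubalgebra ℂ g} [H.IsCartanSubalgebra]
  {Δ : (rootSystem H).Base} {B : Type*} [CommRing B] [Algebra ℂ B]
  {V : Type*} [AddCommGroup V] [Module ℂ V]

/-- The simultaneous eigenvectors of `h` and `D` with eigenvalues `lam` and `m`. -/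
def hwSpace (a : Tau1 n g B →ₗ[ℂ] Module.End ℂ V) (D : (Fin (n + 1) → ℂ) →ₗ[ℂ] Module.End ℂ V)
    (lam : Module.Dual ℂ H) (m : Fin (n + 1) → ℤ) : Submodule ℂ V where
  carrier := {v | (∀ h : H, a (ct 1 (h : g)) v = lam h • v) ∧
    ∀ c, D c v = (∑ i, c i * (m i : ℂ)) • v}
  add_mem' := fun {v w} hv hw => ⟨fun h => by rw [map_add, hv.1, hw.1, smul_add],
    fun c => by rw [map_add, hv.2, hw.2, smul_add]⟩
  zero_mem' := ⟨fun h => by simp, fun c => by simp⟩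
  smul_mem' := fun r v hv => ⟨fun h => by rw [map_smul, hv.1, smul_comm],
    fun c => by rw [map_smul, hv.2, smul_comm]⟩

variable (Δ) in
/-- An irreducible integrable action of `τ̃_1`, given by the operators `a` of `τ_1` and `D` of
the degree derivations, together with a highest weight vector `v₀` of degree zero whose weight
space is finite-dimensional. -/
structure IsHighestWeightSystem (a : Tau1 n g B →ₗ[ℂ] Module.End ℂ V)
    (D : (Fin (n + 1) → ℂ) →ₗ[ℂ] Module.End ℂ V) (lam : Module.Dual ℂ H) (v₀ : V) : Prop where
  comm : ∀ x y, a x * a y - a y * a x = a ⁅x, y⁆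
  comm_deg : ∀ c u, D c * a u - a u * D c = a (degTau1 n g B c u)
  comm_D : ∀ c c', D c * D c' = D c' * D c
  irr : ∀ S : Submodule ℂ V, (∀ u, ∀ s ∈ S, a u s ∈ S) → (∀ c, ∀ s ∈ S, D c s ∈ S) →
    S ≠ ⊥ → S = ⊤
  ne_zero : v₀ ≠ 0
  plus : ∀ c, ∀ x ∈ gPlus Δ, a (ct c x) v₀ = 0
  mem : v₀ ∈ hwSpace a D lam 0
  nilpotent : ∀ i : H.root, ∀ x ∈ rootSpace H (i : Weight ℂ H g), ∀ (m : Fin (n + 1) → ℤ) (b : B)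
    w, ∃ k : ℕ, ((a (ct (mono m ⊗ₜ b) x)) ^ k) w = 0
  finite : FiniteDimensional ℂ (hwSpace a D lam 0)

namespace IsHighestWeightSystem

variable {a : Tau1 n g B →ₗ[ℂ] Module.End ℂ V} {D : (Fin (n + 1) → ℂ) →ₗ[ℂ] Module.End ℂ V}
  {lam : Module.Dual ℂ H} {v₀ : V} (hh : IsHighestWeightSystem Δ a D lam v₀)

include hh

lemma deg_apply (c : Fin (n + 1) → ℂ) (m : Fin (n + 1) → ℤ) (b : B) (x : g) (v : V) :
    D c (a (ct (mono m ⊗ₜ b) x) v) = a (ct (mono m ⊗ₜ b) x) (D c v) +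
      (∑ i, c i * (m i : ℂ)) • a (ct (mono m ⊗ₜ b) x) v := by
  have h1 := LinearMap.congr_fun (hh.comm_deg c (ct (mono m ⊗ₜ b) x)) v
  rw [degTau1_ct, map_smul, LinearMap.sub_apply, Module.End.mul_apply, Module.End.mul_apply,
    LinearMap.smul_apply] at h1
  rw [← h1]
  abel

lemma gen_mem {k m : Fin (n + 1) → ℤ} {b : B} {h : H} {v : V} (hv : v ∈ hwSpace a D lam k) :
    a (ct (mono m ⊗ₜ b) (h : g)) v ∈ hwSpace a D lam (k + m) := by
  refine ⟨fun h' => ?_, fun c => ?_⟩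
  · have h1 := LinearMap.congr_fun (hh.comm (ct 1 (h' : g)) (ct (mono m ⊗ₜ b) (h : g))) v
    rw [ct_lie, ← LieSubalgebra.coe_bracket, trivial_lie_zero, ZeroMemClass.coe_zero, map_zero,
      map_zero, LinearMap.sub_apply, Module.End.mul_apply, Module.End.mul_apply, hv.1, map_smul,
      LinearMap.zero_apply, sub_eq_zero] at h1
    exact h1
  · rw [hh.deg_apply, hv.2, map_smul, ← add_smul, ← Finset.sum_add_distrib]
    simp [mul_add]

lemma cartanAct_mem_hwSpace {k m : Fin (n + 1) → ℤ}
    {u : UniversalEnvelopingAlgebra ℂ (Cartan1 n H B)} (hu : u ∈ gradedPiece n H B m) {v : V}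
    (hv : v ∈ hwSpace a D lam k) : cartanAct hh.comm u v ∈ hwSpace a D lam (k + m) := by
  induction hu using Submodule.span_induction with
  | mem u hu =>
    obtain ⟨l, rfl, rfl⟩ := hu
    induction l with
    | nil => simpa using hv
    | cons q l ih =>
      rw [List.map_cons, List.map_cons, List.prod_cons, List.sum_cons, map_mul,
        Module.End.mul_apply, add_comm q.1, ← add_assoc, gen, cartanAct_ι, elt_eq_ct, inclCartan_ct]
      exact hh.gen_mem ih
  | zero => simp
  | add x y _ _ h1 h2 => rw [map_add, LinearMap.add_apply]; exact add_mem h1 h2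
  | smul r x _ h => rw [map_smul, LinearMap.smul_apply]; exact Submodule.smul_mem _ _ h

lemma iSupIndep_hwSpace : iSupIndep (hwSpace a D lam) := by
  have h1 := Module.End.independent_iInf_maxGenEigenspace_of_forall_mapsTo
    (fun i : Fin (n + 1) => D (Pi.single i 1))
    (fun i j φ => Module.End.mapsTo_maxGenEigenspace_of_comm (hh.comm_D _ _) φ)
  have hinj : Function.Injective fun (m : Fin (n + 1) → ℤ) (i : Fin (n + 1)) => (m i : ℂ) := by
    intro m k h
    funext i
    have h2 : (m i : ℂ) = k i := congrFun h i
    exact_mod_cast h2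
  refine (h1.comp hinj).mono fun m v hv => ?_
  rw [Function.comp_apply, Submodule.mem_iInf]
  intro i
  rw [Module.End.mem_maxGenEigenspace]
  refine ⟨1, ?_⟩
  have h2 := hv.2 (Pi.single i 1)
  rw [pow_one, LinearMap.sub_apply, h2]
  simp [Pi.single_apply]

lemma lie_cartan_plus {v : V} (hv : ∀ c, ∀ x ∈ gPlus Δ, a (ct c x) v = 0) (y : Cartan1 n H B)
    (c : Coeff n B) {x : g} (hx : x ∈ gPlus Δ) : a (ct c x) (a (inclCartan y) v) = 0 := by
  induction y using ct_induction with
  | ht c' h =>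
    refine gPlus_induction Δ (p := fun x => a (ct c x) (a (inclCartan (ct c' h)) v) = 0) hx
      (fun i hi x hx => ?_) (by simp)
      (fun x y h1 h2 => by rw [map_add, map_add, LinearMap.add_apply, h1, h2, add_zero])
    have h1 := LinearMap.congr_fun (hh.comm (ct c x) (ct c' (h : g))) v
    rw [ct_lie, ← lie_skew, lie_of_mem_rootSpace hx, map_neg, map_smul, map_neg, map_smul,
      LinearMap.sub_apply, Module.End.mul_apply, Module.End.mul_apply, LinearMap.neg_apply,
      LinearMap.smul_apply, hv _ _ (mem_gPlus Δ hi hx), hv _ _ (mem_gPlus Δ hi hx), map_zero,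
      smul_zero, neg_zero, sub_zero] at h1
    exact h1
  | ha y z h1 h2 => rw [map_add, map_add, LinearMap.add_apply, map_add, h1, h2, add_zero]

/-- `U(h_1) v₀` consists of vectors killed by `g⁺ ⊗ A ⊗ B`. -/
lemma plus_cartanAct (u : UniversalEnvelopingAlgebra ℂ (Cartan1 n H B)) (c : Coeff n B) {x : g}
    (hx : x ∈ gPlus Δ) : a (ct c x) (cartanAct hh.comm u v₀) = 0 := by
  let S : Submodule ℂ V :=
    { carrier := {v | ∀ c, ∀ x ∈ gPlus Δ, a (ct c x) v = 0}
      add_mem' := fun {v w} hv hw c x hx => by rw [map_add, hv c x hx, hw c x hx, add_zero]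
      zero_mem' := fun c x _ => map_zero _
      smul_mem' := fun r v hv c x hx => by rw [map_smul, hv c x hx, smul_zero] }
  exact cartanAct_mem hh.comm (S := S) (fun y v hv c x hx => hh.lie_cartan_plus hv y c hx) u
    (v := v₀) hh.plus c x hx

lemma heightOp_cartanAct (u : UniversalEnvelopingAlgebra ℂ (Cartan1 n H B)) :
    heightOp Δ a (cartanAct hh.comm u v₀) =
      lam (heightCoweight Δ) • cartanAct hh.comm u v₀ := by
  have hcomm : heightOp Δ a = cartanAct hh.comm
      (UniversalEnvelopingAlgebra.ι ℂ (ct 1 (heightCoweight Δ) : Cartan1 n H B)) := by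
    rw [cartanAct_ι, inclCartan_ct, heightOp]
  rw [hcomm, ← Module.End.mul_apply, ← map_mul, uea_mul_comm cartan1_lie, map_mul,
    Module.End.mul_apply, ← hcomm, heightOp, hh.mem.1, map_smul]

/-- The operators of `D` normalize those of `g⁻ ⊗ A ⊗ B`. -/
lemma deg_lowering (c : Fin (n + 1) → ℂ) (c' : Coeff n B) {f : g} (hf : f ∈ gMinus Δ) :
    D c * a (ct c' f) - a (ct c' f) * D c ∈ lowering Δ a := by
  rw [hh.comm_deg]
  induction c' using coeff_induction with
  | hm m b =>
    rw [degTau1_ct, map_smul]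
    exact Submodule.smul_mem _ _ (mem_lowering Δ _ hf)
  | ha x y h1 h2 => rw [map_add, LinearMap.add_apply, map_add, map_add]; exact add_mem h1 h2

/-- If `W ⊆ U(h_1) v₀` is stable under `h_1`, then `U(τ_1) W` is stable under `τ_1`, and it
meets `U(h_1) v₀` in `W`. -/
lemma opClosure_lowering {W : Submodule ℂ V}
    (hWT : ∀ w ∈ W, ∃ u : UniversalEnvelopingAlgebra ℂ (Cartan1 n H B), w = cartanAct hh.comm u v₀)
    (hW : ∀ (y : Cartan1 n H B), ∀ w ∈ W, a (inclCartan y) w ∈ W) :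
    (∀ u, ∀ s ∈ opClosure (lowering Δ a : Set _) W, a u s ∈ opClosure (lowering Δ a : Set _) W) ∧
    ((∀ c, ∀ w ∈ W, D c w ∈ W) → ∀ c, ∀ s ∈ opClosure (lowering Δ a : Set _) W,
      D c s ∈ opClosure (lowering Δ a : Set _) W) ∧
    ∀ u : UniversalEnvelopingAlgebra ℂ (Cartan1 n H B), cartanAct hh.comm u v₀ ∈ opClosure (lowering Δ a : Set _) W →
      cartanAct hh.comm u v₀ ∈ W := by
  have hst : ∀ c, ∀ x ∈ H.toSubmodule ⊔ gPlus Δ, ∀ w ∈ W, a (ct c x) w ∈ W := by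
    intro c x hx w hw
    obtain ⟨h, hh', z, hz, rfl⟩ := Submodule.mem_sup.mp hx
    obtain ⟨u, rfl⟩ := hWT w hw
    rw [map_add, map_add, LinearMap.add_apply, hh.plus_cartanAct u c hz, add_zero]
    exact hW (ct c ⟨h, hh'⟩) _ hw
  have hWh : ∀ w ∈ W, heightOp Δ a w = lam (heightCoweight Δ) • w := by
    intro w hw
    obtain ⟨u, rfl⟩ := hWT w hw
    exact hh.heightOp_cartanAct u
  refine ⟨(opClosure_lowering_stable Δ hh.comm (D := ∅) hst (by simp) (by simp)).1,
    fun hD c s hs => ?_, fun u hu => ?_⟩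
  · refine (opClosure_lowering_stable Δ hh.comm (D := Set.range D) hst ?_ ?_).2 (D c) ⟨c, rfl⟩ s hs
    · rintro _ ⟨c, rfl⟩; exact hD c
    · rintro _ ⟨c, rfl⟩ c' f hf; exact hh.deg_lowering c c' hf
  · obtain ⟨w, hw, l, hl, hwl⟩ := Submodule.mem_sup.mp (opClosure_lowering_le Δ hh.comm hWh hu)
    have hl0 : l = 0 := by
      refine eq_zero_of_mem_lowPart (c := lam (heightCoweight Δ)) ?_ hl
      rw [← add_sub_cancel_left w l, hwl, map_sub, hh.heightOp_cartanAct, hWh w hw, smul_sub]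
    rwa [← hwl, hl0, add_zero]

/-- Nonzero homogeneous elements of `U(h_1) v₀` generate it. -/
lemma exists_cartanAct_eq {m : Fin (n + 1) → ℤ}
    {u : UniversalEnvelopingAlgebra ℂ (Cartan1 n H B)} (hu : u ∈ gradedPiece n H B m)
    (hne : cartanAct hh.comm u v₀ ≠ 0) :
    ∃ u', cartanAct hh.comm (u' * u) v₀ = v₀ := by
  let ev : UniversalEnvelopingAlgebra ℂ (Cartan1 n H B) →ₗ[ℂ] V :=
    (LinearMap.applyₗ (cartanAct hh.comm u v₀)) ∘ₗ (cartanAct hh.comm).toLinearMap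
  have hev : ∀ u', ev u' = cartanAct hh.comm (u' * u) v₀ := fun u' => by
    rw [map_mul]; rfl
  obtain ⟨h1, h2, h3⟩ := hh.opClosure_lowering (W := LinearMap.range ev)
    (by rintro _ ⟨u', rfl⟩; exact ⟨u' * u, hev u'⟩)
    (by
      rintro y _ ⟨u', rfl⟩
      refine ⟨UniversalEnvelopingAlgebra.ι ℂ y * u', ?_⟩
      rw [hev, hev, mul_assoc, map_mul, Module.End.mul_apply, cartanAct_ι])
  have hD : ∀ c, ∀ w ∈ LinearMap.range ev, D c w ∈ LinearMap.range ev := by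
    rintro c _ ⟨u', rfl⟩
    have hu' : u' ∈ ⨆ m, gradedPiece n H B m := by rw [iSup_gradedPiece]; trivial
    refine Submodule.iSup_induction _ (motive := fun u' => D c (ev u') ∈ LinearMap.range ev) hu'
      (fun k u' hu' => ?_) (by simp) (fun x y h1 h2 => by rw [map_add, map_add]; exact add_mem h1 h2)
    rw [hev, (hh.cartanAct_mem_hwSpace (mul_mem_gradedPiece hu' hu) hh.mem).2, ← hev]
    exact Submodule.smul_mem _ _ ⟨u', rfl⟩
  have htop := hh.irr _ h1 (h2 hD) fun hbot => by
    have h4 : ev 1 ∈ opClosure (lowering Δ a : Set _) (LinearMap.range ev) :=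
      le_opClosure _ _ ⟨1, rfl⟩
    rw [hbot, Submodule.mem_bot, hev, one_mul] at h4
    exact hne h4
  obtain ⟨u', hu'⟩ := h3 1 (by rw [htop]; trivial)
  exact ⟨u', by rw [← hev, hu', map_one, Module.End.one_apply]⟩

/-- The algebra `U(h_1)` acts on `U(h_1) v₀` through a graded morphism to the Laurent polynomials,
and `U(h_1) v₀` is isomorphic to the image of this morphism. -/
theorem exists_gradedHom : ∃ (ψ : GradedHom n H B) (Θ : ψ.image →ₗ[ℂ] V), Function.Injective Θ ∧
    ∀ u, Θ (ψ.toAlgHom.rangeRestrict u) = cartanAct hh.comm u v₀ := by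
  obtain ⟨R, _, _, q, ε, hq, hε, hqε⟩ : ∃ (R : Type _) (_ : CommRing R) (_ : Algebra ℂ R)
      (q : UniversalEnvelopingAlgebra ℂ (Cartan1 n H B) →ₐ[ℂ] R) (ε : R →ₗ[ℂ] V),
      Function.Surjective q ∧ Function.Injective ε ∧ ∀ u, ε (q u) = cartanAct hh.comm u v₀ := by
    exact @exists_quotient_of_cyclic _ V (ueaCommRing n H B) _ _ _ (cartanAct (H := H) hh.comm) v₀
  let 𝒜 : (Fin (n + 1) → ℤ) → Submodule ℂ R := fun m => (gradedPiece n H B m).map q.toLinearMap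
  have hle : ∀ m, 𝒜 m ≤ (hwSpace a D lam m).comap ε := by
    rintro m _ ⟨u, hu, rfl⟩
    have h1 := hh.cartanAct_mem_hwSpace hu hh.mem
    rw [zero_add] at h1
    change ε (q u) ∈ hwSpace a D lam m
    rwa [hqε]
  have hnt : Nontrivial R := ⟨1, 0, fun h => hh.ne_zero (by
    rw [← map_one q] at h
    have h1 := hqε 1
    rw [h, map_zero, map_one, Module.End.one_apply] at h1
    exact h1.symm)⟩
  obtain ⟨χ, hχ, hχg⟩ := exists_graded_embedding (𝒜 := 𝒜)
    ⟨1, one_mem_gradedPiece, map_one q⟩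
    (by
      rintro m k _ ⟨u, hu, rfl⟩ _ ⟨w, hw, rfl⟩
      exact ⟨u * w, mul_mem_gradedPiece hu hw, map_mul q u w⟩)
    (by
      intro m
      rw [Submodule.disjoint_def]
      intro x hx hx'
      have h1 : (⨆ j, ⨆ (_ : j ≠ m), 𝒜 j) ≤
          (⨆ j, ⨆ (_ : j ≠ m), hwSpace a D lam j).comap ε := by
        refine iSup₂_le fun j hj y hy => ?_
        exact (le_iSup₂ (f := fun j (_ : j ≠ m) => hwSpace a D lam j) j hj) (hle j hy)
      have h2 := Submodule.disjoint_def.mp (hh.iSupIndep_hwSpace m) _ (hle m hx) (h1 hx')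
      exact hε (h2.trans (map_zero ε).symm))
    (by
      change ⨆ m, (gradedPiece n H B m).map q.toLinearMap = ⊤
      rw [← Submodule.map_iSup, iSup_gradedPiece, Submodule.map_top]
      exact LinearMap.range_eq_top.mpr hq)
    (by
      rintro m _ ⟨u, hu, rfl⟩ hne
      obtain ⟨u', hu'⟩ := hh.exists_cartanAct_eq hu fun h0 => hne (hε (by
        rw [map_zero]; exact (hqε u).trans h0))
      refine ⟨q u', hε ?_⟩
      change ε (q u * q u') = ε 1
      rw [mul_comm, ← map_mul, ← map_one q, hqε, hqε, hu', map_one, Module.End.one_apply])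
    (by
      have := hh.finite
      exact Module.Finite.of_injective ((ε.domRestrict (𝒜 0)).codRestrict (hwSpace a D lam 0)
        fun x => hle 0 x.2) fun x y hxy => Subtype.ext (hε (congrArg Subtype.val hxy)))
  let ψ : GradedHom n H B :=
    { toAlgHom := χ.comp q
      graded := fun m u hu => hχg m _ ⟨u, hu, rfl⟩ }
  let χ' : R →ₗ[ℂ] ψ.image := χ.toLinearMap.codRestrict (Subalgebra.toSubmodule ψ.image) (by
    intro x
    obtain ⟨u, rfl⟩ := hq x
    exact ⟨u, rfl⟩)
  have hbij : Function.Bijective χ' := by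
    refine ⟨fun x y hxy => hχ (congrArg Subtype.val hxy), ?_⟩
    rintro ⟨_, u, rfl⟩
    exact ⟨q u, rfl⟩
  let e := LinearEquiv.ofBijective χ' hbij
  refine ⟨ψ, ε ∘ₗ e.symm.toLinearMap, hε.comp e.symm.injective, fun u => ?_⟩
  have h1 : e.symm (ψ.toAlgHom.rangeRestrict u) = q u := by
    rw [LinearEquiv.symm_apply_eq]
    rfl
  change ε (e.symm _) = _
  rw [h1, hqε]

end IsHighestWeightSystem

end HighestWeightSystem

/-! ### The operators of `τ̃_1` and the module `M(ψ̄)` -/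

section Tau1D

variable {n : ℕ} {g : Type*} [LieRing g] [LieAlgebra ℂ g] {B : Type*} [CommRing B] [Algebra ℂ B]

lemma tau1D_ofTau1_lie (x y : Tau1 n g B) :
    ⁅Tau1D.ofTau1 x, Tau1D.ofTau1 y⁆ = (Tau1D.ofTau1 ⁅x, y⁆ : Tau1D n g B) := by
  refine Prod.ext ?_ rfl
  change ⁅x, y⁆ + degTau1 n g B 0 y - degTau1 n g B 0 x = ⁅x, y⁆
  simp

lemma tau1D_ofD_lie (c : Fin (n + 1) → ℂ) (y : Tau1 n g B) :
    ⁅(Tau1D.ofD c : Tau1D n g B), Tau1D.ofTau1 y⁆ = Tau1D.ofTau1 (degTau1 n g B c y) := by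
  refine Prod.ext ?_ rfl
  change ⁅(0 : Tau1 n g B), y⁆ + degTau1 n g B c y - degTau1 n g B 0 0 = degTau1 n g B c y
  simp

lemma tau1D_eq (x : Tau1D n g B) : x = Tau1D.ofTau1 x.1 + Tau1D.ofD x.2 := by
  refine Prod.ext ?_ ?_
  · exact (add_zero x.1).symm
  · exact (zero_add x.2).symm

variable {V : Type*} [AddCommGroup V] [Module ℂ V]

/-- The operators of `τ̃_1 = τ_1 ⊕ D` obtained from those of `τ_1` and of `D`. -/
noncomputable def tau1DAct (a : Tau1 n g B →ₗ[ℂ] Module.End ℂ V)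
    (D : (Fin (n + 1) → ℂ) →ₗ[ℂ] Module.End ℂ V) : Tau1D n g B →ₗ[ℂ] Module.End ℂ V :=
  (a.coprod D : Tau1 n g B × (Fin (n + 1) → ℂ) →ₗ[ℂ] Module.End ℂ V)

lemma tau1DAct_apply (a : Tau1 n g B →ₗ[ℂ] Module.End ℂ V)
    (D : (Fin (n + 1) → ℂ) →ₗ[ℂ] Module.End ℂ V) (x : Tau1D n g B) :
    tau1DAct a D x = a x.1 + D x.2 := rfl

lemma tau1DAct_ofTau1 (a : Tau1 n g B →ₗ[ℂ] Module.End ℂ V)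
    (D : (Fin (n + 1) → ℂ) →ₗ[ℂ] Module.End ℂ V) (u : Tau1 n g B) :
    tau1DAct a D (Tau1D.ofTau1 u) = a u := by
  rw [tau1DAct_apply]
  change a u + D 0 = a u
  rw [map_zero, add_zero]

lemma tau1DAct_ofD (a : Tau1 n g B →ₗ[ℂ] Module.End ℂ V)
    (D : (Fin (n + 1) → ℂ) →ₗ[ℂ] Module.End ℂ V) (c : Fin (n + 1) → ℂ) :
    tau1DAct a D (Tau1D.ofD c) = D c := by
  rw [tau1DAct_apply]
  change a 0 + D c = D c
  rw [map_zero, zero_add]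

lemma tau1DAct_comm {a : Tau1 n g B →ₗ[ℂ] Module.End ℂ V}
    {D : (Fin (n + 1) → ℂ) →ₗ[ℂ] Module.End ℂ V}
    (ha : ∀ x y, a x * a y - a y * a x = a ⁅x, y⁆)
    (hDa : ∀ c u, D c * a u - a u * D c = a (degTau1 n g B c u))
    (hD : ∀ c c', D c * D c' = D c' * D c) (x y : Tau1D n g B) :
    tau1DAct a D x * tau1DAct a D y - tau1DAct a D y * tau1DAct a D x = tau1DAct a D ⁅x, y⁆ := by
  rw [tau1DAct_apply, tau1DAct_apply, tau1DAct_apply]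
  change _ = a (⁅x.1, y.1⁆ + degTau1 n g B x.2 y.1 - degTau1 n g B y.2 x.1) + D 0
  rw [map_sub, map_add, ← ha, ← hDa, ← hDa, map_zero, add_zero]
  have h := hD x.2 y.2
  simp only [mul_add, add_mul]
  rw [h]
  abel

end Tau1D

section Coprod

variable {P Q M : Type*} [AddCommMonoid P] [Module ℂ P] [AddCommMonoid Q] [Module ℂ Q]
  [AddCommMonoid M] [Module ℂ M]

lemma coprod_left_apply (f : P →ₗ[ℂ] M) (k : Q →ₗ[ℂ] M) (x : P) : f.coprod k (x, 0) = f x := by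
  rw [LinearMap.coprod_apply, map_zero, add_zero]

lemma coprod_right_apply (f : P →ₗ[ℂ] M) (k : Q →ₗ[ℂ] M) (y : Q) : f.coprod k (0, y) = k y := by
  rw [LinearMap.coprod_apply, map_zero, zero_add]

end Coprod

section MGraded

attribute [local instance] LieRing.ofAssociativeRing

open LieAlgebra LieAlgebra.IsKilling LieModule

variable {n : ℕ} {g : Type*} [LieRing g] [LieAlgebra ℂ g] [FiniteDimensional ℂ g]
  [LieAlgebra.IsSimple ℂ g] {H : LieSubalgebra ℂ g} [H.IsCartanSubalgebra]
  (Δ : (rootSystem H).Base) {B : Type*} [CommRing B] [Algebra ℂ B] (ψ : GradedHom n H B)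

/-- The map `A_ψ → M(ψ)`. -/
noncomputable def gradedTop : ψ.image →ₗ[ℂ] MGraded Δ ψ := Induced.top _ _

lemma plus_lie_gradedTop (y : Coeff n B ⊗[ℂ] gPlus Δ) (w : ψ.image) :
    ⁅(Tau1D.ofTau1 (inclPlus Δ y) : Tau1D n g B), gradedTop Δ ψ w⁆ = 0 := by
  have h1 := Induced.lie_top_left (P₁ := Coeff n B ⊗[ℂ] gPlus Δ)
    (P₂ := Cartan1 n H B × (Fin (n + 1) → ℂ)) (j₁ := Tau1D.ofTau1 ∘ₗ inclPlus Δ)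
    (j₂ := (Tau1D.ofTau1 ∘ₗ inclCartan).coprod Tau1D.ofD)
    (act₁ := (0 : Coeff n B ⊗[ℂ] gPlus Δ →ₗ[ℂ] Module.End ℂ ψ.image))
    (act₂ := ψ.actCartan.coprod ψ.actD) y w
  rw [LinearMap.zero_apply, LinearMap.zero_apply, map_zero] at h1
  exact h1

lemma cartan_lie_gradedTop (x : Cartan1 n H B) (w : ψ.image) :
    ⁅(Tau1D.ofTau1 (inclCartan x) : Tau1D n g B), gradedTop Δ ψ w⁆ =
      gradedTop Δ ψ (ψ.actCartan x w) := by
  have h1 := Induced.lie_top_right (L := Tau1D n g B) (W := ψ.image) (P₁ := Coeff n B ⊗[ℂ] gPlus Δ)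
    (P₂ := Cartan1 n H B × (Fin (n + 1) → ℂ)) (j₁ := Tau1D.ofTau1 ∘ₗ inclPlus Δ)
    (j₂ := (Tau1D.ofTau1 ∘ₗ inclCartan).coprod Tau1D.ofD)
    (act₁ := (0 : Coeff n B ⊗[ℂ] gPlus Δ →ₗ[ℂ] Module.End ℂ ψ.image))
    (act₂ := ψ.actCartan.coprod ψ.actD) (x, 0) w
  rw [coprod_left_apply] at h1
  have h2 := coprod_left_apply ψ.actCartan ψ.actD x
  exact h1.trans (congrArg (fun e : Module.End ℂ ψ.image => gradedTop Δ ψ (e w)) h2)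

lemma deg_lie_gradedTop (c : Fin (n + 1) → ℂ) (w : ψ.image) :
    ⁅(Tau1D.ofD c : Tau1D n g B), gradedTop Δ ψ w⁆ = gradedTop Δ ψ (ψ.actD c w) := by
  have h1 := Induced.lie_top_right (L := Tau1D n g B) (W := ψ.image) (P₁ := Coeff n B ⊗[ℂ] gPlus Δ)
    (P₂ := Cartan1 n H B × (Fin (n + 1) → ℂ)) (j₁ := Tau1D.ofTau1 ∘ₗ inclPlus Δ)
    (j₂ := (Tau1D.ofTau1 ∘ₗ inclCartan).coprod Tau1D.ofD)
    (act₁ := (0 : Coeff n B ⊗[ℂ] gPlus Δ →ₗ[ℂ] Module.End ℂ ψ.image))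
    (act₂ := ψ.actCartan.coprod ψ.actD) (0, c) w
  rw [coprod_right_apply] at h1
  have h2 := coprod_right_apply ψ.actCartan ψ.actD c
  exact h1.trans (congrArg (fun e : Module.End ℂ ψ.image => gradedTop Δ ψ (e w)) h2)

lemma mGraded_eq_top {ψ : GradedHom n H B} (S : Submodule ℂ (MGraded Δ ψ))
    (h1 : ∀ w, gradedTop Δ ψ w ∈ S) (h2 : ∀ (u : Tau1D n g B), ∀ s ∈ S, ⁅u, s⁆ ∈ S) : S = ⊤ :=
  Induced.eq_top_of_stable S h1 h2

lemma mGraded_lift_compat {V : Type*} [AddCommGroup V] [Module ℂ V]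
    {ρ : Tau1D n g B →ₗ[ℂ] Module.End ℂ V} {Θ : ψ.image →ₗ[ℂ] V}
    (hcart : ∀ x w, ρ (Tau1D.ofTau1 (inclCartan x)) (Θ w) = Θ (ψ.actCartan x w))
    (hdeg : ∀ c w, ρ (Tau1D.ofD c) (Θ w) = Θ (ψ.actD c w))
    (p : Cartan1 n H B × (Fin (n + 1) → ℂ)) (w : ψ.image) :
    ρ (((Tau1D.ofTau1 ∘ₗ inclCartan).coprod Tau1D.ofD) p) (Θ w) =
      Θ ((ψ.actCartan.coprod ψ.actD) p w) := by
  rw [LinearMap.coprod_apply, LinearMap.coprod_apply, LinearMap.add_apply, map_add, map_add,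
    LinearMap.add_apply, LinearMap.comp_apply, hcart, hdeg]

lemma mGraded_lift_compat' {V : Type*} [AddCommGroup V] [Module ℂ V]
    {ρ : Tau1D n g B →ₗ[ℂ] Module.End ℂ V} {Θ : ψ.image →ₗ[ℂ] V}
    (hplus : ∀ y w, ρ (Tau1D.ofTau1 (inclPlus Δ y)) (Θ w) = 0)
    (hcart : ∀ x w, ρ (Tau1D.ofTau1 (inclCartan x)) (Θ w) = Θ (ψ.actCartan x w))
    (hdeg : ∀ c w, ρ (Tau1D.ofD c) (Θ w) = Θ (ψ.actD c w))
    (p : (Coeff n B ⊗[ℂ] gPlus Δ) × Cartan1 n H B × (Fin (n + 1) → ℂ)) (w : ψ.image) :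
    ρ (((Tau1D.ofTau1 ∘ₗ inclPlus Δ).coprod
        ((Tau1D.ofTau1 ∘ₗ inclCartan).coprod Tau1D.ofD)) p) (Θ w) =
      Θ (((0 : Coeff n B ⊗[ℂ] gPlus Δ →ₗ[ℂ] Module.End ℂ ψ.image).coprod
        (ψ.actCartan.coprod ψ.actD)) p w) := by
  have h2 := mGraded_lift_compat ψ hcart hdeg p.2 w
  have h3 := hplus p.1 w
  rw [LinearMap.coprod_apply, map_add, LinearMap.add_apply, h2, LinearMap.comp_apply, h3, zero_add]
  have h4 : ((0 : Coeff n B ⊗[ℂ] gPlus Δ →ₗ[ℂ] Module.End ℂ ψ.image).coprod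
      (ψ.actCartan.coprod ψ.actD)) p = (ψ.actCartan.coprod ψ.actD) p.2 := by
    rw [LinearMap.coprod_apply, LinearMap.zero_apply, zero_add]
  rw [h4]

/-- The universal property of `M(ψ̄)`. -/
lemma mGraded_lift {V : Type*} [AddCommGroup V] [Module ℂ V]
    (ρ : Tau1D n g B →ₗ[ℂ] Module.End ℂ V) (hρ : ∀ x y, ρ x * ρ y - ρ y * ρ x = ρ ⁅x, y⁆)
    (Θ : ψ.image →ₗ[ℂ] V) (hplus : ∀ y w, ρ (Tau1D.ofTau1 (inclPlus Δ y)) (Θ w) = 0)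
    (hcart : ∀ x w, ρ (Tau1D.ofTau1 (inclCartan x)) (Θ w) = Θ (ψ.actCartan x w))
    (hdeg : ∀ c w, ρ (Tau1D.ofD c) (Θ w) = Θ (ψ.actD c w)) :
    ∃ Φ : MGraded Δ ψ →ₗ[ℂ] V, (∀ w, Φ (gradedTop Δ ψ w) = Θ w) ∧
      ∀ x m, Φ ⁅x, m⁆ = ρ x (Φ m) := by
  have h3 := Induced.exists_lift
    (P := (Coeff n B ⊗[ℂ] gPlus Δ) × Cartan1 n H B × (Fin (n + 1) → ℂ))
    (j := (Tau1D.ofTau1 ∘ₗ inclPlus Δ).coprod ((Tau1D.ofTau1 ∘ₗ inclCartan).coprod Tau1D.ofD))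
    (act := (0 : Coeff n B ⊗[ℂ] gPlus Δ →ₗ[ℂ] Module.End ℂ ψ.image).coprod
      (ψ.actCartan.coprod ψ.actD)) ρ hρ Θ (mGraded_lift_compat' Δ ψ hplus hcart hdeg)
  exact h3

end MGraded

/-! ### The largest proper submodule of an induced module -/

section IrredQuotientEquiv

variable {L : Type*} [LieRing L] [LieAlgebra ℂ L] {M : Type*} [AddCommGroup M] [Module ℂ M]
  [LieRingModule L M] [LieModule ℂ L M] {V : Type*} [AddCommGroup V] [Module ℂ V]

/-- A surjective equivariant map on `M` whose kernel contains all proper submodules identifies its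
target with the irreducible quotient of `M`. -/
lemma exists_equiv_irredQuotient [Nontrivial V] {ρ : L →ₗ[ℂ] Module.End ℂ V} (Φ : M →ₗ[ℂ] V)
    (hΦ : Function.Surjective Φ) (hρ : ∀ x m, Φ ⁅x, m⁆ = ρ x (Φ m))
    (hmax : ∀ N : LieSubmodule ℂ L M, N ≠ ⊤ → N.toSubmodule ≤ LinearMap.ker Φ) :
    ∃ f : V ≃ₗ[ℂ] IrredQuotient L M, ∀ x v, f (ρ x v) = ⁅x, f v⁆ := by
  have hker : (sSup {N : LieSubmodule ℂ L M | N ≠ ⊤}).toSubmodule = LinearMap.ker Φ := by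
    refine le_antisymm ?_ ?_
    · rw [LieSubmodule.sSup_toSubmodule]
      refine sSup_le ?_
      rintro _ ⟨N, hN, rfl⟩
      exact hmax N hN
    · let K : LieSubmodule ℂ L M :=
        { LinearMap.ker Φ with
          lie_mem := fun {x m} hm => by
            change Φ ⁅x, m⁆ = 0
            rw [hρ, show Φ m = 0 from hm, map_zero] }
      have hK : K ≠ ⊤ := by
        intro h
        obtain ⟨v, hv⟩ := exists_ne (0 : V)
        obtain ⟨m, rfl⟩ := hΦ v
        have : m ∈ K := by rw [h]; trivial
        exact hv this
      exact LieSubmodule.toSubmodule_le_toSubmodule _ _ |>.mpr (le_sSup (show K ∈ {N : LieSubmodule ℂ L M | N ≠ ⊤} from hK))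
  let e : IrredQuotient L M ≃ₗ[ℂ] V :=
    (Submodule.quotEquivOfEq _ _ hker).trans (Φ.quotKerEquivOfSurjective hΦ)
  have he : ∀ m : M, e (LieSubmodule.Quotient.mk m) = Φ m := fun m => rfl
  refine ⟨e.symm, fun x v => ?_⟩
  obtain ⟨m, rfl⟩ := hΦ v
  have h1 : e.symm (Φ m) = LieSubmodule.Quotient.mk m := by
    rw [LinearEquiv.symm_apply_eq, he]
  rw [h1, LinearEquiv.symm_apply_eq, ← hρ, ← he]
  rfl

end IrredQuotientEquiv

section Maximal

attribute [local instance] LieRing.ofAssociativeRing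

open LieAlgebra LieAlgebra.IsKilling LieModule

variable {n : ℕ} {g : Type*} [LieRing g] [LieAlgebra ℂ g] [FiniteDimensional ℂ g]
  [LieAlgebra.IsSimple ℂ g] {H : LieSubalgebra ℂ g} [H.IsCartanSubalgebra]
  {Δ : (rootSystem H).Base} {B : Type*} [CommRing B] [Algebra ℂ B]
  {ψ : GradedHom n H B}

lemma cartan_gPlus_mem {M : Type*} [AddCommGroup M] [Module ℂ M]
    {a : Tau1 n g B →ₗ[ℂ] Module.End ℂ M} {W : Submodule ℂ M}
    (hplus : ∀ c, ∀ x ∈ gPlus Δ, ∀ w ∈ W, a (ct c x) w = 0)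
    (hcart : ∀ y : Cartan1 n H B, ∀ w ∈ W, a (inclCartan y) w ∈ W) (c : Coeff n B) (x : g)
    (hx : x ∈ H.toSubmodule ⊔ gPlus Δ) (w : M) (hw : w ∈ W) : a (ct c x) w ∈ W := by
  obtain ⟨h, hh, p, hp, rfl⟩ := Submodule.mem_sup.mp hx
  rw [map_add, map_add, LinearMap.add_apply, hplus c p hp w hw, add_zero]
  exact hcart (ct c (⟨h, hh⟩ : H)) w hw

lemma actCartan_apply (x : Cartan1 n H B) (w : ψ.image) :
    ψ.actCartan x w = ψ.toAlgHom.rangeRestrict (UniversalEnvelopingAlgebra.ι ℂ x) * w := rfl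

/-- On a copy of `A_ψ`, `U(h_1)` acts by multiplication through the morphism. -/
lemma cartanAct_map_image {M : Type*} [AddCommGroup M] [Module ℂ M]
    {a : Tau1 n g B →ₗ[ℂ] Module.End ℂ M} (ha : ∀ x y, a x * a y - a y * a x = a ⁅x, y⁆)
    {T : ψ.image →ₗ[ℂ] M} (hcart : ∀ x w, a (inclCartan x) (T w) = T (ψ.actCartan x w))
    (u : UniversalEnvelopingAlgebra ℂ (Cartan1 n H B)) (w : ψ.image) :
    cartanAct ha u (T w) = T (ψ.toAlgHom.rangeRestrict u * w) := by
  let S : Subalgebra ℂ (UniversalEnvelopingAlgebra ℂ (Cartan1 n H B)) :=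
    { carrier := {u | ∀ w, cartanAct ha u (T w) = T (ψ.toAlgHom.rangeRestrict u * w)}
      mul_mem' := fun {u v} hu hv w => by
        rw [map_mul, Module.End.mul_apply, hv, hu, map_mul ψ.toAlgHom.rangeRestrict, mul_assoc]
      add_mem' := fun {u v} hu hv w => by
        rw [map_add, map_add, LinearMap.add_apply, hv, hu, add_mul, map_add]
      algebraMap_mem' := fun r w => by
        rw [AlgHom.commutes, AlgHom.commutes, Module.algebraMap_end_apply, Algebra.algebraMap_eq_smul_one,
          smul_mul_assoc, one_mul, map_smul] }
  refine GradedHom.uea_induction S (fun x w => ?_) u w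
  rw [cartanAct_ι, hcart, actCartan_apply]

/-- A module generated by a copy of `A_ψ` of highest weight vectors: the proper submodules are
killed by every equivariant map that is injective on that copy and whose image is irreducible. -/
lemma le_ker_of_ne_top {M V : Type*} [AddCommGroup M] [Module ℂ M] [AddCommGroup V] [Module ℂ V]
    {aM : Tau1 n g B →ₗ[ℂ] Module.End ℂ M} (haM : ∀ x y, aM x * aM y - aM y * aM x = aM ⁅x, y⁆)
    {DM : (Fin (n + 1) → ℂ) →ₗ[ℂ] Module.End ℂ M}
    (hDM : ∀ c u, DM c * aM u - aM u * DM c = aM (degTau1 n g B c u))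
    {T : ψ.image →ₗ[ℂ] M} (hplus : ∀ c, ∀ x ∈ gPlus Δ, ∀ w, aM (ct c x) (T w) = 0)
    (hcart : ∀ x w, aM (inclCartan x) (T w) = T (ψ.actCartan x w))
    (hdeg : ∀ c w, DM c (T w) = T (ψ.actD c w)) {ζ : ℂ}
    (hζ : ψ.toAlgHom.rangeRestrict
      (UniversalEnvelopingAlgebra.ι ℂ (ct 1 (heightCoweight Δ) : Cartan1 n H B)) = ζ • 1)
    (hgen : ∀ S : Submodule ℂ M, (∀ w, T w ∈ S) → (∀ u, ∀ s ∈ S, aM u s ∈ S) →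
      (∀ c, ∀ s ∈ S, DM c s ∈ S) → S = ⊤)
    {Φ : M →ₗ[ℂ] V} (hinj : Function.Injective fun w => Φ (T w))
    (hirr : ∀ S : Submodule ℂ M, (∀ u, ∀ s ∈ S, aM u s ∈ S) → (∀ c, ∀ s ∈ S, DM c s ∈ S) →
      ¬ S ≤ LinearMap.ker Φ → S ⊔ LinearMap.ker Φ = ⊤)
    (hker : ∀ u, ∀ s ∈ LinearMap.ker Φ, aM u s ∈ LinearMap.ker Φ)
    {N : Submodule ℂ M} (hNa : ∀ u, ∀ s ∈ N, aM u s ∈ N) (hND : ∀ c, ∀ s ∈ N, DM c s ∈ N)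
    (hN : N ≠ ⊤) : N ≤ LinearMap.ker Φ := by
  by_contra hle
  refine hN ?_
  have hW : ∀ w ∈ LinearMap.range T, heightOp Δ aM w = ζ • w := by
    rintro _ ⟨w, rfl⟩
    rw [heightOp, ← inclCartan_ct, hcart, actCartan_apply, hζ, smul_mul_assoc, one_mul, map_smul]
  have hst := opClosure_lowering_stable Δ haM (D := Set.range DM) (W := LinearMap.range T)
    (cartan_gPlus_mem (by rintro c x hx _ ⟨w, rfl⟩; exact hplus c x hx w)
      (by rintro y _ ⟨w, rfl⟩; exact ⟨_, (hcart y w).symm⟩))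
    (by rintro _ ⟨c, rfl⟩ _ ⟨w, rfl⟩; exact ⟨_, (hdeg c w).symm⟩)
    (by
      rintro _ ⟨c', rfl⟩ c f hf
      rw [hDM]
      induction c using coeff_induction with
      | hm m b =>
        rw [degTau1_ct, map_smul]
        exact Submodule.smul_mem _ _ (mem_lowering Δ _ hf)
      | ha x y h1 h2 =>
        rw [map_add, LinearMap.add_apply, map_add, map_add]
        exact add_mem h1 h2)
  have htop := hgen _ (fun w => le_opClosure (lowering Δ aM : Set _) (LinearMap.range T) ⟨w, rfl⟩)
    hst.1 fun c => hst.2 _ ⟨c, rfl⟩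
  have hdec : ∀ m : M, ∃ w l, l ∈ lowPart (heightOp Δ aM) ζ ∧ m = T w + l := by
    intro m
    have hm : m ∈ opClosure (lowering Δ aM : Set _) (LinearMap.range T) := by rw [htop]; trivial
    obtain ⟨_, ⟨w, rfl⟩, l, hl, rfl⟩ := Submodule.mem_sup.mp (opClosure_lowering_le Δ haM hW hm)
    exact ⟨w, l, hl, rfl⟩
  -- some `p ∈ N` has the same image as `T 1`; its top component also lies in `N`
  have h1 : T 1 ∈ N ⊔ LinearMap.ker Φ := by rw [hirr N hNa hND hle]; trivial
  obtain ⟨p, hp, k, hk, hpk⟩ := Submodule.mem_sup.mp h1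
  obtain ⟨w, l, hl, rfl⟩ := hdec p
  have hwN : T w ∈ N := mem_of_add_lowPart_mem (hNa _) (hW _ ⟨w, rfl⟩) hl hp
  -- the top component of `k = T (1 - w) - l` lies in the kernel
  have hk' : k = T (1 - w) + -l := by rw [map_sub, ← hpk]; abel
  rw [hk'] at hk
  have h2 : T (1 - w) ∈ LinearMap.ker Φ :=
    mem_of_add_lowPart_mem (hker _) (hW _ ⟨_, rfl⟩) (Submodule.neg_mem _ hl) hk
  have h3 : 1 - w = 0 := hinj (by
    change Φ (T (1 - w)) = Φ (T 0)
    rw [map_zero, map_zero]; exact h2)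
  have h4 : T 1 ∈ N := by rwa [sub_eq_zero.mp h3]
  refine hgen N (fun w => ?_) hNa hND
  obtain ⟨u, rfl⟩ := ψ.toAlgHom.rangeRestrict_surjective w
  rw [← mul_one (ψ.toAlgHom.rangeRestrict u), ← cartanAct_map_image haM hcart]
  exact cartanAct_mem haM (fun x => hNa _) u h4

end Maximal

/-! ### Identification with `V(ψ̄)` -/

namespace IsHighestWeightSystem

attribute [local instance] LieRing.ofAssociativeRing

open LieAlgebra LieAlgebra.IsKilling LieModule

variable {n : ℕ} {g : Type*} [LieRing g] [LieAlgebra ℂ g] [FiniteDimensional ℂ g]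
  [LieAlgebra.IsSimple ℂ g] {H : LieSubalgebra ℂ g} [H.IsCartanSubalgebra]
  {Δ : (rootSystem H).Base} {B : Type*} [CommRing B] [Algebra ℂ B]
  {V : Type*} [AddCommGroup V] [Module ℂ V]
  {a : Tau1 n g B →ₗ[ℂ] Module.End ℂ V} {D : (Fin (n + 1) → ℂ) →ₗ[ℂ] Module.End ℂ V}
  {lam : Module.Dual ℂ H} {v₀ : V} (hh : IsHighestWeightSystem Δ a D lam v₀)
  {ψ : GradedHom n H B} {Θ : ψ.image →ₗ[ℂ] V}
  (hΘ : ∀ u, Θ (ψ.toAlgHom.rangeRestrict u) = cartanAct hh.comm u v₀)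

include hh hΘ

lemma plus_image (c : Coeff n B) {x : g} (hx : x ∈ gPlus Δ) (w : ψ.image) :
    a (ct c x) (Θ w) = 0 := by
  obtain ⟨u, rfl⟩ := ψ.toAlgHom.rangeRestrict_surjective w
  rw [hΘ, hh.plus_cartanAct u c hx]

lemma cartan_image (x : Cartan1 n H B) (w : ψ.image) :
    a (inclCartan x) (Θ w) = Θ (ψ.actCartan x w) := by
  obtain ⟨u, rfl⟩ := ψ.toAlgHom.rangeRestrict_surjective w
  rw [actCartan_apply, ← map_mul ψ.toAlgHom.rangeRestrict, hΘ, hΘ, map_mul, Module.End.mul_apply,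
    cartanAct_ι]

/-- The embedding of `A_ψ` respects the degree derivations, because the morphism is graded. -/
lemma deg_image (c : Fin (n + 1) → ℂ) (w : ψ.image) : D c (Θ w) = Θ (ψ.actD c w) := by
  obtain ⟨u, rfl⟩ := ψ.toAlgHom.rangeRestrict_surjective w
  have hu : u ∈ ⨆ m, gradedPiece n H B m := by rw [iSup_gradedPiece]; trivial
  refine Submodule.iSup_induction _ (motive := fun u => D c (Θ (ψ.toAlgHom.rangeRestrict u)) =
    Θ (ψ.actD c (ψ.toAlgHom.rangeRestrict u))) hu (fun m u hu => ?_) ?_ fun x y h1 h2 => ?_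
  · have h1 := (hh.cartanAct_mem_hwSpace hu hh.mem).2 c
    rw [zero_add] at h1
    have h2 : ψ.actD c (ψ.toAlgHom.rangeRestrict u) =
        (∑ i, c i * (m i : ℂ)) • ψ.toAlgHom.rangeRestrict u := by
      obtain ⟨r, hr⟩ := Submodule.mem_span_singleton.mp (ψ.graded m u hu)
      refine Subtype.ext ?_
      change deg n c (ψ.toAlgHom u) = (∑ i, c i * (m i : ℂ)) • ψ.toAlgHom u
      rw [← hr, map_smul, deg_mono, smul_comm]
    rw [h2, map_smul, hΘ, h1]
  · rw [map_zero, map_zero, map_zero, map_zero, map_zero]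
  · rw [map_add, map_add, map_add, map_add, map_add, h1, h2]

lemma apply_one : Θ 1 = v₀ := by
  have h1 := hΘ 1
  rwa [map_one ψ.toAlgHom.rangeRestrict, map_one (cartanAct hh.comm), Module.End.one_apply] at h1

/-- The height coweight has degree zero, and is sent to a scalar. -/
lemma heightCoweight_image (hinj : Function.Injective Θ) : ψ.toAlgHom.rangeRestrict
    (UniversalEnvelopingAlgebra.ι ℂ (ct 1 (heightCoweight Δ) : Cartan1 n H B)) =
      lam (heightCoweight Δ) • 1 := by
  refine hinj ?_
  rw [hΘ, cartanAct_ι, map_smul, apply_one hh hΘ, inclCartan_ct]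
  exact hh.mem.1 _

/-- An irreducible highest weight module of `τ̃_1` is the module `V(ψ̄)` of its highest weight. -/
theorem exists_equiv_vGraded (hinj : Function.Injective Θ) :
    ∃ f : V ≃ₗ[ℂ] VGraded Δ ψ, ∀ x v, f (tau1DAct a D x v) = ⁅x, f v⁆ := by
  obtain ⟨Φ, hΦΘ, hΦ⟩ := mGraded_lift Δ ψ (tau1DAct a D)
    (tau1DAct_comm hh.comm hh.comm_deg hh.comm_D) Θ
    (fun y w => by
      rw [tau1DAct_ofTau1]
      exact ct_lie_plus Δ (fun c x hx => hh.plus_image hΘ c hx w) y)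
    (fun x w => by rw [tau1DAct_ofTau1, hh.cartan_image hΘ])
    (fun c w => by rw [tau1DAct_ofD, hh.deg_image hΘ])
  have hnt : Nontrivial V := ⟨v₀, 0, hh.ne_zero⟩
  have hΦa : ∀ u m, Φ ⁅(Tau1D.ofTau1 u : Tau1D n g B), m⁆ = a u (Φ m) := fun u m => by
    rw [hΦ, tau1DAct_ofTau1]
  have hΦD : ∀ c m, Φ ⁅(Tau1D.ofD c : Tau1D n g B), m⁆ = D c (Φ m) := fun c m => by
    rw [hΦ, tau1DAct_ofD]
  -- by irreducibility, the image of a submodule under `Φ` is zero or everything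
  have himg : ∀ S : Submodule ℂ (MGraded Δ ψ),
      (∀ u, ∀ s ∈ S, ⁅(Tau1D.ofTau1 u : Tau1D n g B), s⁆ ∈ S) →
      (∀ c, ∀ s ∈ S, ⁅(Tau1D.ofD c : Tau1D n g B), s⁆ ∈ S) →
      ¬ S ≤ LinearMap.ker Φ → S.map Φ = ⊤ := by
    intro S h1 h2 h3
    refine hh.irr _ ?_ ?_ fun h => h3 ?_
    · rintro u _ ⟨s, hs, rfl⟩
      exact ⟨_, h1 u s hs, hΦa u s⟩
    · rintro c _ ⟨s, hs, rfl⟩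
      exact ⟨_, h2 c s hs, hΦD c s⟩
    · exact LinearMap.le_ker_iff_map.mpr h
  have hsurj : Function.Surjective Φ := by
    rw [← LinearMap.range_eq_top, LinearMap.range_eq_map]
    refine himg ⊤ (fun _ _ _ => trivial) (fun _ _ _ => trivial) fun h => hh.ne_zero ?_
    rw [← hh.apply_one hΘ, ← hΦΘ]
    exact h trivial
  refine exists_equiv_irredQuotient Φ hsurj hΦ fun N hN => ?_
  let aM : Tau1 n g B →ₗ[ℂ] Module.End ℂ (MGraded Δ ψ) :=
    lieAct (Tau1D n g B) (MGraded Δ ψ) ∘ₗ Tau1D.ofTau1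
  let DM : (Fin (n + 1) → ℂ) →ₗ[ℂ] Module.End ℂ (MGraded Δ ψ) :=
    lieAct (Tau1D n g B) (MGraded Δ ψ) ∘ₗ Tau1D.ofD
  have haM : ∀ x y, aM x * aM y - aM y * aM x = aM ⁅x, y⁆ := fun x y => by
    change lieAct _ _ _ * lieAct _ _ _ - lieAct _ _ _ * lieAct _ _ _ = lieAct _ _ (Tau1D.ofTau1 _)
    rw [lieAct_comm, tau1D_ofTau1_lie]
  have hDM : ∀ c u, DM c * aM u - aM u * DM c = aM (degTau1 n g B c u) := fun c u => by
    change lieAct _ _ _ * lieAct _ _ _ - lieAct _ _ _ * lieAct _ _ _ = lieAct _ _ (Tau1D.ofTau1 _)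
    rw [lieAct_comm, tau1D_ofD_lie]
  refine le_ker_of_ne_top (Δ := Δ) (aM := aM) haM (DM := DM) hDM (T := gradedTop Δ ψ)
    (fun c x hx w => plus_lie_gradedTop Δ ψ (c ⊗ₜ ⟨x, hx⟩) w)
    (cartan_lie_gradedTop Δ ψ) (deg_lie_gradedTop Δ ψ)
    (hh.heightCoweight_image hΘ hinj) ?_ (Φ := Φ) ?_ ?_ ?_
    (fun u s hs => N.lie_mem hs) (fun c s hs => N.lie_mem hs) ?_
  · intro S h1 h2 h3
    refine mGraded_eq_top Δ S h1 fun x s hs => ?_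
    rw [tau1D_eq x, add_lie]
    exact S.add_mem (h2 _ s hs) (h3 _ s hs)
  · intro w w' hw
    refine hinj ?_
    have h1 : Φ (gradedTop Δ ψ w) = Φ (gradedTop Δ ψ w') := hw
    rwa [hΦΘ, hΦΘ] at h1
  · intro S h1 h2 h3
    rw [← Submodule.comap_map_eq, himg S h1 h2 h3, Submodule.comap_top]
  · intro u s hs
    change Φ ⁅(Tau1D.ofTau1 u : Tau1D n g B), s⁆ = 0
    rw [hΦa, show Φ s = 0 from hs, map_zero]
  · intro h
    exact hN ((LieSubmodule.toSubmodule_inj N ⊤).mp h)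

end IsHighestWeightSystem

/-! ### The module `V(E(1) ∘ ψ̄)` -/

section EvalOne

variable {n : ℕ}

lemma evalOne_mono (m : Fin (n + 1) → ℤ) : GradedHom.evalOne n (mono m) = 1 :=
  (AddMonoidAlgebra.basis (Fin (n + 1) → ℤ) ℂ).constr_basis ℂ (fun _ => (1 : ℂ)) m

lemma evalOne_one : GradedHom.evalOne n 1 = 1 := evalOne_mono 0

lemma evalOne_mul (x y : Laurent n) :
    GradedHom.evalOne n (x * y) = GradedHom.evalOne n x * GradedHom.evalOne n y := by
  induction x using laurent_induction with
  | hm m =>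
    induction y using laurent_induction with
    | hm k => rw [mono_mul_mono, evalOne_mono, evalOne_mono, evalOne_mono, one_mul]
    | ha x y hx hy => rw [mul_add, map_add, hx, hy, map_add, mul_add]
    | hs r x hx => rw [mul_smul_comm, map_smul, hx, map_smul, smul_eq_mul, smul_eq_mul, mul_left_comm]
  | ha x y hx hy => rw [add_mul, map_add, hx, hy, map_add, add_mul]
  | hs r x hx => rw [smul_mul_assoc, map_smul, hx, map_smul, smul_eq_mul, smul_eq_mul, mul_assoc]

end EvalOne

section Quotient

variable {n : ℕ} {g : Type*} [LieRing g] [LieAlgebra ℂ g] {B : Type*} [CommRing B] [Algebra ℂ B]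
  {V : Type*} [AddCommGroup V] [Module ℂ V]

/-- The operators induced on the quotient by a stable subspace. -/
noncomputable def quotAct (a : Tau1 n g B →ₗ[ℂ] Module.End ℂ V) {W : Submodule ℂ V}
    (hW : ∀ u, ∀ s ∈ W, a u s ∈ W) : Tau1 n g B →ₗ[ℂ] Module.End ℂ (V ⧸ W) where
  toFun u := W.mapQ W (a u) fun s hs => hW u s hs
  map_add' u v := by
    refine LinearMap.ext fun x => ?_
    obtain ⟨x, rfl⟩ := W.mkQ_surjective x
    change W.mkQ (a (u + v) x) = W.mkQ (a u x) + W.mkQ (a v x)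
    rw [map_add, LinearMap.add_apply, map_add]
  map_smul' r u := by
    refine LinearMap.ext fun x => ?_
    obtain ⟨x, rfl⟩ := W.mkQ_surjective x
    change W.mkQ (a (r • u) x) = r • W.mkQ (a u x)
    rw [map_smul, LinearMap.smul_apply, map_smul]

lemma quotAct_mkQ (a : Tau1 n g B →ₗ[ℂ] Module.End ℂ V) {W : Submodule ℂ V}
    (hW : ∀ u, ∀ s ∈ W, a u s ∈ W) (u : Tau1 n g B) (x : V) :
    quotAct a hW u (W.mkQ x) = W.mkQ (a u x) := rfl

lemma quotAct_pow_mkQ (a : Tau1 n g B →ₗ[ℂ] Module.End ℂ V) {W : Submodule ℂ V}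
    (hW : ∀ u, ∀ s ∈ W, a u s ∈ W) (u : Tau1 n g B) (k : ℕ) (x : V) :
    ((quotAct a hW u) ^ k) (W.mkQ x) = W.mkQ (((a u) ^ k) x) := by
  induction k with
  | zero => rfl
  | succ k ih =>
    rw [pow_succ', Module.End.mul_apply, ih, quotAct_mkQ, pow_succ', Module.End.mul_apply]

lemma quotAct_comm {a : Tau1 n g B →ₗ[ℂ] Module.End ℂ V} {W : Submodule ℂ V}
    (hW : ∀ u, ∀ s ∈ W, a u s ∈ W) (ha : ∀ x y, a x * a y - a y * a x = a ⁅x, y⁆)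
    (x y : Tau1 n g B) :
    quotAct a hW x * quotAct a hW y - quotAct a hW y * quotAct a hW x = quotAct a hW ⁅x, y⁆ := by
  refine LinearMap.ext fun m => ?_
  obtain ⟨m, rfl⟩ := W.mkQ_surjective m
  rw [LinearMap.sub_apply, Module.End.mul_apply, Module.End.mul_apply]
  simp only [quotAct_mkQ]
  rw [← ha, LinearMap.sub_apply, map_sub]
  rfl

end Quotient

namespace IsHighestWeightSystem

attribute [local instance] LieRing.ofAssociativeRing

open LieAlgebra LieAlgebra.IsKilling LieModule

variable {n : ℕ} {g : Type*} [LieRing g] [LieAlgebra ℂ g] [FiniteDimensional ℂ g]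
  [LieAlgebra.IsSimple ℂ g] {H : LieSubalgebra ℂ g} [H.IsCartanSubalgebra]
  {Δ : (rootSystem H).Base} {B : Type*} [CommRing B] [Algebra ℂ B]
  {V : Type*} [AddCommGroup V] [Module ℂ V]
  {a : Tau1 n g B →ₗ[ℂ] Module.End ℂ V} {D : (Fin (n + 1) → ℂ) →ₗ[ℂ] Module.End ℂ V}
  {lam : Module.Dual ℂ H} {v₀ : V} (hh : IsHighestWeightSystem Δ a D lam v₀)
  {ψ : GradedHom n H B} {Θ : ψ.image →ₗ[ℂ] V}
  (hΘ : ∀ u, Θ (ψ.toAlgHom.rangeRestrict u) = cartanAct hh.comm u v₀)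

include hh

/-- A submodule for `τ_1` that contains the highest weight vector is everything. -/
lemma eq_top_of_mem {S : Submodule ℂ V} (hv : v₀ ∈ S) (hS : ∀ u, ∀ s ∈ S, a u s ∈ S) : S = ⊤ := by
  let W : Submodule ℂ V :=
    LinearMap.range ((LinearMap.applyₗ v₀ : Module.End ℂ V →ₗ[ℂ] V) ∘ₗ
      (cartanAct (H := H) hh.comm).toLinearMap)
  have hW : ∀ u, cartanAct (H := H) hh.comm u v₀ ∈ W := fun u => ⟨u, rfl⟩
  obtain ⟨h1, h2, -⟩ := hh.opClosure_lowering (W := W)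
    (by rintro _ ⟨u, rfl⟩; exact ⟨u, rfl⟩)
    (by
      rintro y _ ⟨u, rfl⟩
      refine ⟨UniversalEnvelopingAlgebra.ι ℂ y * u, ?_⟩
      change cartanAct hh.comm _ v₀ = a (inclCartan y) (cartanAct hh.comm u v₀)
      rw [map_mul, Module.End.mul_apply, cartanAct_ι])
  have hD : ∀ c, ∀ w ∈ W, D c w ∈ W := by
    rintro c _ ⟨u, rfl⟩
    have hu : u ∈ ⨆ m, gradedPiece n H B m := by rw [iSup_gradedPiece]; trivial
    change D c (cartanAct hh.comm u v₀) ∈ W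
    refine Submodule.iSup_induction _ (motive := fun u => D c (cartanAct hh.comm u v₀) ∈ W) hu
      (fun k u hu => ?_) ?_ (fun x y h1 h2 => ?_)
    · rw [(hh.cartanAct_mem_hwSpace hu hh.mem).2]
      exact Submodule.smul_mem _ _ (hW u)
    · rw [map_zero, LinearMap.zero_apply, map_zero]; exact zero_mem _
    · rw [map_add, LinearMap.add_apply, map_add]; exact add_mem h1 h2
  have hv₀ : v₀ ∈ W := by
    have h3 := hW 1
    rwa [map_one, Module.End.one_apply] at h3
  have htop := hh.irr _ h1 (h2 hD) fun hbot => hh.ne_zero (by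
    have h4 := le_opClosure (lowering Δ a : Set _) W hv₀
    rwa [hbot, Submodule.mem_bot] at h4)
  have hWS : W ≤ S := by
    rintro _ ⟨u, rfl⟩
    exact cartanAct_mem hh.comm (fun x => hS _) u hv
  have hle : opClosure (lowering Δ a : Set _) W ≤ S := by
    refine opClosure_le hWS fun y hy s hs => ?_
    have hy' : y ∈ Submodule.span ℂ {y | ∃ c, ∃ f ∈ gMinus Δ, y = a (ct c f)} := hy
    clear hy
    induction hy' using Submodule.span_induction with
    | mem z hz => obtain ⟨c, f, -, rfl⟩ := hz; exact hS _ s hs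
    | zero => exact zero_mem S
    | add y z _ _ h1 h2 => exact add_mem h1 h2
    | smul r y _ h => exact S.smul_mem r h
  rwa [htop, top_le_iff] at hle

include hΘ

/-- The quotient of an irreducible integrable highest weight module by the submodule generated by
the vectors of the highest weight part on which `E(1)` vanishes is an integrable highest weight
module of highest weight `E(1) ∘ ψ̄`. -/
theorem irreducible_finiteDimensional_evalAtOne [Algebra.FiniteType ℂ B]
    (hinj : Function.Injective Θ) :
    IsIrreducible ℂ (Tau1 n g B) (VNongraded Δ ψ.evalAtOne) ∧
      FiniteDimensional ℂ (VNongraded Δ ψ.evalAtOne) := by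
  let E : ψ.image →ₗ[ℂ] ℂ := GradedHom.evalOne n ∘ₗ (Subalgebra.toSubmodule ψ.image).subtype
  have hE1 : E 1 = 1 := evalOne_one
  have hEmul : ∀ x y, E (x * y) = E x * E y := fun x y => evalOne_mul (x : Laurent n) y
  let W₀ : Submodule ℂ V := (LinearMap.ker E).map Θ
  obtain ⟨hW, -, hmem⟩ := hh.opClosure_lowering (W := W₀)
    (by
      rintro _ ⟨w, -, rfl⟩
      obtain ⟨u, rfl⟩ := ψ.toAlgHom.rangeRestrict_surjective w
      exact ⟨u, hΘ u⟩)
    (by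
      rintro y _ ⟨w, hw, rfl⟩
      rw [hh.cartan_image hΘ]
      refine ⟨_, ?_, rfl⟩
      change E _ = 0
      rw [actCartan_apply, hEmul, show E w = 0 from hw, mul_zero])
  let W : Submodule ℂ V := opClosure (lowering Δ a : Set _) W₀
  have hW₀ : W₀ ≤ W := le_opClosure _ _
  -- the highest weight part of `W` is `W₀`, which misses `1` because `E(1) 1 = 1`
  have hv : v₀ ∉ W := by
    intro h
    have h1 := hmem 1 (by rwa [map_one, Module.End.one_apply])
    rw [map_one, Module.End.one_apply] at h1
    obtain ⟨w, hw, hw'⟩ := h1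
    have h2 : w = 1 := hinj (hw'.trans (hh.apply_one hΘ).symm)
    have h3 : E w = 0 := hw
    rw [h2, hE1] at h3
    exact one_ne_zero h3
  refine irreducible_finiteDimensional_vNongraded Δ ψ.evalAtOne (U := V ⧸ W) (a := quotAct a hW)
    (quotAct_comm hW hh.comm) (v := W.mkQ v₀) ?_ ?_ ?_ ?_ ?_
  · intro h
    exact hv ((Submodule.Quotient.mk_eq_zero W).mp h)
  · intro S hS hst
    have h1 : S.comap W.mkQ = ⊤ := hh.eq_top_of_mem hS fun u s hs => hst u _ hs
    rw [eq_top_iff]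
    rintro x -
    obtain ⟨x, rfl⟩ := W.mkQ_surjective x
    have h2 : x ∈ S.comap W.mkQ := by rw [h1]; trivial
    exact h2
  · intro c x hx
    rw [quotAct_mkQ, hh.plus c x hx, map_zero]
  · intro x
    rw [quotAct_mkQ, ← map_smul, ← sub_eq_zero, ← map_sub]
    refine (Submodule.Quotient.mk_eq_zero W).mpr (hW₀ ?_)
    rw [← hh.apply_one hΘ, hh.cartan_image hΘ, ← map_smul, ← map_sub]
    refine ⟨_, ?_, rfl⟩
    change E _ = 0
    rw [map_sub, map_smul, hE1, actCartan_apply, mul_one, smul_eq_mul, mul_one]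
    exact sub_self _
  · intro i x hx m b w
    obtain ⟨w, rfl⟩ := W.mkQ_surjective w
    obtain ⟨k, hk⟩ := hh.nilpotent i x hx m b w
    exact ⟨k, by rw [quotAct_pow_mkQ, hk, map_zero]⟩

omit hΘ in
/-- An irreducible integrable highest weight module of `τ̃_1` is `V(ψ̄)` for a graded morphism
`ψ̄` such that `V(E(1) ∘ ψ̄)` is irreducible and finite-dimensional. -/
theorem exists_gradedHom_equiv [Algebra.FiniteType ℂ B] : ∃ ψ : GradedHom n H B,
    (∃ f : V ≃ₗ[ℂ] VGraded Δ ψ, ∀ x v, f (tau1DAct a D x v) = ⁅x, f v⁆) ∧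
      IsIrreducible ℂ (Tau1 n g B) (VNongraded Δ ψ.evalAtOne) ∧
      FiniteDimensional ℂ (VNongraded Δ ψ.evalAtOne) := by
  obtain ⟨ψ, Θ, hinj, hΘ⟩ := hh.exists_gradedHom
  exact ⟨ψ, hh.exists_equiv_vGraded hΘ hinj, hh.irreducible_finiteDimensional_evalAtOne hΘ hinj⟩

end IsHighestWeightSystem

/-! ### Integrable modules of level zero -/

section Integrable

open LieAlgebra LieAlgebra.IsKilling LieModule

/-- The linear map `c ↦ ∑ i, c_i d_i` to scalar operators. -/
noncomputable def scalarDeg {n : ℕ} (V : Type*) [AddCommGroup V] [Module ℂ V]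
    (d : Fin (n + 1) → ℂ) : (Fin (n + 1) → ℂ) →ₗ[ℂ] Module.End ℂ V where
  toFun c := (∑ i, c i * d i) • 1
  map_add' c c' := by
    simp only [Pi.add_apply, add_mul, Finset.sum_add_distrib, add_smul]
  map_smul' r c := by
    simp only [Pi.smul_apply, smul_eq_mul, mul_assoc, ← Finset.mul_sum, RingHom.id_apply,
      mul_smul]

lemma scalarDeg_apply {n : ℕ} {V : Type*} [AddCommGroup V] [Module ℂ V]
    (d c : Fin (n + 1) → ℂ) (v : V) : scalarDeg V d c v = (∑ i, c i * d i) • v := rfl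

variable {n : ℕ} {g : Type*} [LieRing g] [LieAlgebra ℂ g] [FiniteDimensional ℂ g]
  [LieAlgebra.IsSimple ℂ g] {H : LieSubalgebra ℂ g} [H.IsCartanSubalgebra]
  {B : Type*} [CommRing B] [Algebra ℂ B] {F : InvariantForm g}
  {V : Type*} [AddCommGroup V] [Module ℂ V] [LieRingModule (Tau n B F) V]
  [LieModule ℂ (Tau n B F) V]

/-- After shifting the action of `D` by scalars, a highest weight vector of an irreducible
integrable module of level zero makes it a highest weight system. -/
lemma isHighestWeightSystem_of_integrable {Δ : (rootSystem H).Base}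
    (hirr : LieModule.IsIrreducible ℂ (Tau n B F) V) (hint : IsIntegrable n B F H V)
    (hfin : ∀ lam : Module.Dual ℂ (FullCartan n H), FiniteDimensional ℂ (weightSpace n B F H V lam))
    (hK : ∀ (i : Fin (n + 1)) (v : V),
      ⁅Tau.ofZB F (centralK n (Pi.single i 1) ⊗ₜ[ℂ] (1 : B)), v⁆ = 0)
    (hZ : ∀ z, aZ n B F V z = 0) {lam : Module.Dual ℂ H} {d : Fin (n + 1) → ℂ} {v : V}
    (hv : v ≠ 0) (hvw : v ∈ wt n B F V H lam d)
    (hplus : ∀ i : H.root, Δ.IsPos i →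
      ∀ x ∈ rootSpace H (i : Weight ℂ H g), ∀ c, aT n B F V (ct c x) v = 0) :
    IsHighestWeightSystem Δ (aT n B F V) (aD n B F V - scalarDeg V d) lam v where
  comm x y := by rw [aT_comm, hZ, add_zero]
  comm_deg c u := by
    rw [LinearMap.sub_apply, ← aD_comm_aT, sub_mul, mul_sub]
    have h1 : scalarDeg V d c * aT n B F V u = aT n B F V u * scalarDeg V d c :=
      LinearMap.ext fun w => ((aT n B F V u).map_smul _ w).symm
    rw [h1]
    abel
  comm_D c c' := by
    have h1 : ∀ (c : Fin (n + 1) → ℂ) (y : Module.End ℂ V),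
        scalarDeg V d c * y = y * scalarDeg V d c :=
      fun c y => LinearMap.ext fun w => (y.map_smul _ w).symm
    rw [LinearMap.sub_apply, LinearMap.sub_apply, sub_mul, mul_sub, mul_sub, sub_mul, mul_sub,
      mul_sub, aD_comm_aD F c c', h1 c, h1 c, ← h1 c' (aD n B F V c)]
    abel
  irr S hT hD hS := by
    refine eq_top_of_stable F hirr S hS hT (fun z s _ => ?_) fun c s hs => ?_
    · rw [hZ, LinearMap.zero_apply]; exact zero_mem S
    · have h1 := add_mem (hD c s hs) (S.smul_mem (∑ i, c i * d i) hs)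
      rwa [LinearMap.sub_apply, LinearMap.sub_apply, scalarDeg_apply, sub_add_cancel] at h1
  ne_zero := hv
  plus c x hx := by
    refine gPlus_induction Δ (p := fun x => aT n B F V (ct c x) v = 0) hx
      (fun i hi y hy => hplus i hi y hy c) ?_ fun x y h1 h2 => ?_
    · rw [map_zero, map_zero, LinearMap.zero_apply]
    · rw [map_add, map_add, LinearMap.add_apply, h1, h2, add_zero]
  mem := by
    refine ⟨hvw.1, fun c => ?_⟩
    rw [LinearMap.sub_apply, LinearMap.sub_apply, scalarDeg_apply, hvw.2 c]
    simp
  nilpotent i x hx m b w := aT_nilpotent F hint i hx m b w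
  finite := by
    have h0 : hwSpace (aT n B F V) (aD n B F V - scalarDeg V d) lam 0 ≤ wt n B F V H lam d := by
      intro w hw
      refine (mem_wt F).mpr ⟨hw.1, fun c => ?_⟩
      have h1 := hw.2 c
      rw [LinearMap.sub_apply, LinearMap.sub_apply, scalarDeg_apply, sub_eq_iff_eq_add] at h1
      simpa using h1
    have := hfin (fullWeight lam d)
    exact Submodule.finiteDimensional_of_le (h0.trans (wt_le_weightSpace F hK lam d))

/-- The action of `τ(B)` in terms of that of `τ̃_1`, when `Z ⊗ B` acts by zero and the action of
`D` is shifted. -/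
lemma lie_eq_tau1DAct (hZ : ∀ z, aZ n B F V z = 0) (d : Fin (n + 1) → ℂ) (x : Tau n B F) (v : V) :
    ⁅x, v⁆ = tau1DAct (aT n B F V) (aD n B F V - scalarDeg V d) (Tau.proj F x) v +
      (∑ i, d i * x.dCoord i) • v := by
  have h2 : (∑ i, d i * x.dCoord i) = ∑ i, x.2.2 i * d i :=
    Finset.sum_congr rfl fun i _ => mul_comm _ _
  rw [lie_eq, hZ, tau1DAct_apply, h2]
  change _ = aT n B F V x.1 v + (aD n B F V x.2.2 v - (∑ i, x.2.2 i * d i) • v) + _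
  rw [LinearMap.zero_apply, add_zero, add_assoc, sub_add_cancel]

end Integrable

end LoopToroidal

set_option maxHeartbeats 1000000 in
open scoped TensorProduct in
open LoopToroidal in
theorem theorem5p1 (n : ℕ)
    {g : Type*} [LieRing g] [LieAlgebra ℂ g] [FiniteDimensional ℂ g] [LieAlgebra.IsSimple ℂ g]
    (H : LieSubalgebra ℂ g) [H.IsCartanSubalgebra]
    (Δ : (LieAlgebra.IsKilling.rootSystem H).Base) (F : InvariantForm g)
    {B : Type*} [CommRing B] [Algebra ℂ B] [Algebra.FiniteType ℂ B]
    (V : Type*) [AddCommGroup V] [Module ℂ V] [LieRingModule (Tau n B F) V]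
    [LieModule ℂ (Tau n B F) V]
    (hirr : LieModule.IsIrreducible ℂ (Tau n B F) V)
    (hint : IsIntegrable n B F H V)
    (hfin : ∀ lam : Module.Dual ℂ (FullCartan n H), FiniteDimensional ℂ (weightSpace n B F H V lam))
    (hK : ∀ (i : Fin (n + 1)) (v : V),
      ⁅Tau.ofZB F (centralK n (Pi.single i 1) ⊗ₜ[ℂ] (1 : B)), v⁆ = 0) :
    ∃ ψ : GradedHom n H B,
      (∃ (c : Fin (n + 1) → ℂ) (f : V ≃ₗ[ℂ] VGraded Δ ψ), ∀ (x : Tau n B F) (v : V),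
        f ⁅x, v⁆ = ⁅Tau.proj F x, f v⁆ + (∑ i, c i * x.dCoord i) • f v) ∧
      LieModule.IsIrreducible ℂ (Tau1 n g B) (VNongraded Δ ψ.evalAtOne) ∧
      FiniteDimensional ℂ (VNongraded Δ ψ.evalAtOne) := by
  obtain ⟨hZ, lam, d, v₀, hv, hvw, hplus⟩ := exists_highestWeightVector F Δ hirr hK hint hfin
  have hh := isHighestWeightSystem_of_integrable hirr hint hfin hK hZ hv hvw hplus
  obtain ⟨ψ, ⟨f, hf⟩, hV⟩ := hh.exists_gradedHom_equiv
  refine ⟨ψ, ⟨d, f, fun x v => ?_⟩, hV⟩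
  have h1 := congrArg f (lie_eq_tau1DAct hZ d x v)
  rw [map_add, map_smul, hf] at h1
  exact h1
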